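/- Let $p$ be a prime, $S$ a finite $p$-group and $\mathcal F$ a saturated fusion system over $S$ (saturation in the sense of Broto–Levi–Oliver). For finite groups $G,H$ let $A^+(G,H)$ be the commutative monoid, under disjoint union, of isomorphism classes of finite sets with commuting right $G$-action and free left $H$-action, let $A(G,H)$ be its Grothendieck group, and let $A(G,H)^\wedge_p = A(G,H)\otimes\mathbb Z_p$. Composition $X\circ Y = X\times_H Y$ extends bilinearly to $A(H,K)\times A(G,H)\to A(G,K)$ and to the $p$-completions, and makes $A(S,S)$ and $A(S,S)^\wedge_p$ into rings. For $P\le G$ and a homomorphism $\psi:P\to H$, $[P,\psi]_G^H$ denotes the class of $(H\times G)/\big((x,gy)\sim(x\psi(g),y),\ g\in P\big)$, and $\epsilon$ denotes the additive extension (resp. $\mathbb Z_p$-linear extension to the completion) of $X\mapsto|H\backslash X|$. An element $\Omega$ of $A(S,S)$ is a characteristic biset for $\mathcal F$ if it is the class of a biset and (a) $\Omega$ lies in the subgroup generated by the $[P,\varphi]_S^S$ with $P\le S$ and $\varphi\in\mathrm{Hom}_{\mathcal F}(P,S)$; (b1) $\Omega\circ[P,\varphi]_P^S=\Omega\circ[P,\iota_P]_P^S$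 for all $P\le S$ and $\varphi\in\mathrm{Hom}_{\mathcal F}(P,S)$, where $\iota_P$ is the inclusion; (b2) $[\varphi(P),\varphi^{-1}]_S^P\circ\Omega=[P,\mathrm{id}_P]_S^P\circ\Omega$ for all such $P,\varphi$; (c) $\epsilon(\Omega)\equiv1\pmod p$. A characteristic idempotent for $\mathcal F$ is an idempotent $\omega\in A(S,S)^\wedge_p$ that lies in the $\mathbb Z_p$-submodule generated by the $[P,\varphi]_S^S$ as in (a), satisfies (b1) and (b2) in the $p$-completed modules, and has $\epsilon(\omega)=1$. **Proposition.** $\mathcal F$ has a characteristic idempotent. More precisely, $\mathcal F$ has a characteristic biset $\Omega$ that is idempotent mod $p$, i.e. $\Omega^2-\Omega\in pA(S,S)$; and for every such $\Omega$ the sequence $\Omega,\Omega^{p},\Omega^{p^2},\dots$ converges $p$-adically in $A(S,S)^\wedge_p$ to a characteristic idempotent for $\mathcal F$. -/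

import Mathlib

open scoped TensorProduct

universe u

/-! ### Fusion systems over a finite `p`-group -/

/-- The homomorphism `c_g : P → Q`, `x ↦ g x g⁻¹`, for `g` in the transporter from `P` to `Q`. -/
def conjHom {S : Type u} [Group S] (g : S) (P Q : Subgroup S)
    (h : ∀ x ∈ P, g * x * g⁻¹ ∈ Q) : P →* Q where
  toFun x := ⟨g * x * g⁻¹, h x x.2⟩
  map_one' := by ext; simp
  map_mul' x y := by ext; simp

/-- A fusion system over `S`: a category whose objects are the subgroups of `S`, whose morphisms
are injective homomorphisms (composed as maps), which contains all homomorphisms induced by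
conjugation in `S` (in particular identities and inclusions), and in which every morphism is an
isomorphism of the category followed by an inclusion. -/
structure FusionSystem (S : Type u) [Group S] where
  /-- the set of morphisms from `P` to `Q` -/
  Hom : (P Q : Subgroup S) → Set (P →* Q)
  comp_mem : ∀ {P Q R : Subgroup S} {β : Q →* R} {α : P →* Q},
    β ∈ Hom Q R → α ∈ Hom P Q → β.comp α ∈ Hom P R
  conj_mem : ∀ (P Q : Subgroup S) (g : S) (h : ∀ x ∈ P, g * x * g⁻¹ ∈ Q),
    conjHom g P Q h ∈ Hom P Q
  injective : ∀ {P Q : Subgroup S} {φ : P →* Q}, φ ∈ Hom P Q → Function.Injective φ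
  factor : ∀ {P Q : Subgroup S} {φ : P →* Q}, φ ∈ Hom P Q →
    ∃ (R : Subgroup S) (hR : R ≤ Q) (e : P ≃* R),
      e.toMonoidHom ∈ Hom P R ∧ e.symm.toMonoidHom ∈ Hom R P ∧
        φ = (Subgroup.inclusion hR).comp e.toMonoidHom

namespace FusionSystem

variable {S : Type u} [Group S] (F : FusionSystem S)

/-- The isomorphisms `P → Q` of the category `F`. -/
def IsIso {P Q : Subgroup S} (e : P ≃* Q) : Prop :=
  e.toMonoidHom ∈ F.Hom P Q ∧ e.symm.toMonoidHom ∈ F.Hom Q P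

/-- The morphisms in `F` from `P` to the whole group `S`, as homomorphisms `P →* S`. -/
def HomS (P : Subgroup S) : Set (P →* S) :=
  {φ | φ.codRestrict (⊤ : Subgroup S) (fun _ => Subgroup.mem_top _) ∈ F.Hom P ⊤}

/-- `P` and `Q` are isomorphic in `F`. -/
def Conjugate (P Q : Subgroup S) : Prop := ∃ e : P ≃* Q, F.IsIso e

/-- `|C_S(P)| ≥ |C_S(P')|` for every `P'` that is `F`-conjugate to `P`. -/
def FullyCentralized (P : Subgroup S) : Prop :=
  ∀ P' : Subgroup S, F.Conjugate P' P →
    Nat.card (Subgroup.centralizer (P' : Set S)) ≤ Nat.card (Subgroup.centralizer (P : Set S))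

/-- `|N_S(P)| ≥ |N_S(P')|` for every `P'` that is `F`-conjugate to `P`. -/
def FullyNormalized (P : Subgroup S) : Prop :=
  ∀ P' : Subgroup S, F.Conjugate P' P →
    Nat.card (Subgroup.normalizer (P' : Set S)) ≤ Nat.card (Subgroup.normalizer (P : Set S))

theorem id_mem (P : Subgroup S) : MonoidHom.id P ∈ F.Hom P P := by
  have h := F.conj_mem P P 1 (by simp)
  have e : conjHom 1 P P (by simp) = MonoidHom.id P := by ext; simp [conjHom]
  rwa [e] at h

/-- The group `Aut_F(P)` of automorphisms of `P` in `F`. -/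
def autF (P : Subgroup S) : Subgroup (MulAut P) where
  carrier := {e | F.IsIso e}
  mul_mem' {_ _} ha hb := ⟨F.comp_mem ha.1 hb.1, F.comp_mem hb.2 ha.2⟩
  one_mem' := ⟨F.id_mem P, F.id_mem P⟩
  inv_mem' {_} ha := ⟨ha.2, ha.1⟩

/-- The group `Aut_S(P)` of automorphisms of `P` induced by conjugation by elements of `N_S(P)`. -/
def autS (P : Subgroup S) : Subgroup (MulAut P) := (Subgroup.normalizerMonoidHom P).range

/-- `N_φ`: the `g ∈ N_S(P)` such that `φ c_g φ⁻¹` is conjugation on `φ(P)` by some `h` in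
`N_S(φ(P))`, i.e. `φ (g x g⁻¹) = h φ(x) h⁻¹` for all `x ∈ P`. -/
def extender {P : Subgroup S} (φ : P →* S) : Subgroup S where
  carrier := {g | g ∈ Subgroup.normalizer (P : Set S) ∧
    ∃ h ∈ Subgroup.normalizer (φ.range : Set S),
      ∀ x y : P, (y : S) = g * x * g⁻¹ → φ y = h * φ x * h⁻¹}
  one_mem' := ⟨one_mem _, 1, one_mem _, fun x y hxy => by
    have : y = x := Subtype.ext (by simpa using hxy)
    simp [this]⟩
  mul_mem' := by
    rintro a b ⟨ha, h, hh, H⟩ ⟨hb, k, hk, K⟩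
    refine ⟨mul_mem ha hb, h * k, mul_mem hh hk, fun x y hxy => ?_⟩
    have hz : b * x * b⁻¹ ∈ P := (Subgroup.mem_normalizer_iff.1 hb x).1 x.2
    rw [H ⟨_, hz⟩ y (by rw [hxy]; simp [mul_assoc]), K x ⟨_, hz⟩ rfl]
    simp [mul_assoc]
  inv_mem' := by
    rintro a ⟨ha, h, hh, H⟩
    refine ⟨inv_mem ha, h⁻¹, inv_mem hh, fun x y hxy => ?_⟩
    rw [H y x (by rw [hxy]; simp [mul_assoc])]
    simp [mul_assoc]

theorem le_extender {P : Subgroup S} (φ : P →* S) : P ≤ extender φ := fun g hg =>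
  ⟨Subgroup.le_normalizer hg, φ ⟨g, hg⟩, Subgroup.le_normalizer ⟨_, rfl⟩, fun x y hxy => by
    have : y = ⟨g, hg⟩ * x * ⟨g, hg⟩⁻¹ := Subtype.ext hxy
    simp [this]⟩

/-- Saturation, in the form of Broto, Levi and Oliver. -/
structure IsSaturated (p : ℕ) : Prop where
  sylow : ∀ P : Subgroup S, F.FullyNormalized P →
    F.FullyCentralized P ∧ ¬ p ∣ (autS P).relIndex (F.autF P)
  extension : ∀ (P : Subgroup S) (φ : P →* S), φ ∈ F.HomS P → F.FullyCentralized φ.range →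
    ∃ ψ : extender φ →* S, ψ ∈ F.HomS (extender φ) ∧
      ψ.comp (Subgroup.inclusion (le_extender φ)) = φ

/-- A morphism `φ : P → S` of `F`, as an isomorphism onto its image `φ(P)`. -/
noncomputable def toImage {P : Subgroup S} (φ : F.HomS P) : P ≃* φ.1.range :=
  MonoidHom.ofInjective (f := φ.1) fun _ _ h =>
    F.injective φ.2 (Subtype.ext h)

end FusionSystem

/-! ### Bisets -/

/-- A finite `(G, H)`-biset: a finite set with a right `G`-action and a free left `H`-action that
commute. The right action `x · g` is `MulOpposite.op g • x`. -/
structure Biset (G H : Type u) [Group G] [Group H] where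
  carrier : Type u
  [finite : Finite carrier]
  [left : MulAction H carrier]
  [right : MulAction Gᵐᵒᵖ carrier]
  [comm : SMulCommClass H Gᵐᵒᵖ carrier]
  free : ∀ (h : H) (x : carrier), h • x = x → h = 1

namespace Biset

attribute [instance] Biset.finite Biset.left Biset.right Biset.comm

variable {G H K L : Type u} [Group G] [Group H] [Group K] [Group L]

/-- Isomorphism of bisets: a bijection that respects both actions. -/
def Iso (X Y : Biset G H) : Prop :=
  ∃ e : X.carrier ≃ Y.carrier, (∀ (h : H) x, e (h • x) = h • e x) ∧
    ∀ (g : Gᵐᵒᵖ) x, e (g • x) = g • e x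

instance setoid (G H : Type u) [Group G] [Group H] : Setoid (Biset G H) where
  r := Iso
  iseqv :=
    { refl := fun _ => ⟨Equiv.refl _, fun _ _ => rfl, fun _ _ => rfl⟩
      symm := by
        rintro X Y ⟨e, h1, h2⟩
        exact ⟨e.symm, fun h x => by rw [Equiv.symm_apply_eq, h1, Equiv.apply_symm_apply],
          fun h x => by rw [Equiv.symm_apply_eq, h2, Equiv.apply_symm_apply]⟩
      trans := by
        rintro X Y Z ⟨e, h1, h2⟩ ⟨f, k1, k2⟩
        exact ⟨e.trans f, fun h x => by simp [h1, k1], fun g x => by simp [h2, k2]⟩ }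

/-- The empty biset. -/
def empty (G H : Type u) [Group G] [Group H] : Biset G H :=
  letI : MulAction H PEmpty.{u + 1} :=
    { smul := fun _ x => x, one_smul := fun x => x.elim, mul_smul := fun _ _ x => x.elim }
  letI : MulAction Gᵐᵒᵖ PEmpty.{u + 1} :=
    { smul := fun _ x => x, one_smul := fun x => x.elim, mul_smul := fun _ _ x => x.elim }
  haveI : SMulCommClass H Gᵐᵒᵖ PEmpty.{u + 1} := ⟨fun _ _ x => x.elim⟩
  { carrier := PEmpty.{u + 1}
    free := fun _ x => x.elim }

/-- The disjoint union of two bisets. -/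
def sum (X Y : Biset G H) : Biset G H where
  carrier := X.carrier ⊕ Y.carrier
  free := by
    rintro h (x | x) hx
    · exact X.free h x (Sum.inl_injective hx)
    · exact Y.free h x (Sum.inr_injective hx)

/-- The relation `(x · g, y) ∼ (x, g · y)` on `X × Y`. -/
def compSetoid (X : Biset H K) (Y : Biset G H) : Setoid (X.carrier × Y.carrier) where
  r a b := ∃ g : H, a.1 = MulOpposite.op g • b.1 ∧ b.2 = g • a.2
  iseqv :=
    { refl := fun _ => ⟨1, by simp, by simp⟩
      symm := by
        rintro a b ⟨g, h1, h2⟩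
        exact ⟨g⁻¹, by rw [h1, smul_smul, ← MulOpposite.op_mul]; simp,
          by rw [h2, smul_smul]; simp⟩
      trans := by
        rintro a b c ⟨g, h1, h2⟩ ⟨k, h3, h4⟩
        exact ⟨k * g, by rw [h1, h3, smul_smul, MulOpposite.op_mul],
          by rw [h4, h2, smul_smul]⟩ }

/-- The composite `X ∘ Y = X ×_H Y` of an `(H, K)`-biset `X` and a `(G, H)`-biset `Y`, with its left
`K`-action on `X` and right `G`-action on `Y`. -/
def comp (X : Biset H K) (Y : Biset G H) : Biset G K :=
  letI : MulAction K (Quotient (compSetoid X Y)) :=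
    { smul := fun k => Quotient.map (fun a => (k • a.1, a.2)) (by
        rintro a b ⟨g, h1, h2⟩
        exact ⟨g, by simp only [h1, smul_comm], h2⟩)
      one_smul := by
        rintro ⟨a⟩
        exact congrArg (Quotient.mk _) (Prod.ext (one_smul _ _) rfl)
      mul_smul := by
        rintro k l ⟨a⟩
        exact congrArg (Quotient.mk _) (Prod.ext (mul_smul _ _ _) rfl) }
  letI : MulAction Gᵐᵒᵖ (Quotient (compSetoid X Y)) :=
    { smul := fun k => Quotient.map (fun a => (a.1, k • a.2)) (by
        rintro a b ⟨g, h1, h2⟩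
        exact ⟨g, h1, by simp only [h2, smul_comm]⟩)
      one_smul := by
        rintro ⟨a⟩
        exact congrArg (Quotient.mk _) (Prod.ext rfl (one_smul _ _))
      mul_smul := by
        rintro k l ⟨a⟩
        exact congrArg (Quotient.mk _) (Prod.ext rfl (mul_smul _ _ _)) }
  haveI : SMulCommClass K Gᵐᵒᵖ (Quotient (compSetoid X Y)) := ⟨by rintro k g ⟨a⟩; rfl⟩
  { carrier := Quotient (compSetoid X Y)
    free := by
      rintro k ⟨a⟩ h
      obtain ⟨g, h1, h2⟩ := Quotient.exact h
      have hg : g = 1 := Y.free g _ h2.symm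
      exact X.free k _ (by simpa [hg] using h1) }

/-- The class of `(x, y)` in `X ∘ Y`. -/
def compMk (X : Biset H K) (Y : Biset G H) (x : X.carrier) (y : Y.carrier) : (comp X Y).carrier :=
  Quotient.mk (compSetoid X Y) (x, y)

/-- `G` itself as a `(G, G)`-biset. -/
def one (G : Type u) [Group G] [Finite G] : Biset G G where
  carrier := G
  free h x hx := by simpa using hx

/-- The relation `(x, g y) ∼ (x ψ(g), y)`, for `g ∈ P`, on `H × G`. -/
def basisSetoid (P : Subgroup G) (ψ : P →* H) : Setoid (H × G) where
  r a b := ∃ g : P, a.2 = g * b.2 ∧ b.1 = a.1 * ψ g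
  iseqv :=
    { refl := fun _ => ⟨1, by simp, by simp⟩
      symm := by
        rintro a b ⟨g, h1, h2⟩
        exact ⟨g⁻¹, by simp [h1], by simp [h2]⟩
      trans := by
        rintro a b c ⟨g, h1, h2⟩ ⟨k, h3, h4⟩
        exact ⟨g * k, by simp [h1, h3, mul_assoc], by simp [h4, h2, mul_assoc]⟩ }

/-- The transitive biset `H ×_{(P, ψ)} G` of a subgroup `P` of `G` and a homomorphism `ψ : P → H`,
with left action `h · (x, y) = (h x, y)` and right action `(x, y) · g = (x, y g)`. -/
def basis [Finite G] [Finite H] (P : Subgroup G) (ψ : P →* H) : Biset G H :=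
  letI : MulAction H (Quotient (basisSetoid P ψ)) :=
    { smul := fun k => Quotient.map (fun a => (k * a.1, a.2)) (by
        rintro a b ⟨g, h1, h2⟩
        exact ⟨g, h1, by simp [h2, mul_assoc]⟩)
      one_smul := by
        rintro ⟨a⟩
        exact congrArg (Quotient.mk _) (Prod.ext (one_mul _) rfl)
      mul_smul := by
        rintro k l ⟨a⟩
        exact congrArg (Quotient.mk _) (Prod.ext (mul_assoc _ _ _) rfl) }
  letI : MulAction Gᵐᵒᵖ (Quotient (basisSetoid P ψ)) :=
    { smul := fun k => Quotient.map (fun a => (a.1, a.2 * k.unop)) (by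
        rintro a b ⟨g, h1, h2⟩
        exact ⟨g, by simp [h1, mul_assoc], h2⟩)
      one_smul := by
        rintro ⟨a⟩
        exact congrArg (Quotient.mk _) (Prod.ext rfl (mul_one _))
      mul_smul := by
        rintro k l ⟨a⟩
        exact congrArg (Quotient.mk _) (Prod.ext rfl (mul_assoc _ _ _).symm) }
  haveI : SMulCommClass H Gᵐᵒᵖ (Quotient (basisSetoid P ψ)) := ⟨by rintro k g ⟨a⟩; rfl⟩
  { carrier := Quotient (basisSetoid P ψ)
    free := by
      rintro k ⟨a⟩ h
      obtain ⟨g, h1, h2⟩ := Quotient.exact h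
      have hg : g = 1 := by
        have : (1 : G) * a.2 = g * a.2 := by simpa using h1
        exact Subtype.ext (mul_right_cancel this).symm
      subst hg
      simpa using h2 }

/-- The number of left orbits of a biset. -/
noncomputable def numOrbits (X : Biset G H) : ℕ :=
  Nat.card (MulAction.orbitRel.Quotient H X.carrier)

/-! Isomorphisms between composites. -/

theorem iso_mk {X Y : Biset G H} (f : X.carrier → Y.carrier) (hf : Function.Bijective f)
    (h1 : ∀ (h : H) x, f (h • x) = h • f x) (h2 : ∀ (g : Gᵐᵒᵖ) x, f (g • x) = g • f x) :
    X ≈ Y :=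
  ⟨Equiv.ofBijective f hf, h1, h2⟩

theorem sum_congr {X X' Y Y' : Biset G H} (h : X ≈ X') (k : Y ≈ Y') : X.sum Y ≈ X'.sum Y' := by
  obtain ⟨e, h1, h2⟩ := h
  obtain ⟨f, k1, k2⟩ := k
  refine ⟨Equiv.sumCongr e f, ?_, ?_⟩
  · rintro h (x | x)
    · exact congrArg Sum.inl (h1 h x)
    · exact congrArg Sum.inr (k1 h x)
  · rintro h (x | x)
    · exact congrArg Sum.inl (h2 h x)
    · exact congrArg Sum.inr (k2 h x)

theorem sum_assoc (X Y Z : Biset G H) : (X.sum Y).sum Z ≈ X.sum (Y.sum Z) :=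
  ⟨Equiv.sumAssoc _ _ _, by rintro h ((x | x) | x) <;> rfl, by rintro h ((x | x) | x) <;> rfl⟩

theorem sum_comm (X Y : Biset G H) : X.sum Y ≈ Y.sum X :=
  ⟨Equiv.sumComm _ _, by rintro h (x | x) <;> rfl, by rintro h (x | x) <;> rfl⟩

theorem empty_sum (X : Biset G H) : (empty G H).sum X ≈ X :=
  ⟨Equiv.emptySum PEmpty _, by rintro h (x | x); exacts [x.elim, rfl],
    by rintro h (x | x); exacts [x.elim, rfl]⟩

theorem comp_congr {X X' : Biset H K} {Y Y' : Biset G H} (h : X ≈ X') (k : Y ≈ Y') :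
    X.comp Y ≈ X'.comp Y' := by
  obtain ⟨e, h1, h2⟩ := h
  obtain ⟨f, k1, k2⟩ := k
  refine ⟨Quotient.congr (Equiv.prodCongr e f) ?_, ?_, ?_⟩
  · rintro ⟨a, b⟩ ⟨c, d⟩
    refine exists_congr fun g => ?_
    change (a = _ • c ∧ d = g • b) ↔ (e a = _ • e c ∧ f d = g • f b)
    rw [← h2, ← k1, e.apply_eq_iff_eq, f.apply_eq_iff_eq]
  · rintro h ⟨x⟩
    exact congrArg (Quotient.mk _) (Prod.ext (h1 h x.1) rfl)
  · rintro h ⟨x⟩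
    exact congrArg (Quotient.mk _) (Prod.ext rfl (k2 h x.2))

theorem sum_comp (X X' : Biset H K) (Y : Biset G H) :
    (X.sum X').comp Y ≈ (X.comp Y).sum (X'.comp Y) := by
  let f : ((X.sum X').comp Y).carrier → ((X.comp Y).sum (X'.comp Y)).carrier :=
    Quotient.lift (fun a => Sum.map (fun x => compMk X Y x a.2) (fun x => compMk X' Y x a.2) a.1)
      (by
        rintro ⟨a | a, b⟩ ⟨c | c, d⟩ ⟨g, h1, h2⟩
        · exact congrArg Sum.inl (Quotient.sound ⟨g, Sum.inl_injective h1, h2⟩)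
        · exact absurd h1 (by rintro ⟨⟩)
        · exact absurd h1 (by rintro ⟨⟩)
        · exact congrArg Sum.inr (Quotient.sound ⟨g, Sum.inr_injective h1, h2⟩))
  refine iso_mk f ⟨?_, ?_⟩ ?_ ?_
  · rintro ⟨a | a, b⟩ ⟨c | c, d⟩ h
    · obtain ⟨g, h1, h2⟩ := Quotient.exact (Sum.inl_injective h)
      exact Quotient.sound ⟨g, congrArg Sum.inl h1, h2⟩
    · exact absurd h (by rintro ⟨⟩)
    · exact absurd h (by rintro ⟨⟩)
    · obtain ⟨g, h1, h2⟩ := Quotient.exact (Sum.inr_injective h)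
      exact Quotient.sound ⟨g, congrArg Sum.inr h1, h2⟩
  · rintro (⟨a, b⟩ | ⟨a, b⟩)
    · exact ⟨Quotient.mk _ (Sum.inl a, b), rfl⟩
    · exact ⟨Quotient.mk _ (Sum.inr a, b), rfl⟩
  · rintro h ⟨a | a, b⟩ <;> rfl
  · rintro h ⟨a | a, b⟩ <;> rfl

theorem comp_sum (X : Biset H K) (Y Y' : Biset G H) :
    X.comp (Y.sum Y') ≈ (X.comp Y).sum (X.comp Y') := by
  let f : (X.comp (Y.sum Y')).carrier → ((X.comp Y).sum (X.comp Y')).carrier :=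
    Quotient.lift (fun a => Sum.map (fun y => compMk X Y a.1 y) (fun y => compMk X Y' a.1 y) a.2)
      (by
        rintro ⟨a, b | b⟩ ⟨c, d | d⟩ ⟨g, h1, h2⟩
        · exact congrArg Sum.inl (Quotient.sound ⟨g, h1, Sum.inl_injective h2⟩)
        · exact absurd h2 (by rintro ⟨⟩)
        · exact absurd h2 (by rintro ⟨⟩)
        · exact congrArg Sum.inr (Quotient.sound ⟨g, h1, Sum.inr_injective h2⟩))
  refine iso_mk f ⟨?_, ?_⟩ ?_ ?_
  · rintro ⟨a, b | b⟩ ⟨c, d | d⟩ h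
    · obtain ⟨g, h1, h2⟩ := Quotient.exact (Sum.inl_injective h)
      exact Quotient.sound ⟨g, h1, congrArg Sum.inl h2⟩
    · exact absurd h (by rintro ⟨⟩)
    · exact absurd h (by rintro ⟨⟩)
    · obtain ⟨g, h1, h2⟩ := Quotient.exact (Sum.inr_injective h)
      exact Quotient.sound ⟨g, h1, congrArg Sum.inr h2⟩
  · rintro (⟨a, b⟩ | ⟨a, b⟩)
    · exact ⟨Quotient.mk _ (a, Sum.inl b), rfl⟩
    · exact ⟨Quotient.mk _ (a, Sum.inr b), rfl⟩
  · rintro h ⟨a, b | b⟩ <;> rfl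
  · rintro h ⟨a, b | b⟩ <;> rfl

theorem empty_comp (Y : Biset G H) : (empty H K).comp Y ≈ empty G K :=
  iso_mk (Quotient.lift (fun a => a.1) (fun a => a.1.elim))
    ⟨by rintro ⟨a⟩; exact a.1.elim, fun a => a.elim⟩
    (by rintro h ⟨a⟩; exact a.1.elim) (by rintro h ⟨a⟩; exact a.1.elim)

theorem comp_empty (X : Biset H K) : X.comp (empty G H) ≈ empty G K :=
  iso_mk (Quotient.lift (fun a => a.2) (fun a => a.2.elim))
    ⟨by rintro ⟨a⟩; exact a.2.elim, fun a => a.elim⟩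
    (by rintro h ⟨a⟩; exact a.2.elim) (by rintro h ⟨a⟩; exact a.2.elim)

theorem one_comp [Finite H] (Y : Biset G H) : (one H).comp Y ≈ Y := by
  let f : ((one H).comp Y).carrier → Y.carrier :=
    Quotient.lift (fun a : H × Y.carrier => a.1 • a.2) (by
      rintro ⟨(a : H), b⟩ ⟨(c : H), d⟩ ⟨g, h1, h2⟩
      change a = c * g at h1
      change d = g • b at h2
      change a • b = c • d
      rw [h1, h2, smul_smul])
  refine iso_mk f ⟨?_, fun y => ⟨Quotient.mk _ ((1 : H), y), one_smul _ _⟩⟩ ?_ ?_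
  · rintro ⟨(a : H), b⟩ ⟨(c : H), d⟩ h
    change a • b = c • d at h
    refine Quotient.sound ⟨c⁻¹ * a, ?_, ?_⟩
    · change a = c * (c⁻¹ * a)
      simp
    · change d = (c⁻¹ * a) • b
      rw [mul_smul, h, inv_smul_smul]
  · rintro h ⟨(a : H), b⟩
    exact mul_smul h a b
  · rintro h ⟨(a : H), b⟩
    exact smul_comm a h b

theorem comp_one [Finite G] (X : Biset G H) : X.comp (one G) ≈ X := by
  let f : (X.comp (one G)).carrier → X.carrier :=
    Quotient.lift (fun a : X.carrier × G => MulOpposite.op a.2 • a.1) (by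
      rintro ⟨a, (b : G)⟩ ⟨c, (d : G)⟩ ⟨g, h1, h2⟩
      change a = MulOpposite.op g • c at h1
      change d = g * b at h2
      change MulOpposite.op b • a = MulOpposite.op d • c
      rw [h1, h2, smul_smul, MulOpposite.op_mul])
  refine iso_mk f ⟨?_, fun y => ⟨Quotient.mk _ (y, (1 : G)), one_smul _ _⟩⟩ ?_ ?_
  · rintro ⟨a, (b : G)⟩ ⟨c, (d : G)⟩ h
    change MulOpposite.op b • a = MulOpposite.op d • c at h
    refine Quotient.sound ⟨d * b⁻¹, ?_, ?_⟩
    · change a = MulOpposite.op (d * b⁻¹) • c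
      rw [MulOpposite.op_mul, mul_smul, ← h, smul_smul, ← MulOpposite.op_mul]
      simp
    · change d = d * b⁻¹ * b
      simp
  · rintro h ⟨a, (b : G)⟩
    exact (smul_comm h (MulOpposite.op b) a).symm
  · rintro h ⟨a, (b : G)⟩
    exact mul_smul h (MulOpposite.op b) a

theorem comp_assoc (X : Biset K L) (Y : Biset H K) (Z : Biset G H) :
    (X.comp Y).comp Z ≈ X.comp (Y.comp Z) := by
  let f : ((X.comp Y).comp Z).carrier → (X.comp (Y.comp Z)).carrier :=
    Quotient.lift
      (fun a : (X.comp Y).carrier × Z.carrier =>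
        Quotient.lift (fun b : X.carrier × Y.carrier =>
            compMk X (Y.comp Z) b.1 (compMk Y Z b.2 a.2))
          (by
            rintro ⟨b, c⟩ ⟨b', c'⟩ ⟨g, h1, h2⟩
            exact Quotient.sound ⟨g, h1, congrArg (fun t => compMk Y Z t a.2) h2⟩) a.1)
      (by
        rintro ⟨⟨a, b⟩, c⟩ ⟨⟨a', b'⟩, c'⟩ ⟨g, h1, h2⟩
        obtain ⟨k, h3, h4⟩ := Quotient.exact h1
        change a = MulOpposite.op k • a' at h3
        change MulOpposite.op g • b' = k • b at h4
        change c' = g • c at h2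
        refine Quotient.sound ⟨k, h3, ?_⟩
        change compMk Y Z b' c' = compMk Y Z (k • b) c
        rw [← h4]
        exact Quotient.sound (s := compSetoid Y Z) (a := (b', c'))
          (b := (MulOpposite.op g • b', c)) (Setoid.symm' _ ⟨g, rfl, h2⟩))
  refine iso_mk f ⟨?_, ?_⟩ ?_ ?_
  · rintro ⟨⟨a, b⟩, c⟩ ⟨⟨a', b'⟩, c'⟩ h
    obtain ⟨k, h1, h2⟩ := Quotient.exact h
    obtain ⟨g, h3, h4⟩ := Quotient.exact h2
    change a = MulOpposite.op k • a' at h1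
    change b' = MulOpposite.op g • k • b at h3
    change c = g • c' at h4
    refine Quotient.sound ⟨g⁻¹, Quotient.sound ⟨k, h1, ?_⟩, ?_⟩
    · change MulOpposite.op g⁻¹ • b' = k • b
      rw [h3, smul_smul, ← MulOpposite.op_mul]
      simp
    · change c' = g⁻¹ • c
      rw [h4, inv_smul_smul]
  · rintro ⟨a, ⟨b, c⟩⟩
    exact ⟨Quotient.mk _ (compMk X Y a b, c), rfl⟩
  · rintro h ⟨⟨a, b⟩, c⟩; rfl
  · rintro h ⟨⟨a, b⟩, c⟩; rfl

theorem numOrbits_congr {X Y : Biset G H} (h : X ≈ Y) : X.numOrbits = Y.numOrbits := by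
  obtain ⟨e, h1, -⟩ := h
  refine Nat.card_congr (Quotient.congr e fun a b => ?_)
  change (∃ k : H, k • b = a) ↔ ∃ k : H, k • e b = e a
  simp only [← h1, e.apply_eq_iff_eq]

theorem numOrbits_empty (G H : Type u) [Group G] [Group H] : (empty G H).numOrbits = 0 := by
  have : IsEmpty (MulAction.orbitRel.Quotient H (empty G H).carrier) :=
    ⟨by rintro ⟨x⟩; exact PEmpty.elim x⟩
  exact Nat.card_of_isEmpty

theorem numOrbits_sum (X Y : Biset G H) : (X.sum Y).numOrbits = X.numOrbits + Y.numOrbits := by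
  let f : MulAction.orbitRel.Quotient H (X.sum Y).carrier →
      MulAction.orbitRel.Quotient H X.carrier ⊕ MulAction.orbitRel.Quotient H Y.carrier :=
    Quotient.lift (Sum.map (Quotient.mk _) (Quotient.mk _)) (by
      rintro (a | a) (b | b) ⟨k, h⟩
      · exact congrArg Sum.inl (Quotient.sound ⟨k, Sum.inl_injective h⟩)
      · exact absurd h (by rintro ⟨⟩)
      · exact absurd h (by rintro ⟨⟩)
      · exact congrArg Sum.inr (Quotient.sound ⟨k, Sum.inr_injective h⟩))
  have hf : Function.Bijective f := by
    constructor
    · rintro ⟨a | a⟩ ⟨b | b⟩ h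
      · obtain ⟨k, hk⟩ := Quotient.exact (Sum.inl_injective h)
        exact Quotient.sound ⟨k, congrArg (Sum.inl (β := Y.carrier)) hk⟩
      · exact absurd h (by rintro ⟨⟩)
      · exact absurd h (by rintro ⟨⟩)
      · obtain ⟨k, hk⟩ := Quotient.exact (Sum.inr_injective h)
        exact Quotient.sound ⟨k, congrArg (Sum.inr (α := X.carrier)) hk⟩
    · rintro (a | a)
      · induction a using Quotient.inductionOn with | h a =>
        exact ⟨Quotient.mk _ (Sum.inl a), rfl⟩
      · induction a using Quotient.inductionOn with | h a =>
        exact ⟨Quotient.mk _ (Sum.inr a), rfl⟩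
  exact (Nat.card_congr (Equiv.ofBijective f hf)).trans Nat.card_sum

end Biset

/-! ### Burnside modules -/

/-- `A⁺(G, H)`: the commutative monoid of isomorphism classes of finite `(G, H)`-bisets under
disjoint union. -/
def BisetClass (G H : Type u) [Group G] [Group H] : Type (u + 1) := Quotient (Biset.setoid G H)

namespace BisetClass

variable {G H K L : Type u} [Group G] [Group H] [Group K] [Group L]

/-- The isomorphism class of a biset. -/
def mk (X : Biset G H) : BisetClass G H := Quotient.mk _ X

instance : Add (BisetClass G H) :=
  ⟨Quotient.map₂ Biset.sum fun _ _ h _ _ k => Biset.sum_congr h k⟩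

instance : Zero (BisetClass G H) := ⟨mk (Biset.empty G H)⟩

instance : AddCommMonoid (BisetClass G H) where
  add_assoc := by rintro ⟨X⟩ ⟨Y⟩ ⟨Z⟩; exact Quotient.sound (Biset.sum_assoc X Y Z)
  add_comm := by rintro ⟨X⟩ ⟨Y⟩; exact Quotient.sound (Biset.sum_comm X Y)
  zero_add := by rintro ⟨X⟩; exact Quotient.sound (Biset.empty_sum X)
  add_zero := by
    rintro ⟨X⟩
    exact Quotient.sound (Setoid.trans' _ (Biset.sum_comm X _) (Biset.empty_sum X))
  nsmul := nsmulRec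

/-- Composition of classes of bisets, as a biadditive map. -/
def compHom : BisetClass H K →+ BisetClass G H →+ BisetClass G K where
  toFun x :=
    { toFun := Quotient.map₂ Biset.comp (fun _ _ h _ _ k => Biset.comp_congr h k) x
      map_zero' := by
        induction x using Quotient.inductionOn with | h X => exact Quotient.sound (Biset.comp_empty X)
      map_add' := by
        induction x using Quotient.inductionOn with | h X =>
        rintro ⟨Y⟩ ⟨Z⟩
        exact Quotient.sound (Biset.comp_sum X Y Z) }
  map_zero' := by ext ⟨Y⟩; exact Quotient.sound (Biset.empty_comp Y)
  map_add' := by rintro ⟨X⟩ ⟨X'⟩; ext ⟨Y⟩; exact Quotient.sound (Biset.sum_comp X X' Y)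

theorem compHom_assoc (x : BisetClass K L) (y : BisetClass H K) (z : BisetClass G H) :
    compHom (compHom x y) z = compHom x (compHom y z) := by
  induction x using Quotient.inductionOn with | h X =>
  induction y using Quotient.inductionOn with | h Y =>
  induction z using Quotient.inductionOn with | h Z =>
  exact Quotient.sound (Biset.comp_assoc X Y Z)

theorem one_compHom [Finite H] (y : BisetClass G H) : compHom (mk (Biset.one H)) y = y := by
  induction y using Quotient.inductionOn with | h Y => exact Quotient.sound (Biset.one_comp Y)

theorem compHom_one [Finite G] (x : BisetClass G H) : compHom x (mk (Biset.one G)) = x := by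
  induction x using Quotient.inductionOn with | h X => exact Quotient.sound (Biset.comp_one X)

/-- The homomorphism `A⁺(G, H) → ℤ` that counts the left orbits of a biset. -/
noncomputable def numOrbitsHom : BisetClass G H →+ ℤ where
  toFun := Quotient.lift (fun X => (X.numOrbits : ℤ)) fun _ _ h =>
    congrArg Nat.cast (Biset.numOrbits_congr h)
  map_zero' := congrArg Nat.cast (Biset.numOrbits_empty G H)
  map_add' := by
    rintro ⟨X⟩ ⟨Y⟩
    exact (congrArg Nat.cast (Biset.numOrbits_sum X Y)).trans (Nat.cast_add _ _)

end BisetClass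

open Algebra (GrothendieckAddGroup)

/-- The Burnside module `A(G, H)`: the Grothendieck group of `A⁺(G, H)`. -/
abbrev Burnside (G H : Type u) [Group G] [Group H] : Type (u + 1) :=
  GrothendieckAddGroup (BisetClass G H)

namespace Burnside

variable {G H K L : Type u} [Group G] [Group H] [Group K] [Group L]

/-- The element of `A(G, H)` represented by a biset. -/
def ofBiset (X : Biset G H) : Burnside G H := GrothendieckAddGroup.of (BisetClass.mk X)

theorem hom_ext {M N : Type*} [AddCommMonoid M] [AddCommGroup N]
    {f g : GrothendieckAddGroup M →+ N}
    (h : ∀ m, f (GrothendieckAddGroup.of m) = g (GrothendieckAddGroup.of m)) : f = g :=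
  GrothendieckAddGroup.lift.symm.injective (AddMonoidHom.ext h)

theorem lift_of {M N : Type*} [AddCommMonoid M] [AddCommGroup N] (f : M →+ N) (m : M) :
    GrothendieckAddGroup.lift f (GrothendieckAddGroup.of m) = f m :=
  DFunLike.congr_fun (GrothendieckAddGroup.lift.symm_apply_apply f) m

/-- The bilinear extension `A(H, K) × A(G, H) → A(G, K)` of the composition of bisets. -/
noncomputable def comp : Burnside H K →+ Burnside G H →+ Burnside G K :=
  GrothendieckAddGroup.lift
    { toFun := fun x =>
        GrothendieckAddGroup.lift (GrothendieckAddGroup.of.comp (BisetClass.compHom x))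
      map_zero' := hom_ext fun m => by rw [lift_of]; simp
      map_add' := fun x y => hom_ext fun m => by
        rw [AddMonoidHom.add_apply, lift_of, lift_of, lift_of]; simp }

theorem comp_of (x : BisetClass H K) (y : BisetClass G H) :
    comp (GrothendieckAddGroup.of x) (GrothendieckAddGroup.of y) =
      GrothendieckAddGroup.of (BisetClass.compHom x y) := by
  rw [comp, lift_of]
  exact lift_of _ _

theorem comp_assoc (x : Burnside K L) (y : Burnside H K) (z : Burnside G H) :
    comp (comp x y) z = comp x (comp y z) := by
  have h1 (x : BisetClass K L) (y : BisetClass H K) :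
      comp (comp (GrothendieckAddGroup.of x) (GrothendieckAddGroup.of y)) =
        (comp (G := G) (GrothendieckAddGroup.of x)).comp (comp (GrothendieckAddGroup.of y)) :=
    hom_ext fun m => by
      rw [AddMonoidHom.comp_apply]
      simp only [comp_of, BisetClass.compHom_assoc]
  have h2 (x : BisetClass K L) : (comp.flip z).comp (comp (GrothendieckAddGroup.of x)) =
      (comp (GrothendieckAddGroup.of x)).comp (comp.flip z) :=
    hom_ext fun m => DFunLike.congr_fun (h1 x m) z
  have h3 : (comp.flip z).comp (comp.flip y) = comp.flip (comp (K := K) y z) :=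
    hom_ext (M := BisetClass K L) fun m => DFunLike.congr_fun (h2 m) y
  exact DFunLike.congr_fun h3 x

theorem one_comp [Finite H] (y : Burnside G H) : comp (ofBiset (Biset.one H)) y = y := by
  have h : comp (ofBiset (Biset.one H)) = AddMonoidHom.id (Burnside G H) :=
    hom_ext fun m => by
      rw [ofBiset, comp_of, BisetClass.one_compHom]; rfl
  exact DFunLike.congr_fun h y

theorem comp_one [Finite G] (x : Burnside G H) : comp x (ofBiset (Biset.one G)) = x := by
  have h : (comp (K := H)).flip (ofBiset (Biset.one G)) = AddMonoidHom.id (Burnside G H) :=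
    hom_ext fun m => by
      rw [AddMonoidHom.flip_apply, ofBiset, comp_of, BisetClass.compHom_one]; rfl
  exact DFunLike.congr_fun h x

/-- The double Burnside ring `A(G, G)`, with composition as multiplication. -/
noncomputable instance [Finite G] : Ring (Burnside G G) where
  __ := (inferInstance : AddCommGroup (Burnside G G))
  mul x y := comp x y
  one := ofBiset (Biset.one G)
  mul_assoc := comp_assoc
  one_mul := one_comp
  mul_one := comp_one
  left_distrib x := map_add (comp x)
  right_distrib x y z := by
    change comp (x + y) z = comp x z + comp y z
    rw [map_add]; rfl
  zero_mul x := by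
    change comp 0 x = 0
    rw [map_zero]; rfl
  mul_zero x := map_zero (comp x)

theorem mul_def [Finite G] (x y : Burnside G G) : x * y = comp x y := rfl

/-- The basis element `[P, ψ]` of `A(G, H)`. -/
def basis [Finite G] [Finite H] (P : Subgroup G) (ψ : P →* H) : Burnside G H :=
  ofBiset (Biset.basis P ψ)

/-- The augmentation `ε : A(G, H) → ℤ`, counting left orbits. -/
noncomputable def augmentation : Burnside G H →+ ℤ :=
  GrothendieckAddGroup.lift BisetClass.numOrbitsHom

end Burnside

/-- The `p`-completed Burnside module `A(G, H) ⊗ ℤ_p`. For `G = H` finite it is a ring. -/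
abbrev BurnsideHat (p : ℕ) [Fact p.Prime] (G H : Type u) [Group G] [Group H] : Type (u + 1) :=
  ℤ_[p] ⊗[ℤ] Burnside G H

namespace BurnsideHat

variable {p : ℕ} [Fact p.Prime] {G H K : Type u} [Group G] [Group H] [Group K]

/-- The canonical map `A(G, H) → A(G, H) ⊗ ℤ_p`. -/
noncomputable def of (p : ℕ) [Fact p.Prime] : Burnside G H →+ BurnsideHat p G H :=
  (TensorProduct.mk ℤ ℤ_[p] (Burnside G H) 1).toAddMonoidHom

/-- The `ℤ_p`-bilinear extension of composition. -/
noncomputable def comp :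
    BurnsideHat p H K →ₗ[ℤ_[p]] BurnsideHat p G H →ₗ[ℤ_[p]] BurnsideHat p G K :=
  LinearMap.liftBaseChange ℤ_[p]
    (LinearMap.baseChangeHom ℤ ℤ_[p] (Burnside G H) (Burnside G K) ∘ₗ
      ((addMonoidHomLequivInt ℤ).toLinearMap ∘ₗ Burnside.comp.toIntLinearMap))

theorem comp_tmul (a b : ℤ_[p]) (x : Burnside H K) (y : Burnside G H) :
    comp (a ⊗ₜ[ℤ] x) (b ⊗ₜ[ℤ] y) = (a * b) ⊗ₜ[ℤ] Burnside.comp x y := rfl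

/-- On `A(G, G) ⊗ ℤ_p`, composition is the multiplication of the ring. -/
theorem comp_eq_mul [Finite G] (x y : BurnsideHat p G G) : comp x y = x * y := by
  induction x using TensorProduct.induction_on with
  | zero => simp
  | add x x' hx hx' => rw [map_add, add_mul, LinearMap.add_apply, hx, hx']
  | tmul a x =>
    induction y using TensorProduct.induction_on with
    | zero => simp
    | add y y' hy hy' => rw [map_add, mul_add, hy, hy']
    | tmul b y => rw [comp_tmul, Algebra.TensorProduct.tmul_mul_tmul, Burnside.mul_def]

/-- The basis element `[P, ψ]` of `A(G, H) ⊗ ℤ_p`. -/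
noncomputable def basis (p : ℕ) [Fact p.Prime] [Finite G] [Finite H] (P : Subgroup G)
    (ψ : P →* H) : BurnsideHat p G H :=
  of p (Burnside.basis P ψ)

/-- The augmentation `ε : A(G, H) ⊗ ℤ_p → ℤ_p`. -/
noncomputable def augmentation : BurnsideHat p G H →ₗ[ℤ_[p]] ℤ_[p] :=
  LinearMap.liftBaseChange ℤ_[p]
    ((Int.castAddHom ℤ_[p]).comp Burnside.augmentation).toIntLinearMap

end BurnsideHat

/-! ### Characteristic bisets and characteristic idempotents -/

namespace FusionSystem

variable {S : Type u} [Group S] [Finite S] (F : FusionSystem S)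

/-- `[P, φ]` in `A(P, S)`, for a homomorphism `φ : P → S`. -/
def restrictAlong {P : Subgroup S} (φ : P →* S) : Burnside P S :=
  Burnside.basis (⊤ : Subgroup P) (φ.comp (⊤ : Subgroup P).subtype)

/-- `Ω ∘ [P, φ] = Ω ∘ [P, ι_P]` in `A(P, S)` for all `P ≤ S` and `φ ∈ Hom_F(P, S)`. -/
def RightStable (Ω : Burnside S S) : Prop :=
  ∀ (P : Subgroup S) (φ : F.HomS P),
    Burnside.comp Ω (restrictAlong φ.1) = Burnside.comp Ω (restrictAlong P.subtype)

/-- `[φ(P), φ⁻¹] ∘ Ω = [P, id] ∘ Ω` in `A(S, P)` for all `P ≤ S` and `φ ∈ Hom_F(P, S)`. -/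
def LeftStable (Ω : Burnside S S) : Prop :=
  ∀ (P : Subgroup S) (φ : F.HomS P),
    Burnside.comp (Burnside.basis φ.1.range (F.toImage φ).symm.toMonoidHom) Ω =
      Burnside.comp (Burnside.basis P (MonoidHom.id P)) Ω

/-- Right stability in the `p`-completed modules. -/
def RightStableHat (p : ℕ) [Fact p.Prime] (Ω : BurnsideHat p S S) : Prop :=
  ∀ (P : Subgroup S) (φ : F.HomS P),
    BurnsideHat.comp Ω (BurnsideHat.of p (restrictAlong φ.1)) =
      BurnsideHat.comp Ω (BurnsideHat.of p (restrictAlong P.subtype))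

/-- Left stability in the `p`-completed modules. -/
def LeftStableHat (p : ℕ) [Fact p.Prime] (Ω : BurnsideHat p S S) : Prop :=
  ∀ (P : Subgroup S) (φ : F.HomS P),
    BurnsideHat.comp (BurnsideHat.basis p φ.1.range (F.toImage φ).symm.toMonoidHom) Ω =
      BurnsideHat.comp (BurnsideHat.basis p P (MonoidHom.id P)) Ω

/-- `A_F(S, S)`: the subgroup of `A(S, S)` generated by the `[P, φ]` with `φ ∈ Hom_F(P, S)`. -/
noncomputable def burnside : AddSubgroup (Burnside S S) :=
  AddSubgroup.closure {x | ∃ (P : Subgroup S) (φ : F.HomS P), x = Burnside.basis P φ.1}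

/-- The `ℤ_p`-submodule of `A(S, S) ⊗ ℤ_p` generated by the `[P, φ]` with `φ ∈ Hom_F(P, S)`. -/
noncomputable def burnsideHat (p : ℕ) [Fact p.Prime] : Submodule ℤ_[p] (BurnsideHat p S S) :=
  Submodule.span ℤ_[p] {x | ∃ (P : Subgroup S) (φ : F.HomS P), x = BurnsideHat.basis p P φ.1}

/-- `Ω ∈ A(S, S)` is a characteristic biset for `F` (with respect to `p`). -/
structure IsCharacteristicBiset (p : ℕ) (Ω : Burnside S S) : Prop where
  isBiset : ∃ X : Biset S S, Ω = Burnside.ofBiset X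
  mem : Ω ∈ F.burnside
  rightStable : F.RightStable Ω
  leftStable : F.LeftStable Ω
  augmentation : Burnside.augmentation Ω ≡ 1 [ZMOD p]

/-- `ω ∈ A(S, S) ⊗ ℤ_p` is a characteristic idempotent for `F`. -/
structure IsCharacteristicIdempotent (p : ℕ) [Fact p.Prime] (ω : BurnsideHat p S S) : Prop where
  idempotent : IsIdempotentElem ω
  mem : ω ∈ F.burnsideHat p
  rightStable : F.RightStableHat p ω
  leftStable : F.LeftStableHat p ω
  augmentation : BurnsideHat.augmentation ω = 1

end FusionSystem

/-- `Ω` is idempotent modulo `p` in the double Burnside ring: `Ω² - Ω ∈ p A(S, S)`. -/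
def IsIdempotentMod {S : Type u} [Group S] [Finite S] (p : ℕ) (Ω : Burnside S S) : Prop :=
  ∃ Λ : Burnside S S, Ω * Ω - Ω = p • Λ

/-- The sequence `x` converges to `a` in the `p`-adic topology of the abelian group `M`: for every
`n`, eventually `x k - a ∈ pⁿ M`. -/
def PAdicTendsto {M : Type*} [AddCommGroup M] (p : ℕ) (x : ℕ → M) (a : M) : Prop :=
  ∀ n : ℕ, ∃ N : ℕ, ∀ k ≥ N, ∃ y : M, x k - a = p ^ n • y

/-! A `(G, H)`-biset is an `H × G`-set whose isotropy groups are graphs of homomorphisms from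
subgroups of `G` to `H`, and a finite set with a group action is determined up to isomorphism by its
marks, the numbers of fixed points of subgroups (`exists_equiv_of_mark_eq`). For a biset whose
isotropy groups are graphs of morphisms of `F`, both stability conditions hold once the marks are
constant on classes of graphs, two graphs being equivalent when they differ by morphisms of `F` in
the two coordinates (`MarkStable.mark_map_eq`). The class of the graph of `φ : P → S` depends only
on the `F`-class of `P`, and is represented by the diagonal of a fully normalised subgroup.

Such a set is made from the biset `S` by adding orbits, treating subgroups in descending order of
size. Adding a copy of `T ⧸ D` raises the mark at `D` by `|N(D) : D|`, so the marks in a class can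
be equalised only if their differences satisfy a divisibility. Saturation supplies it: it gives an
injective homomorphism from the normaliser of a graph to `S × S` that carries the graph to its
representative (`IsSaturated.isFusionFamily`). Orbit counting on the two fixed-point sets then
yields the divisibility, as all terms belonging to larger subgroups cancel
(`IsFusionFamily.card_normalizer_dvd_mark_sub`).

The mark at the diagonal of `S` can be kept equal to `|Z(S)|`. Orbits whose isotropy group is the
graph of an automorphism of `S` then contribute `|Aut_F(S) : Aut_S(S)|` left orbits, a number prime
to `p`, and all others a multiple of `p` (`not_dvd_numOrbits`). As `A(S, S)/p` is finite, some power
of the class is idempotent mod `p`. Its augmentation is a unit and idempotent mod `p`, hence `1`;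
this power is the characteristic biset.

For convergence, write `Ω² = Ω + pΛ`. Since `A(S, S)` is torsion-free, `Λ` commutes with `Ω`.
Commutative algebra then makes the powers `Ω ^ p ^ k` a Cauchy sequence of approximate idempotents
(`Burnside.exists_pow_sub_pow`). The limit exists because the completed module is finite over `ℤ_p`,
and the linear conditions pass to it. -/

/-! ### Finite sets with a group action and their marks -/

section Marks

variable {T : Type u} [Group T]

/-- The number of points of `X` fixed by the subgroup `D`. -/
noncomputable def mark (X : Type*) [MulAction T X] (D : Subgroup T) : ℕ :=
  Nat.card {x : X // ∀ d ∈ D, d • x = x}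

theorem mark_congr {X Y : Type*} [MulAction T X] [MulAction T Y] (e : X ≃ Y)
    (he : ∀ (t : T) x, e (t • x) = t • e x) (D : Subgroup T) : mark X D = mark Y D :=
  Nat.card_congr (e.subtypeEquiv fun x => by simp only [← he, e.apply_eq_iff_eq])

theorem mark_sum (X Y : Type*) [Finite X] [Finite Y] [MulAction T X] [MulAction T Y]
    (D : Subgroup T) : mark (X ⊕ Y) D = mark X D + mark Y D := by
  rw [mark, Nat.card_congr (Equiv.subtypeSum), Nat.card_sum]
  simp [mark]

theorem mark_bot (X : Type*) [MulAction T X] : mark X (⊥ : Subgroup T) = Nat.card X :=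
  Nat.card_congr (Equiv.subtypeUnivEquiv (by simp))

theorem mark_pos_iff (X : Type*) [Finite X] [MulAction T X] (D : Subgroup T) :
    0 < mark X D ↔ ∃ x : X, D ≤ MulAction.stabilizer T x := by
  rw [mark, Finite.card_pos_iff, nonempty_subtype]
  rfl

theorem mark_eq_zero_of_forall (X : Type*) [Finite X] [MulAction T X] (D : Subgroup T)
    (h : ∀ x : X, ¬ D ≤ MulAction.stabilizer T x) : mark X D = 0 := by
  have := (mark_pos_iff X D).not.2 (by simpa using h)
  omega

/-- The subgroup `t D t⁻¹`. -/
abbrev conjSubgroup (t : T) (D : Subgroup T) : Subgroup T := D.map (MulAut.conj t).toMonoidHom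

theorem mem_conjSubgroup {t : T} {D : Subgroup T} {x : T} :
    x ∈ conjSubgroup t D ↔ t⁻¹ * x * t ∈ D := by
  constructor
  · rintro ⟨d, hd, rfl⟩
    simpa [mul_assoc] using hd
  · intro h
    exact ⟨_, h, by simp [mul_assoc]⟩

theorem card_conjSubgroup (t : T) (D : Subgroup T) : Nat.card (conjSubgroup t D) = Nat.card D :=
  (Nat.card_congr (D.equivMapOfInjective _ (MulAut.conj t).injective).toEquiv).symm

theorem mark_conjSubgroup (X : Type*) [MulAction T X] (t : T) (D : Subgroup T) :
    mark X (conjSubgroup t D) = mark X D := by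
  refine Nat.card_congr (((MulAction.toPerm (α := T) (β := X) t⁻¹)).subtypeEquiv fun x => ?_)
  simp only [MulAction.toPerm_apply]
  constructor
  · intro h d hd
    have := h (t * d * t⁻¹) (mem_conjSubgroup.2 (by simpa [mul_assoc] using hd))
    rw [smul_smul, eq_inv_smul_iff, smul_smul]
    simpa [mul_assoc] using this
  · intro h d hd
    have := h _ (mem_conjSubgroup.1 hd)
    rw [smul_smul, eq_inv_smul_iff, smul_smul] at this
    simpa [mul_assoc] using this

/-- Splits off the orbit of `x`; the smaller set `Y` is its complement. This drives the inductions
on orbit decompositions. -/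
theorem exists_equiv_quotient_sum {X : Type u} [Finite X] [MulAction T X] (x : X) :
    ∃ (Y : Type u) (_ : Finite Y) (_ : MulAction T Y) (e : X ≃ (T ⧸ MulAction.stabilizer T x) ⊕ Y),
      Nat.card Y < Nat.card X ∧ ∀ (t : T) z, e (t • z) = t • e z := by
  classical
  let A : SubMulAction T X := ⟨(MulAction.orbit T x)ᶜ, fun c y hy => by
    rintro h
    obtain ⟨t, ht⟩ := h
    exact hy ⟨c⁻¹ * t, by simpa [mul_smul, inv_smul_eq_iff] using ht⟩⟩
  let f : (T ⧸ MulAction.stabilizer T x) ⊕ A → X :=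
    Sum.elim (fun q => MulAction.ofQuotientStabilizer T x q) Subtype.val
  have hf : Function.Bijective f := by
    constructor
    · rintro (a | a) (b | b) h
      · exact congrArg _ (MulAction.injective_ofQuotientStabilizer T x h)
      · refine absurd ?_ b.2
        change f (Sum.inr b) ∈ _
        rw [← h]
        exact MulAction.ofQuotientStabilizer_mem_orbit T x a
      · refine absurd ?_ a.2
        change f (Sum.inr a) ∈ _
        rw [h]
        exact MulAction.ofQuotientStabilizer_mem_orbit T x b
      · exact congrArg _ (Subtype.ext h)
    · intro y
      by_cases hy : y ∈ MulAction.orbit T x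
      · obtain ⟨t, rfl⟩ := hy
        exact ⟨Sum.inl (t : T ⧸ _), rfl⟩
      · exact ⟨Sum.inr ⟨y, hy⟩, rfl⟩
  have hs : ∀ (t : T) z, f (t • z) = t • f z := by
    rintro t (a | a)
    · exact MulAction.ofQuotientStabilizer_smul T x t a
    · rfl
  refine ⟨A, inferInstance, inferInstance, (Equiv.ofBijective f hf).symm, ?_, fun t z => ?_⟩
  · exact Finite.card_subtype_lt (p := fun y => y ∈ A) (x := x)
      (fun h => h (MulAction.mem_orbit_self x))
  · rw [Equiv.symm_apply_eq]
    change _ = f _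
    rw [hs]
    exact congrArg _ ((Equiv.ofBijective f hf).apply_symm_apply z).symm

/-- Burnside: two finite `T`-sets with the same marks are isomorphic. -/
theorem exists_equiv_of_mark_eq [Finite T] {X Y : Type u} [Finite X] [Finite Y] [MulAction T X]
    [MulAction T Y] (h : ∀ D : Subgroup T, mark X D = mark Y D) :
    ∃ e : X ≃ Y, ∀ (t : T) x, e (t • x) = t • e x := by
  induction hn : Nat.card X using Nat.strong_induction_on generalizing X Y with | _ n ih =>
  have hXY : Nat.card X = Nat.card Y := by
    have := h ⊥
    rwa [mark_bot, mark_bot] at this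
  rcases isEmpty_or_nonempty X with hX | hX
  · have : IsEmpty Y := by
      rw [← Finite.card_eq_zero_iff, ← hXY, Finite.card_eq_zero_iff]; exact hX
    exact ⟨Equiv.equivOfIsEmpty X Y, fun t x => isEmptyElim x⟩
  -- A largest isotropy group of `X` fixes some `y` in `Y`, and the stabiliser of `y` fixes some `z`
  -- in `X`. Maximality forces equality, so isomorphic orbits can be removed from both sides.
  obtain ⟨x, hx⟩ := Finite.exists_max fun x : X => Nat.card (MulAction.stabilizer T x)
  obtain ⟨y, hy⟩ := (mark_pos_iff Y (MulAction.stabilizer T x)).1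
    (by rw [← h]; exact (mark_pos_iff X _).2 ⟨x, le_rfl⟩)
  obtain ⟨z, hz⟩ := (mark_pos_iff X (MulAction.stabilizer T y)).1
    (by rw [h]; exact (mark_pos_iff Y _).2 ⟨y, le_rfl⟩)
  have hst : MulAction.stabilizer T x = MulAction.stabilizer T y :=
    Subgroup.eq_of_le_of_card_ge hy ((Subgroup.card_le_of_le hz).trans (hx z))
  obtain ⟨X', _, _, e, he, he'⟩ := exists_equiv_quotient_sum (T := T) x
  obtain ⟨Y', _, _, f, hf, hf'⟩ := exists_equiv_quotient_sum (T := T) y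
  rw [← hst] at f
  obtain ⟨f, hf'⟩ : ∃ f : Y ≃ (T ⧸ MulAction.stabilizer T x) ⊕ Y',
      ∀ (t : T) z, f (t • z) = t • f z := by
    rw [hst]; exact ⟨_, hf'⟩
  obtain ⟨g, hg⟩ := ih (Nat.card X') (hn ▸ he) (X := X') (Y := Y') (fun D => by
    have := h D
    rw [mark_congr e he', mark_congr f hf', mark_sum, mark_sum] at this
    omega) rfl
  refine ⟨(e.trans (Equiv.sumCongr (Equiv.refl _) g)).trans f.symm, fun t w => ?_⟩
  simp only [Equiv.trans_apply, Equiv.symm_apply_eq, he', hf', Equiv.apply_symm_apply]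
  rcases e w with a | a
  · rfl
  · exact congrArg Sum.inr (hg t a)

theorem stabilizer_quotient_mk (D : Subgroup T) (t : T) :
    MulAction.stabilizer T (t : T ⧸ D) = conjSubgroup t D := by
  ext x
  rw [mem_conjSubgroup, MulAction.mem_stabilizer_iff]
  change ((x * t : T) : T ⧸ D) = t ↔ _
  rw [eq_comm, QuotientGroup.eq, mul_assoc]

/-- Isotropy groups of `T ⧸ D` are conjugates of `D`. Hence adding `T ⧸ D` changes no mark at other
subgroups of order at least `|D|`. -/
theorem mark_quotient_eq_zero [Finite T] {D R : Subgroup T} (hc : Nat.card D ≤ Nat.card R)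
    (h : ∀ t, R ≠ conjSubgroup t D) : mark (T ⧸ D) R = 0 := by
  refine mark_eq_zero_of_forall _ _ fun x hx => ?_
  obtain ⟨t, rfl⟩ := QuotientGroup.mk_surjective x
  rw [stabilizer_quotient_mk] at hx
  exact h t (Subgroup.eq_of_le_of_card_ge hx (by rwa [card_conjSubgroup]))

/-- The cosets fixed by `D` form `N(D)/D`, so one copy of `T ⧸ D` raises the mark at `D` by `|N(D) :
D|`. -/
theorem mark_quotient_self [Finite T] (D : Subgroup T) :
    mark (T ⧸ D) D * Nat.card D = Nat.card (Subgroup.normalizer (D : Set T)) := by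
  have h : mark (T ⧸ D) D = Nat.card (Subgroup.normalizer (D : Set T) ⧸
      D.subgroupOf (Subgroup.normalizer (D : Set T))) := by
    refine Nat.card_congr (Equiv.trans ?_ (Sylow.fixedPointsMulLeftCosetsEquivQuotient D))
    refine Equiv.subtypeEquivRight fun x => ?_
    exact ⟨fun h d => h d d.2, fun h d hd => h ⟨d, hd⟩⟩
  rw [h, ← Nat.card_congr (Subgroup.subgroupOfEquivOfLe
    (Subgroup.le_normalizer (H := D))).toEquiv, ← Subgroup.card_eq_card_quotient_mul_card_subgroup]

/-- A form of the orbit counting theorem for a group acting on a fixed-point set. -/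
theorem card_dvd_sum_card_fixed [Finite T] {N : Type*} [Group N] [Fintype N] (θ : N →* T)
    {X : Type*} [Finite X] [MulAction T X] (E : Subgroup T)
    (hE : ∀ n, θ n ∈ Subgroup.normalizer (E : Set T)) :
    Nat.card N ∣ ∑ n : N, Nat.card {x : X // (∀ d ∈ E, d • x = x) ∧ θ n • x = x} := by
  classical
  have hmem : ∀ (n : N) (x : X), (∀ d ∈ E, d • x = x) → ∀ d ∈ E, d • θ n • x = θ n • x := by
    intro n x hx d hd
    have h1 : (θ n)⁻¹ * d * θ n ∈ E := by
      have := (Subgroup.mem_normalizer_iff.1 (inv_mem (hE n)) d).1 hd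
      simpa using this
    have := hx _ h1
    rw [mul_assoc, mul_smul, inv_smul_eq_iff, mul_smul] at this
    exact this
  let _ : MulAction N {x : X // ∀ d ∈ E, d • x = x} :=
    { smul := fun n x => ⟨θ n • x.1, hmem n x.1 x.2⟩
      one_smul := fun x => Subtype.ext (by change θ 1 • x.1 = x.1; simp)
      mul_smul := fun a b x => Subtype.ext (by
        change θ (a * b) • x.1 = θ a • θ b • x.1; rw [map_mul, mul_smul]) }
  have := Fintype.ofFinite {x : X // ∀ d ∈ E, d • x = x}
  have := Fintype.ofFinite (Quotient (MulAction.orbitRel N {x : X // ∀ d ∈ E, d • x = x}))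
  have key := MulAction.sum_card_fixedBy_eq_card_orbits_mul_card_group N
    {x : X // ∀ d ∈ E, d • x = x}
  have h2 : ∀ n : N, Nat.card {x : X // (∀ d ∈ E, d • x = x) ∧ θ n • x = x} =
      Fintype.card (MulAction.fixedBy {x : X // ∀ d ∈ E, d • x = x} n) := by
    intro n
    rw [← Nat.card_eq_fintype_card]
    refine Nat.card_congr ((Equiv.subtypeSubtypeEquivSubtypeInter _ _).symm.trans
      (Equiv.subtypeEquivRight fun x => ?_))
    exact (Subtype.ext_iff (a1 := n • x) (a2 := x)).symm
  simp only [h2]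
  rw [key, Nat.card_eq_fintype_card]
  exact dvd_mul_left _ _

end Marks

/-! ### Stabilisation of finite sets with a group action -/

section Stabilization

variable {T : Type u} [Group T]

/-- All stabilisers of points of `X` belong to the family `C`. -/
def IsotropyIn (C : Set (Subgroup T)) (X : Type*) [MulAction T X] : Prop :=
  ∀ x : X, MulAction.stabilizer T x ∈ C

/-- A family `C` of subgroups with a choice `rep` of class representatives, for a class relation
with respect to which the normaliser of each member maps to the normaliser of its representative,
compatibly with the family and with the classes. -/
structure IsFusionFamily (C : Set (Subgroup T)) (rep : Subgroup T → Subgroup T) : Prop where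
  mem_of_le : ∀ {D R : Subgroup T}, D ∈ C → R ≤ D → R ∈ C
  conj_mem : ∀ {D : Subgroup T} (t : T), D ∈ C → conjSubgroup t D ∈ C
  rep_conj : ∀ {D : Subgroup T} (t : T), D ∈ C → rep (conjSubgroup t D) = rep D
  exists_hom : ∀ {D : Subgroup T}, D ∈ C →
    ∃ θ : Subgroup.normalizer (D : Set T) →* T, Function.Injective θ ∧
      (D.subgroupOf (Subgroup.normalizer (D : Set T))).map θ = rep D ∧
      ∀ R : Subgroup (Subgroup.normalizer (D : Set T)),
        (R.map θ ∈ C ↔ R.map (Subgroup.subtype _) ∈ C) ∧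
          (R.map (Subgroup.subtype _) ∈ C → rep (R.map θ) = rep (R.map (Subgroup.subtype _)))

/-- Identifies the terms of the orbit counting formula with marks at subgroups enlarged by one
element. -/
theorem mark_map_sup_zpowers {N : Type*} [Group N] (θ : N →* T) (K : Subgroup N) (n : N)
    (X : Type*) [MulAction T X] :
    mark X ((K ⊔ Subgroup.zpowers n).map θ) =
      Nat.card {x : X // (∀ d ∈ K.map θ, d • x = x) ∧ θ n • x = x} := by
  refine Nat.card_congr (Equiv.subtypeEquivRight fun x => ?_)
  have h (L : Subgroup N) : (∀ d ∈ L.map θ, d • x = x) ↔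
      L ≤ (MulAction.stabilizer T x).comap θ := by
    simp only [Subgroup.mem_map, forall_exists_index, and_imp, forall_apply_eq_imp_iff₂]
    rfl
  rw [h, h, sup_le_iff, Subgroup.zpowers_le]
  rfl

theorem mark_eq_zero_of_notMem {C : Set (Subgroup T)}
    (hC : ∀ {D R : Subgroup T}, D ∈ C → R ≤ D → R ∈ C) {X : Type*} [Finite X] [MulAction T X]
    (hX : IsotropyIn C X) {D : Subgroup T} (hD : D ∉ C) : mark X D = 0 :=
  mark_eq_zero_of_forall _ _ fun x hx => hD (hC (hX x) hx)

namespace IsFusionFamily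

variable {C : Set (Subgroup T)} {rep : Subgroup T → Subgroup T}

theorem map_subtype_subgroupOf {D N : Subgroup T} (h : D ≤ N) :
    (D.subgroupOf N).map N.subtype = D := by
  rw [Subgroup.subgroupOf_map_subtype, inf_eq_left.2 h]

theorem card_rep (h : IsFusionFamily C rep) {D : Subgroup T} (hD : D ∈ C) :
    Nat.card (rep D) = Nat.card D := by
  obtain ⟨θ, hθ, hD', -⟩ := h.exists_hom hD
  rw [← hD', ← Nat.card_congr (Subgroup.equivMapOfInjective _ θ hθ).toEquiv]
  exact Nat.card_congr (Subgroup.subgroupOfEquivOfLe Subgroup.le_normalizer).toEquiv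

theorem rep_mem (h : IsFusionFamily C rep) {D : Subgroup T} (hD : D ∈ C) : rep D ∈ C := by
  obtain ⟨θ, hθ, hD', hR⟩ := h.exists_hom hD
  rw [← hD', (hR _).1, map_subtype_subgroupOf Subgroup.le_normalizer]
  exact hD

theorem rep_rep (h : IsFusionFamily C rep) {D : Subgroup T} (hD : D ∈ C) :
    rep (rep D) = rep D := by
  obtain ⟨θ, hθ, hD', hR⟩ := h.exists_hom hD
  have h1 := (hR (D.subgroupOf _)).2
  rw [map_subtype_subgroupOf Subgroup.le_normalizer, hD'] at h1
  exact h1 hD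

theorem map_mem_normalizer {D E : Subgroup T} (θ : Subgroup.normalizer (D : Set T) →* T)
    (hθ : (D.subgroupOf (Subgroup.normalizer (D : Set T))).map θ = E)
    (n : Subgroup.normalizer (D : Set T)) : θ n ∈ Subgroup.normalizer (E : Set T) := by
  subst hθ
  have key (n : Subgroup.normalizer (D : Set T)) (y : T)
      (hy : y ∈ (D.subgroupOf (Subgroup.normalizer (D : Set T))).map θ) :
      θ n * y * (θ n)⁻¹ ∈ (D.subgroupOf (Subgroup.normalizer (D : Set T))).map θ := by
    obtain ⟨d, hd, rfl⟩ := hy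
    exact ⟨n * d * n⁻¹, (Subgroup.mem_normalizer_iff.1 n.2 d).1 hd, by simp⟩
  refine Subgroup.mem_normalizer_iff.2 fun y => ⟨key n y, fun hy => ?_⟩
  have := key n⁻¹ _ hy
  simpa [mul_assoc] using this

/-- The homomorphism `θ` embeds `N(D)` into the normaliser of `θ(D) = rep D`. -/
theorem card_normalizer_dvd (h : IsFusionFamily C rep) {D : Subgroup T} (hD : D ∈ C) :
    Nat.card (Subgroup.normalizer (D : Set T)) ∣
      Nat.card (Subgroup.normalizer (rep D : Set T)) := by
  obtain ⟨θ, hθ, hD', -⟩ := h.exists_hom hD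
  rw [Nat.card_congr (MonoidHom.ofInjective hθ).toEquiv]
  refine Subgroup.card_dvd_of_le ?_
  rintro _ ⟨n, rfl⟩
  exact map_mem_normalizer θ hD' n

variable [Finite T]

/-- `N(D)` acts on the fixed points of `D`, and through `θ` on those of `rep D`, so `|N(D)|` divides
both orbit counting sums. In their difference only the `|D|` elements of `D` survive, each
contributing the difference of the two marks. -/
theorem card_normalizer_dvd_mark_sub (h : IsFusionFamily C rep) {X : Type*} [Finite X]
    [MulAction T X] (hX : IsotropyIn C X) {D : Subgroup T} (hD : D ∈ C)
    (hst : ∀ E ∈ C, Nat.card D < Nat.card E → mark X E = mark X (rep E)) :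
    (Nat.card (Subgroup.normalizer (D : Set T)) : ℤ) ∣
      Nat.card D * ((mark X (rep D) : ℤ) - mark X D) := by
  classical
  obtain ⟨θ, hθ, hD', hR⟩ := h.exists_hom hD
  let N := Subgroup.normalizer (D : Set T)
  have := Fintype.ofFinite N
  let K : Subgroup N := D.subgroupOf N
  have hK : K.map N.subtype = D := map_subtype_subgroupOf Subgroup.le_normalizer
  have hcK : Nat.card K = Nat.card D :=
    Nat.card_congr (Subgroup.subgroupOfEquivOfLe Subgroup.le_normalizer).toEquiv
  have h1 := Int.natCast_dvd_natCast.2 (card_dvd_sum_card_fixed θ (X := X) (rep D)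
    (map_mem_normalizer θ hD'))
  have h2 := Int.natCast_dvd_natCast.2 (card_dvd_sum_card_fixed N.subtype (X := X) D
    (fun n => n.2))
  have h3 := dvd_sub h1 h2
  rw [Nat.cast_sum, Nat.cast_sum, ← Finset.sum_sub_distrib] at h3
  -- For `n` outside `D` both terms are marks at images of `D⟨n⟩`, which is larger than `D`. They
  -- agree by `hst` and the common representative, or both vanish outside `C`.
  have h4 (n : N) :
      ((Nat.card {x : X // (∀ d ∈ rep D, d • x = x) ∧ θ n • x = x} : ℤ) -
        Nat.card {x : X // (∀ d ∈ D, d • x = x) ∧ N.subtype n • x = x}) =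
      if n ∈ K then (mark X (rep D) : ℤ) - mark X D else 0 := by
    have e1 := mark_map_sup_zpowers θ K n X
    have e2 := mark_map_sup_zpowers N.subtype K n X
    rw [hD'] at e1
    rw [hK] at e2
    rw [← e1, ← e2]
    split_ifs with hn
    · rw [sup_eq_left.2 ((Subgroup.zpowers_le).2 hn), hK, hD']
    · rw [sub_eq_zero, Nat.cast_inj]
      by_cases hC : (K ⊔ Subgroup.zpowers n).map N.subtype ∈ C
      · have hC' := ((hR (K ⊔ Subgroup.zpowers n)).1).2 hC
        have hlt : Nat.card D < Nat.card (K ⊔ Subgroup.zpowers n : Subgroup N) := by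
          rw [← hcK]
          refine lt_of_le_of_ne (Subgroup.card_le_of_le le_sup_left) fun he => hn ?_
          have := Subgroup.eq_of_le_of_card_ge (le_sup_left : K ≤ K ⊔ Subgroup.zpowers n) he.ge
          rw [this]
          exact (le_sup_right : _ ≤ K ⊔ _) (Subgroup.mem_zpowers n)
        rw [hst _ hC, hst _ hC', (hR _).2 hC]
        · rwa [← Nat.card_congr (Subgroup.equivMapOfInjective _ θ hθ).toEquiv]
        · rwa [← Nat.card_congr
            (Subgroup.equivMapOfInjective _ N.subtype N.subtype_injective).toEquiv]
      · rw [mark_eq_zero_of_notMem h.mem_of_le hX hC,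
          mark_eq_zero_of_notMem h.mem_of_le hX (fun hC' => hC (((hR _).1).1 hC'))]
  simp only [h4] at h3
  rw [← Finset.sum_filter, Finset.sum_const, nsmul_eq_mul] at h3
  have hcard : (Finset.univ.filter fun n : N => n ∈ K).card = Nat.card D := by
    rw [← hcK, Nat.card_eq_fintype_card, Fintype.card_subtype]
  rw [hcard] at h3
  exact h3

/-- Copies of `T ⧸ D` are added one at a time, by induction on the total deficit over all subgroups
of order `n`. Each copy acts only on the conjugates of `D` at this order, and on nothing larger. -/
theorem exists_extension_of_target {C : Set (Subgroup T)}
    (hconj : ∀ {D : Subgroup T} (t : T), D ∈ C → conjSubgroup t D ∈ C)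
    (n : ℕ) (τ : Subgroup T → ℕ) (hτ : ∀ D ∈ C, ∀ t, τ (conjSubgroup t D) = τ D)
    (X : Type u) [Finite X] [MulAction T X] (hX : IsotropyIn C X)
    (hle : ∀ D ∈ C, Nat.card D = n → mark X D ≤ τ D)
    (hdvd : ∀ D ∈ C, Nat.card D = n → mark (T ⧸ D) D ∣ τ D - mark X D) :
    ∃ (Y : Type u) (_ : Finite Y) (_ : MulAction T Y), IsotropyIn C Y ∧
      (∀ D : Subgroup T, n < Nat.card D → mark Y D = mark X D) ∧
      ∀ D ∈ C, Nat.card D = n → mark Y D = τ D := by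
  classical
  have := Fintype.ofFinite (Subgroup T)
  induction hm : ∑ D ∈ Finset.univ.filter fun D => D ∈ C ∧ Nat.card D = n, (τ D - mark X D)
    using Nat.strong_induction_on generalizing X with | _ m ih =>
  by_cases hall : ∀ D ∈ C, Nat.card D = n → mark X D = τ D
  · exact ⟨X, ‹_›, ‹_›, hX, fun _ _ => rfl, hall⟩
  push Not at hall
  obtain ⟨D, hD, hDn, hne⟩ := hall
  have hpos : 0 < mark (T ⧸ D) D := by
    refine Nat.pos_of_ne_zero fun h0 => ?_
    have := mark_quotient_self D
    rw [h0, zero_mul] at this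
    exact Nat.card_pos.ne this
  have hX' : IsotropyIn C (X ⊕ (T ⧸ D)) := by
    rintro (x | q)
    · have : MulAction.stabilizer T (Sum.inl x : X ⊕ (T ⧸ D)) = MulAction.stabilizer T x := by
        ext t; simp [MulAction.mem_stabilizer_iff]
      rw [this]
      exact hX x
    · obtain ⟨t, rfl⟩ := QuotientGroup.mk_surjective q
      have : MulAction.stabilizer T (Sum.inr (t : T ⧸ D) : X ⊕ (T ⧸ D)) =
          MulAction.stabilizer T (t : T ⧸ D) := by
        ext s; simp [MulAction.mem_stabilizer_iff]
      rw [this, stabilizer_quotient_mk]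
      exact hconj t hD
  have hmark (R : Subgroup T) (hR : ∀ t, R ≠ conjSubgroup t D) (hn : n ≤ Nat.card R) :
      mark (X ⊕ (T ⧸ D)) R = mark X R := by
    rw [mark_sum, mark_quotient_eq_zero (hDn.trans_le hn) hR, add_zero]
  have hmark' (t : T) :
      mark (X ⊕ (T ⧸ D)) (conjSubgroup t D) = mark X D + mark (T ⧸ D) D := by
    rw [mark_conjSubgroup, mark_sum]
  -- The deficit at `D` is nonzero and divisible by `|N(D) : D|`, so one further copy does not
  -- overshoot.
  have hle' : mark X D + mark (T ⧸ D) D ≤ τ D := by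
    have h1 := hle D hD hDn
    have h2 := Nat.le_of_dvd (by omega) (hdvd D hD hDn)
    omega
  have hquot (t : T) : mark (T ⧸ conjSubgroup t D) (conjSubgroup t D) = mark (T ⧸ D) D := by
    have h1 := mark_quotient_self (conjSubgroup t D)
    have h2 := mark_quotient_self D
    have h3 : Nat.card (Subgroup.normalizer (conjSubgroup t D : Set T)) =
        Nat.card (Subgroup.normalizer (D : Set T)) := by
      have : Subgroup.normalizer (conjSubgroup t D : Set T) =
          conjSubgroup t (Subgroup.normalizer (D : Set T)) :=
        (Subgroup.map_equiv_normalizer_eq D (MulAut.conj t)).symm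
      rw [this, card_conjSubgroup]
    rw [h3, card_conjSubgroup, ← h2] at h1
    exact Nat.eq_of_mul_eq_mul_right Nat.card_pos h1
  have hdec : ∀ R ∈ C, Nat.card R = n → (mark (X ⊕ (T ⧸ D)) R ≤ τ R ∧
      mark (T ⧸ R) R ∣ τ R - mark (X ⊕ (T ⧸ D)) R) ∧
      mark X R ≤ mark (X ⊕ (T ⧸ D)) R := by
    intro R hR hRn
    refine ⟨?_, by rw [mark_sum]; omega⟩
    by_cases hc : ∃ t, R = conjSubgroup t D
    · obtain ⟨t, rfl⟩ := hc
      rw [hmark', hτ D hD, hquot]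
      refine ⟨hle', ?_⟩
      rw [Nat.sub_add_eq]
      exact Nat.dvd_sub (hdvd D hD hDn) dvd_rfl
    · push Not at hc
      rw [hmark R hc hRn.ge]
      exact ⟨hle R hR hRn, hdvd R hR hRn⟩
  obtain ⟨Y, hY1, hY2, hY3, hY4, hY5⟩ := ih _ (by
    rw [← hm]
    refine Finset.sum_lt_sum (fun R hR => ?_) ⟨D, by simp [hD, hDn], ?_⟩
    · have hR' := Finset.mem_filter.1 hR
      have := (hdec R hR'.2.1 hR'.2.2).2
      omega
    · rw [mark_sum]
      omega) (X ⊕ (T ⧸ D)) hX' (fun R hR hn => (hdec R hR hn).1.1)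
      (fun R hR hn => (hdec R hR hn).1.2) rfl
  refine ⟨Y, hY1, hY2, hY3, fun R hR => ?_, hY5⟩
  rw [hY4 R hR, hmark R ?_ hR.le]
  rintro t rfl
  rw [card_conjSubgroup] at hR
  omega

/-- Equalises the marks at one order. The last clause, that a representative whose mark is already
maximal in its class keeps it, is what preserves the mark at the diagonal of `S`. -/
theorem exists_extension_step (h : IsFusionFamily C rep) (n : ℕ) (X : Type u) [Finite X]
    [MulAction T X] (hX : IsotropyIn C X)
    (hst : ∀ E ∈ C, n < Nat.card E → mark X E = mark X (rep E)) :
    ∃ (Y : Type u) (_ : Finite Y) (_ : MulAction T Y), IsotropyIn C Y ∧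
      (∀ E ∈ C, n ≤ Nat.card E → mark Y E = mark Y (rep E)) ∧
      (∀ D : Subgroup T, n < Nat.card D → mark Y D = mark X D) ∧
      ∀ E : Subgroup T, rep E = E → E ∈ C → Nat.card E = n →
        (∀ D ∈ C, rep D = E → mark X D ≤ mark X E) → mark Y E = mark X E := by
  classical
  have := Fintype.ofFinite (Subgroup T)
  -- `L E` is the largest excess of a mark in the class over the mark at `E`. Adding it as a
  -- multiple of `|N(E) : E|` makes `τ` dominate all marks of the class without spoiling
  -- divisibility.
  let L (E : Subgroup T) : ℕ := (Finset.univ.filter fun D => D ∈ C ∧ rep D = E).sup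
    fun D => mark X D - mark X E
  let τ (E : Subgroup T) : ℕ := mark X E + L E * mark (T ⧸ E) E
  have hpos (D : Subgroup T) : 0 < mark (T ⧸ D) D := by
    refine Nat.pos_of_ne_zero fun h0 => ?_
    have := mark_quotient_self D
    rw [h0, zero_mul] at this
    exact Nat.card_pos.ne this
  have hle : ∀ D ∈ C, mark X D ≤ τ (rep D) := by
    intro D hD
    have h1 : mark X D - mark X (rep D) ≤ L (rep D) :=
      Finset.le_sup (f := fun D' => mark X D' - mark X (rep D)) (by simp [hD])
    have h2 := Nat.le_mul_of_pos_right (L (rep D)) (hpos (rep D))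
    change _ ≤ mark X (rep D) + L (rep D) * mark (T ⧸ rep D) (rep D)
    omega
  obtain ⟨Y, hY1, hY2, hY3, hY4, hY5⟩ := exists_extension_of_target (C := C) h.conj_mem n
    (fun D => τ (rep D)) (fun D hD t => by simp only [h.rep_conj t hD]) X hX
    (fun D hD _ => hle D hD) (fun D hD hn => by
      have h1 := h.card_normalizer_dvd_mark_sub hX hD (fun E hE hlt => hst E hE (hn ▸ hlt))
      -- The added term, times `|D| = |rep D|`, is `L · |N(rep D)|`, a multiple of `|N(D)|`.
      -- Cancelling `|D|` later turns this into divisibility by `|N(D) : D|`.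
      have h2 : (Nat.card (Subgroup.normalizer (D : Set T)) : ℤ) ∣
          Nat.card D * (τ (rep D) - mark X D) := by
        have h3 := Int.natCast_dvd_natCast.2 (h.card_normalizer_dvd hD)
        have h4 := mark_quotient_self (rep D)
        rw [h.card_rep hD] at h4
        have h5 : (Nat.card D : ℤ) * (τ (rep D) - mark X D) =
            Nat.card D * ((mark X (rep D) : ℤ) - mark X D) +
              L (rep D) * Nat.card (Subgroup.normalizer (rep D : Set T)) := by
          rw [← h4]
          simp only [τ]
          push_cast
          ring
        rw [h5]
        exact dvd_add h1 (h3.mul_left _)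
      rw [← mark_quotient_self D, ← Nat.cast_sub (hle D hD), ← Nat.cast_mul,
        Int.natCast_dvd_natCast, mul_comm] at h2
      exact Nat.dvd_of_mul_dvd_mul_left Nat.card_pos h2)
  refine ⟨Y, hY1, hY2, hY3, fun E hE hn => ?_, hY4, fun E hrep hE hn hdom => ?_⟩
  · rcases hn.eq_or_lt with hn | hn
    · rw [hY5 E hE hn.symm, hY5 _ (h.rep_mem hE) ((h.card_rep hE).trans hn.symm), h.rep_rep hE]
    · rw [hY4 _ hn, hY4 _ (hn.trans_eq (h.card_rep hE).symm), hst E hE hn]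
  · rw [hY5 E hE hn, hrep]
    have hL : L E = 0 := by
      refine (Finset.sup_eq_bot_iff _ _).2 fun D hD => ?_
      have hD' := (Finset.mem_filter.1 hD).2
      exact Nat.sub_eq_zero_of_le (hdom D hD'.1 hD'.2)
    simp [τ, hL]

/-- Descending induction on the order: each step leaves the marks at larger subgroups alone, so
stability already achieved there persists. -/
theorem exists_stable_extension (h : IsFusionFamily C rep) (n : ℕ) (X : Type u) [Finite X]
    [MulAction T X] (hX : IsotropyIn C X)
    (hst : ∀ E ∈ C, n < Nat.card E → mark X E = mark X (rep E)) :
    ∃ (Y : Type u) (_ : Finite Y) (_ : MulAction T Y), IsotropyIn C Y ∧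
      (∀ E ∈ C, mark Y E = mark Y (rep E)) ∧
      ∀ D : Subgroup T, n < Nat.card D → mark Y D = mark X D := by
  induction n generalizing X with
  | zero => exact ⟨X, ‹_›, ‹_›, hX, fun E hE => hst E hE Nat.card_pos, fun _ _ => rfl⟩
  | succ n ih =>
    obtain ⟨Y, _, _, hY3, hY4, hY5, -⟩ := h.exists_extension_step (n + 1) X hX hst
    obtain ⟨Z, hZ1, hZ2, hZ3, hZ4, hZ5⟩ := ih Y hY3 (fun E hE hn => hY4 E hE hn)
    exact ⟨Z, hZ1, hZ2, hZ3, hZ4, fun D hD => by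
      rw [hZ5 D (Nat.lt_of_succ_lt hD), hY5 D hD]⟩

end IsFusionFamily

end Stabilization

/-! ### Graphs of homomorphisms -/

section Graphs

variable {G H K : Type u} [Group G] [Group H] [Group K]

/-- The graph `{(ψ g, g) | g ∈ P}` of a homomorphism `ψ : P → H`. -/
def homGraph (P : Subgroup G) (ψ : P →* H) : Subgroup (H × G) := (ψ.prod P.subtype).range

theorem mem_homGraph {P : Subgroup G} {ψ : P →* H} {x : H × G} :
    x ∈ homGraph P ψ ↔ ∃ h : x.2 ∈ P, ψ ⟨x.2, h⟩ = x.1 := by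
  constructor
  · rintro ⟨g, rfl⟩
    exact ⟨g.2, rfl⟩
  · rintro ⟨h, e⟩
    exact ⟨⟨x.2, h⟩, Prod.ext e rfl⟩

theorem map_snd_homGraph (P : Subgroup G) (ψ : P →* H) :
    (homGraph P ψ).map (MonoidHom.snd H G) = P := by
  ext g
  constructor
  · rintro ⟨x, hx, rfl⟩
    exact (mem_homGraph.1 hx).1
  · intro h
    exact ⟨(ψ ⟨g, h⟩, g), mem_homGraph.2 ⟨h, rfl⟩, rfl⟩

theorem card_homGraph (P : Subgroup G) (ψ : P →* H) : Nat.card (homGraph P ψ) = Nat.card P :=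
  (Nat.card_congr (MonoidHom.ofInjective (f := ψ.prod P.subtype) fun _ _ h =>
    Subtype.ext (congrArg Prod.snd h)).toEquiv).symm

/-- Meeting `H × 1` trivially means that the projection of `D` to `G` is injective; `ψ` is its
inverse followed by the projection to `H`. -/
theorem exists_eq_homGraph (D : Subgroup (H × G)) (hD : ∀ h : H, (h, 1) ∈ D → h = 1) :
    ∃ (P : Subgroup G) (ψ : P →* H), D = homGraph P ψ := by
  let f : D →* D.map (MonoidHom.snd H G) := (MonoidHom.snd H G).subgroupMap D
  have hf : Function.Bijective f := by
    refine ⟨(injective_iff_map_eq_one f).2 ?_, (MonoidHom.snd H G).subgroupMap_surjective D⟩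
    rintro ⟨⟨h, g⟩, hx⟩ h1
    have hg : g = 1 := congrArg Subtype.val h1
    subst hg
    exact Subtype.ext (Prod.ext (hD h hx) rfl)
  let e := MulEquiv.ofBijective f hf
  refine ⟨_, (MonoidHom.fst H G).comp (D.subtype.comp e.symm.toMonoidHom), ?_⟩
  have he (d : D) : ((e d : _) : G) = d.1.2 := rfl
  ext x
  rw [mem_homGraph]
  constructor
  · intro hx
    refine ⟨⟨x, hx, rfl⟩, ?_⟩
    have : e.symm ⟨x.2, ⟨x, hx, rfl⟩⟩ = ⟨x, hx⟩ := by
      rw [MulEquiv.symm_apply_eq]; rfl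
    simp [this]
  · rintro ⟨h, e'⟩
    have h1 := congrArg Subtype.val (e.apply_symm_apply ⟨x.2, h⟩)
    rw [he] at h1
    have : (e.symm ⟨x.2, h⟩).1 = x := Prod.ext e' h1
    rw [← this]
    exact (e.symm ⟨x.2, h⟩).2

/-- The composite `{(a, c) | (a, b) ∈ D, (b, c) ∈ E}` of two relations. -/
def relComp (D : Subgroup (K × H)) (E : Subgroup (H × G)) : Subgroup (K × G) where
  carrier := {x | ∃ h, (x.1, h) ∈ D ∧ (h, x.2) ∈ E}
  one_mem' := ⟨1, D.one_mem, E.one_mem⟩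
  mul_mem' := by
    rintro a b ⟨h, h1, h2⟩ ⟨k, k1, k2⟩
    exact ⟨h * k, D.mul_mem h1 k1, E.mul_mem h2 k2⟩
  inv_mem' := by
    rintro a ⟨h, h1, h2⟩
    exact ⟨h⁻¹, D.inv_mem h1, E.inv_mem h2⟩

/-- The converse relation. -/
abbrev relInv (D : Subgroup (H × G)) : Subgroup (G × H) :=
  D.comap (MulEquiv.prodComm (M := G) (N := H)).toMonoidHom

theorem mem_relInv {D : Subgroup (H × G)} {x : G × H} : x ∈ relInv D ↔ (x.2, x.1) ∈ D := Iff.rfl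

end Graphs

/-! ### Bisets as sets with an action of the product group -/

namespace Biset

variable {G H K L : Type u} [Group G] [Group H] [Group K] [Group L]

/-- A `(G, H)`-biset as a set with left action of `H × G`, by `(h, g) · x = h x g⁻¹`. -/
instance prodAction (X : Biset G H) : MulAction (H × G) X.carrier where
  smul t x := t.1 • MulOpposite.op t.2⁻¹ • x
  one_smul x := by change (1 : H) • MulOpposite.op (1 : G)⁻¹ • x = x; simp
  mul_smul s t x := by
    change (s.1 * t.1) • MulOpposite.op (s.2 * t.2)⁻¹ • x =
      s.1 • MulOpposite.op s.2⁻¹ • t.1 • MulOpposite.op t.2⁻¹ • x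
    rw [mul_inv_rev, MulOpposite.op_mul, mul_smul, mul_smul, ← smul_comm t.1 (MulOpposite.op s.2⁻¹)]

theorem prod_smul_def (X : Biset G H) (t : H × G) (x : X.carrier) :
    t • x = t.1 • MulOpposite.op t.2⁻¹ • x := rfl

theorem mem_stabilizer_iff {X : Biset G H} {x : X.carrier} {t : H × G} :
    t ∈ MulAction.stabilizer (H × G) x ↔ t.1 • x = MulOpposite.op t.2 • x := by
  rw [MulAction.mem_stabilizer_iff, prod_smul_def, smul_comm, MulOpposite.op_inv,
    inv_smul_eq_iff]

theorem stabilizer_free {X : Biset G H} (x : X.carrier) (h : H)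
    (hh : (h, (1 : G)) ∈ MulAction.stabilizer (H × G) x) : h = 1 :=
  X.free h x (by simpa using mem_stabilizer_iff.1 hh)

theorem equiv_of_prod {X Y : Biset G H} (e : X.carrier ≃ Y.carrier)
    (he : ∀ (t : H × G) x, e (t • x) = t • e x) : X ≈ Y := by
  refine ⟨e, fun h x => ?_, fun g x => ?_⟩
  · simpa [prod_smul_def] using he (h, 1) x
  · simpa [prod_smul_def] using he (1, g.unop⁻¹) x

theorem exists_prod_equiv {X Y : Biset G H} (h : X ≈ Y) :
    ∃ e : X.carrier ≃ Y.carrier, ∀ (t : H × G) x, e (t • x) = t • e x := by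
  obtain ⟨e, h1, h2⟩ := h
  exact ⟨e, fun t x => by rw [prod_smul_def, prod_smul_def, h1, h2]⟩

/-- The biset of a finite `H × G`-set on which `H` acts freely. -/
def ofProd (X : Type u) [Finite X] [MulAction (H × G) X]
    (hX : ∀ (h : H) (x : X), (h, (1 : G)) • x = x → h = 1) : Biset G H :=
  letI : MulAction H X := MulAction.compHom X (MonoidHom.inl H G)
  letI : MulAction Gᵐᵒᵖ X :=
    { smul := fun g x => ((1 : H), g.unop⁻¹) • x
      one_smul := fun x => by
        change ((1 : H), (1 : G)⁻¹) • x = x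
        rw [inv_one]; exact one_smul _ x
      mul_smul := fun a b x => by
        change ((1 : H), (b.unop * a.unop)⁻¹) • x = ((1 : H), a.unop⁻¹) • ((1 : H), b.unop⁻¹) • x
        rw [smul_smul]; simp }
  haveI : SMulCommClass H Gᵐᵒᵖ X := ⟨fun h g x => by
    change (h, (1 : G)) • ((1 : H), g.unop⁻¹) • x = ((1 : H), g.unop⁻¹) • (h, (1 : G)) • x
    rw [smul_smul, smul_smul]; simp⟩
  { carrier := X
    free := hX }

/-- The product action rebuilt from the two one-sided actions contains a double inverse, so it
equals the original one only after a rewrite; the two instances on the same carrier are therefore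
named explicitly. -/
theorem ofProd_smul (X : Type u) [Finite X] [MulAction (H × G) X]
    (hX : ∀ (h : H) (x : X), (h, (1 : G)) • x = x → h = 1) (t : H × G)
    (x : X) : @SMul.smul (H × G) (ofProd X hX).carrier _ t x = @SMul.smul (H × G) X _ t x := by
  have : (t.1, (1 : G)) • ((1 : H), (t.2⁻¹)⁻¹) • x = t • x := by
    rw [smul_smul]
    simp
  exact this

theorem stabilizer_ofProd (X : Type u) [Finite X] [MulAction (H × G) X]
    (hX : ∀ (h : H) (x : X), (h, (1 : G)) • x = x → h = 1) (x : X) :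
    @MulAction.stabilizer (H × G) (ofProd X hX).carrier _ _ x =
      @MulAction.stabilizer (H × G) X _ _ x := by
  ext t
  exact Eq.congr_left (ofProd_smul X hX t x)

theorem mark_ofProd (X : Type u) [Finite X] [MulAction (H × G) X]
    (hX : ∀ (h : H) (x : X), (h, (1 : G)) • x = x → h = 1) (D : Subgroup (H × G)) :
    mark (ofProd X hX).carrier D = mark X D :=
  mark_congr (X := (ofProd X hX).carrier) (Y := X) (Equiv.refl _) (ofProd_smul X hX) D

theorem equiv_of_mark_eq [Finite G] [Finite H] {X Y : Biset G H}
    (h : ∀ D : Subgroup (H × G), mark X.carrier D = mark Y.carrier D) : X ≈ Y := by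
  obtain ⟨e, he⟩ := exists_equiv_of_mark_eq h
  exact equiv_of_prod e he

theorem mark_eq_of_equiv {X Y : Biset G H} (h : X ≈ Y) (D : Subgroup (H × G)) :
    mark X.carrier D = mark Y.carrier D := by
  obtain ⟨e, he⟩ := exists_prod_equiv h
  exact mark_congr e he D

theorem mark_sum_carrier (X Y : Biset G H) (D : Subgroup (H × G)) :
    mark (X.sum Y).carrier D = mark X.carrier D + mark Y.carrier D := by
  refine Eq.trans ?_ (mark_sum X.carrier Y.carrier D)
  exact mark_congr (X := (X.sum Y).carrier) (Y := X.carrier ⊕ Y.carrier) (Equiv.refl _)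
    (by rintro t (x | x) <;> rfl) D

/-! #### Transitive bisets -/

section Basis

variable [Finite G] [Finite H] (P : Subgroup G) (ψ : P →* H)

/-- The base point `(1, 1)` of `H ×_{(P, ψ)} G`. -/
def basisPoint : (basis P ψ).carrier := Quotient.mk (basisSetoid P ψ) (1, 1)

theorem basis_mk_eq (h : H) (g : G) :
    (Quotient.mk (basisSetoid P ψ) (h, g) : (basis P ψ).carrier) =
      (h, g⁻¹) • basisPoint P ψ := by
  rw [prod_smul_def]
  exact congrArg (Quotient.mk (basisSetoid P ψ)) (Prod.ext (by simp) (by simp))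

theorem stabilizer_basisPoint :
    MulAction.stabilizer (H × G) (basisPoint P ψ) = homGraph P ψ := by
  ext ⟨h, g⟩
  rw [mem_stabilizer_iff, mem_homGraph]
  constructor
  · intro e
    obtain ⟨k, h1, h2⟩ := Quotient.exact (s := basisSetoid P ψ) (a := (h * 1, 1)) (b := (1, 1 * g)) e
    simp only [mul_one, one_mul] at h1 h2
    have hk : g = (k⁻¹ : P) := by
      rw [Subgroup.coe_inv]; exact eq_inv_of_mul_eq_one_right h1.symm
    refine ⟨hk ▸ (k⁻¹).2, ?_⟩
    have : (⟨g, hk ▸ (k⁻¹).2⟩ : P) = k⁻¹ := Subtype.ext hk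
    change ψ ⟨g, _⟩ = h
    rw [this, map_inv]
    exact inv_eq_of_mul_eq_one_left h2.symm
  · rintro ⟨hg, e⟩
    have e' : h = ψ ⟨g, hg⟩ := e.symm
    exact Quotient.sound (s := basisSetoid P ψ) (a := (h * 1, 1)) (b := (1, 1 * g))
      ⟨⟨g, hg⟩⁻¹, by simp, by simp [e']⟩

theorem exists_smul_basisPoint (x : (basis P ψ).carrier) :
    ∃ t : H × G, t • basisPoint P ψ = x := by
  obtain ⟨⟨h, g⟩⟩ := x
  exact ⟨_, (basis_mk_eq P ψ h g).symm⟩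

theorem exists_stabilizer_basis (x : (basis P ψ).carrier) :
    ∃ t : H × G, MulAction.stabilizer (H × G) x = conjSubgroup t (homGraph P ψ) := by
  obtain ⟨t, rfl⟩ := exists_smul_basisPoint P ψ x
  exact ⟨t, by rw [MulAction.stabilizer_smul_eq_stabilizer_map_conj, stabilizer_basisPoint]⟩

theorem exists_quotient_equiv_basis : ∃ e : ((H × G) ⧸ homGraph P ψ) ≃ (basis P ψ).carrier,
    ∀ (t : H × G) x, e (t • x) = t • e x := by
  rw [← stabilizer_basisPoint]
  refine ⟨Equiv.ofBijective (MulAction.ofQuotientStabilizer (H × G) (basisPoint P ψ))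
    ⟨MulAction.injective_ofQuotientStabilizer _ _, fun x => ?_⟩,
    MulAction.ofQuotientStabilizer_smul _ _⟩
  obtain ⟨t, rfl⟩ := exists_smul_basisPoint P ψ x
  exact ⟨(t : (H × G) ⧸ _), rfl⟩

end Basis

theorem equiv_empty {X : Biset G H} (h : IsEmpty X.carrier) : X ≈ empty G H :=
  equiv_of_prod ((Equiv.equivOfIsEmpty X.carrier PEmpty)) (fun _ x => isEmptyElim x)

/-- Freeness makes the stabiliser of `x` a graph, so the orbit of `x` is a transitive biset `[P,
ψ]`; `Y` is the rest of `X`. -/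
theorem exists_equiv_basis_sum [Finite G] [Finite H] {X : Biset G H} (x : X.carrier) :
    ∃ (P : Subgroup G) (ψ : P →* H) (Y : Biset G H),
      MulAction.stabilizer (H × G) x = homGraph P ψ ∧ Nat.card Y.carrier < Nat.card X.carrier ∧
      (∀ y : Y.carrier, ∃ x' : X.carrier,
        MulAction.stabilizer (H × G) y = MulAction.stabilizer (H × G) x') ∧
      X ≈ (basis P ψ).sum Y := by
  obtain ⟨P, ψ, hP⟩ := exists_eq_homGraph (MulAction.stabilizer (H × G) x) (stabilizer_free x)
  obtain ⟨Y, _, _, e₀, hcard, he₀⟩ := exists_equiv_quotient_sum (T := H × G) x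
  have hst (y : Y) : MulAction.stabilizer (H × G) y =
      MulAction.stabilizer (H × G) (e₀.symm (Sum.inr y)) := by
    ext t
    rw [MulAction.mem_stabilizer_iff, MulAction.mem_stabilizer_iff, ← e₀.apply_eq_iff_eq, he₀,
      Equiv.apply_symm_apply]
    exact (Sum.inr_injective.eq_iff (a := t • y) (b := y)).symm
  let Y' : Biset G H := ofProd Y fun h y hy => by
    refine stabilizer_free (e₀.symm (Sum.inr y)) h ?_
    rw [← hst]
    exact hy
  obtain ⟨e, he⟩ : ∃ e : X.carrier ≃ ((H × G) ⧸ homGraph P ψ) ⊕ Y,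
      ∀ (t : H × G) z, e (t • z) = t • e z := by
    rw [← hP]; exact ⟨e₀, he₀⟩
  obtain ⟨f, hf⟩ := exists_quotient_equiv_basis P ψ
  refine ⟨P, ψ, Y', hP, hcard, fun y => ⟨e₀.symm (Sum.inr y), Eq.trans (stabilizer_ofProd Y _ y) (hst y)⟩, ?_⟩
  · let ι : Y ≃ Y'.carrier := Equiv.refl Y
    refine equiv_of_prod (Y := (basis P ψ).sum Y') (e.trans (Equiv.sumCongr f ι)) fun t z => ?_
    change Sum.map f ι (e (t • z)) = t • (show ((basis P ψ).sum Y').carrier from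
      Sum.map f ι (e z))
    rw [he]
    rcases e z with a | a
    · exact congrArg Sum.inl (hf t a)
    · exact congrArg Sum.inr (ofProd_smul Y _ t a).symm

/-! #### Composition -/

/-- If `(k x, y) ∼ (x, y g)`, the element `l` of `H` realising the relation satisfies `k x = x l`
and `l y = y g`. -/
theorem stabilizer_compMk_le (X : Biset H K) (Y : Biset G H) (x : X.carrier) (y : Y.carrier) :
    MulAction.stabilizer (K × G) (compMk X Y x y) ≤
      relComp (MulAction.stabilizer (K × H) x) (MulAction.stabilizer (H × G) y) := by
  rintro ⟨k, g⟩ h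
  rw [mem_stabilizer_iff] at h
  obtain ⟨l, h1, h2⟩ := Quotient.exact (s := compSetoid X Y) (a := (k • x, y))
    (b := (x, MulOpposite.op g • y)) h
  exact ⟨l, mem_stabilizer_iff.2 h1, mem_stabilizer_iff.2 h2.symm⟩

theorem card_eq_card_orbits_mul {A : Type u} [Group A] {X : Type u} [MulAction A X]
    (hX : ∀ (a : A) (x : X), a • x = x → a = 1) :
    Nat.card X = Nat.card (MulAction.orbitRel.Quotient A X) * Nat.card A := by
  rw [← Nat.card_prod]
  exact Nat.card_congr (MulAction.selfEquivOrbitsQuotientProd fun x =>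
    (Subgroup.eq_bot_iff_forall _).2 fun a ha => hX a x ha)

/-- The composite is the orbit set of `H` on `X × Y`, and this action is free because it is free on
`Y`. -/
theorem card_comp_mul (X : Biset H K) (Y : Biset G H) :
    Nat.card (X.comp Y).carrier * Nat.card H = Nat.card X.carrier * Nat.card Y.carrier := by
  let _ : MulAction H (X.carrier × Y.carrier) :=
    { smul := fun h a => (MulOpposite.op h⁻¹ • a.1, h • a.2)
      one_smul := fun a => Prod.ext
        (by change MulOpposite.op (1 : H)⁻¹ • a.1 = a.1; simp) (one_smul _ _)
      mul_smul := fun h k a => Prod.ext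
        (by
          change MulOpposite.op (h * k)⁻¹ • a.1 = MulOpposite.op h⁻¹ • MulOpposite.op k⁻¹ • a.1
          rw [smul_smul, ← MulOpposite.op_mul, mul_inv_rev])
        (mul_smul _ _ _) }
  rw [← Nat.card_prod X.carrier, card_eq_card_orbits_mul (A := H) (X := X.carrier × Y.carrier)
    fun h a ha => Y.free h a.2 (congrArg Prod.snd ha)]
  congr 1
  refine Nat.card_congr (Quotient.congr (Equiv.refl _) fun a b => ?_)
  change (∃ h : H, a.1 = MulOpposite.op h • b.1 ∧ b.2 = h • a.2) ↔
    ∃ h : H, (MulOpposite.op h⁻¹ • b.1, h • b.2) = a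
  constructor
  · rintro ⟨h, h1, h2⟩
    exact ⟨h⁻¹, Prod.ext (by rw [inv_inv, h1]) (by rw [h2, inv_smul_smul])⟩
  · rintro ⟨h, rfl⟩
    exact ⟨h⁻¹, rfl, (inv_smul_smul h b.2).symm⟩

theorem numOrbits_mul_card (X : Biset G H) :
    X.numOrbits * Nat.card H = Nat.card X.carrier :=
  (card_eq_card_orbits_mul X.free).symm

theorem numOrbits_comp [Finite H] [Finite K] (X : Biset H K) (Y : Biset G H) :
    (X.comp Y).numOrbits = X.numOrbits * Y.numOrbits := by
  have h := card_comp_mul X Y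
  rw [← numOrbits_mul_card, ← numOrbits_mul_card, ← numOrbits_mul_card] at h
  have hpos : 0 < Nat.card K * Nat.card H := Nat.mul_pos Nat.card_pos Nat.card_pos
  refine Nat.eq_of_mul_eq_mul_right hpos ?_
  linarith

/-! #### Restriction -/

/-- Restriction of the right action along a homomorphism. -/
def restrictRight (X : Biset G H) (φ : L →* G) : Biset L H :=
  letI : MulAction Lᵐᵒᵖ X.carrier := MulAction.compHom X.carrier φ.op
  haveI : SMulCommClass H Lᵐᵒᵖ X.carrier :=
    ⟨fun h g x => smul_comm h (MulOpposite.op (φ g.unop)) x⟩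
  { carrier := X.carrier
    free := X.free }

/-- Restriction of the left action along an injective homomorphism. -/
def restrictLeft (X : Biset G H) (φ : L →* H) (hφ : Function.Injective φ) : Biset G L :=
  letI : MulAction L X.carrier := MulAction.compHom X.carrier φ
  haveI : SMulCommClass L Gᵐᵒᵖ X.carrier := ⟨fun h g x => smul_comm (φ h) g x⟩
  { carrier := X.carrier
    free := fun h x hx => hφ (by rw [map_one]; exact X.free (φ h) x hx) }

theorem mark_restrictRight (X : Biset G H) (φ : L →* G) (R : Subgroup (H × L)) :
    mark (X.restrictRight φ).carrier R =
      mark X.carrier (R.map ((MonoidHom.id H).prodMap φ)) := by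
  refine Nat.card_congr (Equiv.subtypeEquivRight fun x => ?_)
  simp only [Subgroup.mem_map, forall_exists_index, and_imp, forall_apply_eq_imp_iff₂]
  refine forall₂_congr fun r _ => ?_
  change r.1 • MulOpposite.op (φ r.2⁻¹) • (show X.carrier from x) = x ↔
    r.1 • MulOpposite.op (φ r.2)⁻¹ • (show X.carrier from x) = x
  rw [map_inv]

theorem mark_restrictLeft (X : Biset G H) (φ : L →* H) (hφ : Function.Injective φ)
    (R : Subgroup (L × G)) :
    mark (X.restrictLeft φ hφ).carrier R =
      mark X.carrier (R.map (φ.prodMap (MonoidHom.id G))) := by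
  refine Nat.card_congr (Equiv.subtypeEquivRight fun x => ?_)
  simp only [Subgroup.mem_map, forall_exists_index, and_imp, forall_apply_eq_imp_iff₂]
  rfl

/-- Every class has exactly one representative `(x, base point)`, since the left action of `G` on
`[L, φ]` is free and transitive. -/
theorem comp_basis_top [Finite L] [Finite G] (X : Biset G H) (φ : L →* G) :
    X.comp (basis ⊤ (φ.comp (⊤ : Subgroup L).subtype)) ≈ X.restrictRight φ := by
  refine Setoid.symm ?_
  have hpt (g : G) (l : L) : (Quotient.mk (basisSetoid ⊤ (φ.comp (⊤ : Subgroup L).subtype)) (g, l) :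
      (basis ⊤ (φ.comp (⊤ : Subgroup L).subtype)).carrier) =
      (g * φ l) • basisPoint ⊤ (φ.comp (⊤ : Subgroup L).subtype) :=
    Quotient.sound (s := basisSetoid ⊤ (φ.comp (⊤ : Subgroup L).subtype)) (a := (g, l))
      (b := (g * φ l * 1, 1)) ⟨⟨l, trivial⟩, by simp, by simp⟩
  have hmove (x : X.carrier) (y : (basis ⊤ (φ.comp (⊤ : Subgroup L).subtype)).carrier) (g : G) :
      compMk X _ x (g • y) = compMk X _ (MulOpposite.op g • x) y :=
    (Quotient.sound (s := compSetoid X (basis ⊤ (φ.comp (⊤ : Subgroup L).subtype)))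
      (a := (MulOpposite.op g • x, y)) (b := (x, g • y)) ⟨g, rfl, rfl⟩).symm
  refine iso_mk (X := X.restrictRight φ)
    (fun x : X.carrier => compMk X _ x (basisPoint ⊤ (φ.comp (⊤ : Subgroup L).subtype)))
    ⟨?_, ?_⟩ (fun _ _ => rfl) ?_
  · intro (x : X.carrier) (x' : X.carrier) h
    obtain ⟨g, h1, h2⟩ := Quotient.exact (s := compSetoid X _) h
    have hg : g = 1 := (basis _ _).free g _ h2.symm
    change x = MulOpposite.op g • x' at h1
    rw [h1, hg, MulOpposite.op_one, one_smul]
  · rintro ⟨x, ⟨g, l⟩⟩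
    refine ⟨MulOpposite.op (g * φ l) • x, ?_⟩
    refine (hmove _ _ _).symm.trans ?_
    rw [← hpt]
    rfl
  · intro l (x : X.carrier)
    change compMk X _ (MulOpposite.op (φ l.unop) • x) _ = compMk X _ x (l • basisPoint _ _)
    rw [← hmove]
    congr 1
    refine Eq.trans ?_ (hpt 1 l.unop).symm |>.trans ?_
    · rw [one_mul]
    · exact congrArg (Quotient.mk _) (Prod.ext rfl (one_mul _).symm)

/-- As `e` is an isomorphism, the right action of `H` on `[Q, e]` is free and transitive, so each
class is uniquely (base point, `x`). Left multiplication by `l` moves the base point as right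
multiplication by `e⁻¹(l)` does. -/
theorem basis_comp [Finite L] [Finite H] (Q : Subgroup H) (e : Q ≃* L) (φ : L →* H)
    (hφ : Function.Injective φ) (he : ∀ l, φ l = e.symm l) (X : Biset G H) :
    (basis Q e.toMonoidHom).comp X ≈ X.restrictLeft φ hφ := by
  refine Setoid.symm ?_
  have hpt (l : L) (h : H) : (Quotient.mk (basisSetoid Q e.toMonoidHom) (l, h) :
      (basis Q e.toMonoidHom).carrier) =
      MulOpposite.op (φ l * h) • basisPoint Q e.toMonoidHom :=
    (Quotient.sound (s := basisSetoid Q e.toMonoidHom) (a := (1, 1 * (φ l * h)))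
      (b := (l, h)) ⟨e.symm l, by simp [he], by simp⟩).symm
  have hmove (x : X.carrier) (y : (basis Q e.toMonoidHom).carrier) (h : H) :
      compMk _ X y (h • x) = compMk _ X (MulOpposite.op h • y) x :=
    (Quotient.sound (s := compSetoid (basis Q e.toMonoidHom) X)
      (a := (MulOpposite.op h • y, x)) (b := (y, h • x)) ⟨h, rfl, rfl⟩).symm
  refine iso_mk (X := X.restrictLeft φ hφ)
    (fun x : X.carrier => compMk _ X (basisPoint Q e.toMonoidHom) x)
    ⟨?_, ?_⟩ ?_ (fun _ _ => rfl)
  · intro (x : X.carrier) (x' : X.carrier) h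
    obtain ⟨g, h1, h2⟩ := Quotient.exact (s := compSetoid _ X) h
    change basisPoint Q e.toMonoidHom = MulOpposite.op g • basisPoint Q e.toMonoidHom at h1
    have h3 : ((1 : L), g) ∈ homGraph Q e.toMonoidHom := by
      rw [← stabilizer_basisPoint, mem_stabilizer_iff, one_smul]
      exact h1
    obtain ⟨hg, h4⟩ := mem_homGraph.1 h3
    have h5 : (⟨g, hg⟩ : Q) = 1 := e.injective (h4.trans (map_one e).symm)
    have h6 : g = 1 := congrArg Subtype.val h5
    change x' = g • x at h2
    rw [h2, h6, one_smul]
  · rintro ⟨⟨l, h⟩, x⟩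
    refine ⟨(φ l * h) • x, ?_⟩
    refine (hmove _ _ _).trans ?_
    rw [← hpt]
    rfl
  · intro l (x : X.carrier)
    change compMk _ X _ (φ l • x) = compMk _ X (l • basisPoint _ _) x
    rw [hmove]
    congr 1
    refine Eq.trans ?_ (hpt l 1).symm |>.trans ?_
    · rw [mul_one]
    · exact congrArg (Quotient.mk _) (Prod.ext (mul_one _).symm rfl)

end Biset

/-! ### The structure of the Burnside modules -/

namespace Burnside

variable {G H K : Type u} [Group G] [Group H] [Group K]

theorem ofBiset_congr {X Y : Biset G H} (h : X ≈ Y) : ofBiset X = ofBiset Y :=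
  congrArg GrothendieckAddGroup.of (Quotient.sound h)

theorem ofBiset_sum (X Y : Biset G H) : ofBiset (X.sum Y) = ofBiset X + ofBiset Y :=
  map_add GrothendieckAddGroup.of (BisetClass.mk X) (BisetClass.mk Y)

theorem ofBiset_empty : ofBiset (Biset.empty G H) = 0 :=
  map_zero (GrothendieckAddGroup.of (M := BisetClass G H))

theorem comp_ofBiset (X : Biset H K) (Y : Biset G H) :
    comp (ofBiset X) (ofBiset Y) = ofBiset (X.comp Y) :=
  comp_of (BisetClass.mk X) (BisetClass.mk Y)

theorem augmentation_ofBiset (X : Biset G H) : augmentation (ofBiset X) = X.numOrbits :=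
  lift_of _ _

theorem exists_eq_sub (z : Burnside G H) : ∃ X Y : Biset G H, z = ofBiset X - ofBiset Y := by
  obtain ⟨⟨x, ⟨y, _⟩⟩, h⟩ := (AddLocalization.addMonoidOf (⊤ : AddSubmonoid (BisetClass G H))).surj z
  obtain ⟨X, hX⟩ := Quotient.exists_rep x
  obtain ⟨Y, hY⟩ := Quotient.exists_rep y
  subst hX hY
  exact ⟨X, Y, eq_sub_of_add_eq h⟩

theorem augmentation_comp [Finite H] [Finite K] (x : Burnside H K) (y : Burnside G H) :
    augmentation (comp x y) = augmentation x * augmentation y := by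
  obtain ⟨X, X', rfl⟩ := exists_eq_sub x
  obtain ⟨Y, Y', rfl⟩ := exists_eq_sub y
  simp only [map_sub, AddMonoidHom.sub_apply, comp_ofBiset, augmentation_ofBiset,
    Biset.numOrbits_comp]
  push_cast
  ring

/-- The number of fixed points of a subgroup of `H × G`, as a homomorphism on `A(G, H)`. -/
noncomputable def markHom (D : Subgroup (H × G)) : Burnside G H →+ ℤ :=
  GrothendieckAddGroup.lift
    { toFun := Quotient.lift (fun X => (mark X.carrier D : ℤ)) fun _ _ h =>
        congrArg Nat.cast (Biset.mark_eq_of_equiv h D)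
      map_zero' := by
        have : IsEmpty (Biset.empty G H).carrier := ⟨fun x => PEmpty.elim x⟩
        exact congrArg Nat.cast (mark_eq_zero_of_forall _ D fun x => isEmptyElim x)
      map_add' := by
        rintro ⟨X⟩ ⟨Y⟩
        exact (congrArg Nat.cast (Biset.mark_sum_carrier X Y D)).trans (Nat.cast_add _ _) }

theorem markHom_ofBiset (D : Subgroup (H × G)) (X : Biset G H) :
    markHom D (ofBiset X) = mark X.carrier D :=
  lift_of _ _

/-- Marks embed `A(G, H)` in a product of copies of `ℤ`; in particular it is torsion-free. -/
theorem eq_zero_of_markHom [Finite G] [Finite H] (z : Burnside G H)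
    (h : ∀ D, markHom D z = 0) : z = 0 := by
  obtain ⟨X, Y, rfl⟩ := exists_eq_sub z
  rw [sub_eq_zero]
  refine ofBiset_congr (Biset.equiv_of_mark_eq fun D => ?_)
  have := h D
  rw [map_sub, markHom_ofBiset, markHom_ofBiset, sub_eq_zero] at this
  exact_mod_cast this

theorem eq_zero_of_nsmul_eq_zero [Finite G] [Finite H] {n : ℕ} (hn : n ≠ 0) {z : Burnside G H}
    (h : n • z = 0) : z = 0 :=
  eq_zero_of_markHom z fun D => by
    have := congrArg (markHom D) h
    rw [map_nsmul, map_zero, nsmul_eq_mul] at this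
    exact (mul_eq_zero.1 this).resolve_left (by exact_mod_cast hn)

/-- Orbit decomposition, as a membership criterion: only the transitive bisets given by isotropy
groups of `X` need to lie in `N`. -/
theorem ofBiset_mem [Finite G] [Finite H] (N : AddSubgroup (Burnside G H)) (X : Biset G H)
    (h : ∀ (x : X.carrier) (P : Subgroup G) (ψ : P →* H),
      MulAction.stabilizer (H × G) x = homGraph P ψ → basis P ψ ∈ N) : ofBiset X ∈ N := by
  induction hn : Nat.card X.carrier using Nat.strong_induction_on generalizing X with | _ n ih =>
  rcases isEmpty_or_nonempty X.carrier with hX | ⟨⟨x⟩⟩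
  · rw [ofBiset_congr (Biset.equiv_empty hX), ofBiset_empty]
    exact N.zero_mem
  · obtain ⟨P, ψ, Y, hP, hcard, hY, hXY⟩ := Biset.exists_equiv_basis_sum x
    rw [ofBiset_congr hXY, ofBiset_sum]
    refine N.add_mem (h x P ψ hP) (ih _ (hn ▸ hcard) Y (fun y Q χ hQ => ?_) rfl)
    obtain ⟨x', hx'⟩ := hY y
    exact h x' Q χ (hx'.symm.trans hQ)

instance finite_int [Finite G] [Finite H] : Module.Finite ℤ (Burnside G H) := by
  rw [Module.Finite.iff_addGroup_fg, AddGroup.fg_iff]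
  have hfin (P : Subgroup G) : Finite (P →* H) := DFunLike.finite _
  refine ⟨Set.range fun a : (Σ P : Subgroup G, P →* H) => basis a.1 a.2, ?_,
    Set.finite_range _⟩
  refine (AddSubgroup.eq_top_iff' _).2 fun z => ?_
  obtain ⟨X, Y, rfl⟩ := exists_eq_sub z
  have h (X : Biset G H) := ofBiset_mem (AddSubgroup.closure
    (Set.range fun a : (Σ P : Subgroup G, P →* H) => basis a.1 a.2)) X
    fun x P ψ _ => AddSubgroup.subset_closure ⟨⟨P, ψ⟩, rfl⟩
  exact AddSubgroup.sub_mem _ (h X) (h Y)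

/-- Some positive power of an element of the double Burnside ring is idempotent modulo `p`. -/
theorem exists_pow_isIdempotentMod [Finite G] {p : ℕ} (hp : p ≠ 0) (x : Burnside G G) :
    ∃ n, 0 < n ∧ IsIdempotentMod p (x ^ n) := by
  -- `A(G, G)/p` is finitely generated and torsion, hence finite, so two distinct powers of `x`
  -- agree modulo `p`.
  let f : Burnside G G →ₗ[ℤ] Burnside G G := (p : ℤ) • LinearMap.id
  have : Finite (Burnside G G ⧸ LinearMap.range f) := by
    refine Module.finite_of_fg_torsion _ fun {y} => ?_
    obtain ⟨y, rfl⟩ := Submodule.mkQ_surjective _ y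
    refine ⟨⟨(p : ℤ), mem_nonZeroDivisors_of_ne_zero (by exact_mod_cast hp)⟩, ?_⟩
    change (p : ℤ) • Submodule.mkQ (LinearMap.range f) y = 0
    rw [← map_smul]
    exact (Submodule.Quotient.mk_eq_zero _).2 ⟨y, rfl⟩
  let r (y z : Burnside G G) : Prop := ∃ w, y - z = p • w
  have key : ∃ a d, 0 < d ∧ r (x ^ (a + d)) (x ^ a) := by
    obtain ⟨a, b, hab, h⟩ := Finite.exists_ne_map_eq_of_infinite
      fun n : ℕ => Submodule.mkQ (LinearMap.range f) (x ^ n)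
    have hr (a b : ℕ) (h : Submodule.mkQ (LinearMap.range f) (x ^ b) =
        Submodule.mkQ (LinearMap.range f) (x ^ a)) : r (x ^ b) (x ^ a) := by
      obtain ⟨w, hw⟩ := (Submodule.Quotient.eq _).1 h
      exact ⟨w, by rw [← hw]; simp [f]⟩
    rcases hab.lt_or_gt with hlt | hlt
    · obtain ⟨d, rfl⟩ := Nat.exists_eq_add_of_lt hlt
      exact ⟨a, d + 1, by omega, hr _ _ h.symm⟩
    · obtain ⟨d, rfl⟩ := Nat.exists_eq_add_of_lt hlt
      exact ⟨b, d + 1, by omega, hr _ _ h⟩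
  obtain ⟨a, d, hd, w, hw⟩ := key
  have h1 (m k : ℕ) : r (x ^ (a + m + d * k)) (x ^ (a + m)) := by
    induction k with
    | zero => exact ⟨0, by simp⟩
    | succ k ih =>
      obtain ⟨v, hv⟩ := ih
      refine ⟨w * x ^ (m + d * k) + v, ?_⟩
      rw [smul_add, ← hv, ← smul_mul_assoc, ← hw, sub_mul, ← pow_add, ← pow_add]
      have e1 : a + d + (m + d * k) = a + m + d * (k + 1) := by ring
      have e2 : a + (m + d * k) = a + m + d * k := by ring
      rw [e1, e2]
      abel
  -- From exponent `a` on, the powers have period `d` modulo `p`. The exponent `d(a + 1)` is a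
  -- multiple of the period and at least `a`, so doubling it changes nothing.
  refine ⟨d * (a + 1), by positivity, ?_⟩
  obtain ⟨m, hm⟩ : ∃ m, d * (a + 1) = a + m :=
    Nat.exists_eq_add_of_le (by nlinarith)
  obtain ⟨v, hv⟩ := h1 m (a + 1)
  refine ⟨v, ?_⟩
  rw [← pow_add, ← hv, ← hm]

/-- Both `p x y` and `p y x` equal `x³ - x²`, and `p` can be cancelled because the ring is
torsion-free. -/
theorem isIdempotentMod_commute [Finite G] {p : ℕ} (hp : p ≠ 0) {x y : Burnside G G}
    (h : x * x - x = p • y) : x * y = y * x := by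
  rw [← sub_eq_zero]
  refine eq_zero_of_nsmul_eq_zero hp ?_
  rw [smul_sub, ← mul_smul_comm, ← smul_mul_assoc, ← h]
  noncomm_ring

/-- First `x ^ p ≡ x` modulo `p`; raising a congruence modulo `p` to the power `p ^ k` improves it
to one modulo `p ^ (k + 1)`. -/
theorem exists_pow_sub_pow_eq {R : Type*} [CommRing R] {p : ℕ} (hp : p ≠ 0) {x y : R}
    (h : x * x - x = p * y) (k : ℕ) : ∃ z, x ^ p ^ (k + 1) - x ^ p ^ k = (p : R) ^ (k + 1) * z := by
  have hdvd : ∀ n : ℕ, (p : R) ∣ x ^ (n + 1) - x := by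
    intro n
    induction n with
    | zero => simp
    | succ n ih =>
      have : x ^ (n + 1 + 1) - x = x * (x ^ (n + 1) - x) + (x * x - x) := by ring
      rw [this, h]
      exact dvd_add (ih.mul_left _) (dvd_mul_right _ _)
  have h1 : (p : R) ∣ x ^ p - x := by
    obtain ⟨n, rfl⟩ := Nat.exists_eq_succ_of_ne_zero hp
    exact hdvd n
  obtain ⟨z, hz⟩ := dvd_sub_pow_of_dvd_sub h1 k
  exact ⟨z, by rw [pow_succ', pow_mul, hz]⟩

theorem exists_sq_pow_sub_pow_eq {R : Type*} [CommRing R] {p : ℕ} {x y : R}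
    (h : x * x - x = p * y) (k : ℕ) :
    ∃ z, x ^ p ^ k * x ^ p ^ k - x ^ p ^ k = (p : R) ^ (k + 1) * z := by
  obtain ⟨z, hz⟩ := dvd_sub_pow_of_dvd_sub (⟨y, h⟩ : (p : R) ∣ x * x - x) k
  exact ⟨z, by rw [← mul_pow, hz]⟩

/-- Powers of an element that is idempotent modulo `p` form a `p`-adic Cauchy sequence of
approximate idempotents. -/
theorem exists_pow_sub_pow [Finite G] {p : ℕ} (hp : p ≠ 0) {x : Burnside G G}
    (h : IsIdempotentMod p x) (k : ℕ) :
    (∃ y, x ^ p ^ (k + 1) - x ^ p ^ k = p ^ (k + 1) • y) ∧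
      ∃ y, x ^ p ^ k * x ^ p ^ k - x ^ p ^ k = p ^ (k + 1) • y := by
  obtain ⟨y, hy⟩ := h
  have hcomm := isIdempotentMod_commute hp hy
  -- The binomial argument needs commutativity, available in the subring generated by `x` and `y`.
  have : IsMulCommutative (Algebra.adjoin ℤ {x, y}) := by
    refine Algebra.isMulCommutative_adjoin ℤ ?_
    rintro a (rfl | rfl) b (rfl | rfl)
    · rfl
    · exact hcomm
    · exact hcomm.symm
    · rfl
  let _ : CommRing (Algebra.adjoin ℤ {x, y}) :=
    { Subalgebra.toRing _ with mul_comm := fun a b => this.is_comm.comm a b }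
  let x' : Algebra.adjoin ℤ {x, y} := ⟨x, Algebra.subset_adjoin (by simp)⟩
  let y' : Algebra.adjoin ℤ {x, y} := ⟨y, Algebra.subset_adjoin (by simp)⟩
  have hxy : x' * x' - x' = (p : Algebra.adjoin ℤ {x, y}) * y' := by
    rw [← nsmul_eq_mul]
    exact Subtype.ext hy
  obtain ⟨z, hz⟩ := exists_pow_sub_pow_eq hp hxy k
  obtain ⟨w, hw⟩ := exists_sq_pow_sub_pow_eq hxy k
  rw [← Nat.cast_pow, ← nsmul_eq_mul] at hz hw
  exact ⟨⟨z, congrArg Subtype.val hz⟩, ⟨w, congrArg Subtype.val hw⟩⟩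

end Burnside

/-! ### Graphs of morphisms of a fusion system -/

namespace FusionSystem

variable {S : Type u} [Group S] (F : FusionSystem S)

theorem subtype_comp_mem_HomS {P Q : Subgroup S} {φ : P →* Q} (h : φ ∈ F.Hom P Q) :
    Q.subtype.comp φ ∈ F.HomS P := by
  have h' := F.comp_mem (F.conj_mem Q ⊤ 1 (by simp)) h
  change (Q.subtype.comp φ).codRestrict (⊤ : Subgroup S) _ ∈ F.Hom P ⊤
  convert! h'
  ext x
  simp [conjHom]

theorem exists_iso_of_mem_HomS {P : Subgroup S} {φ : P →* S} (h : φ ∈ F.HomS P) :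
    ∃ e : P ≃* φ.range, F.IsIso e ∧ ∀ x, (e x : S) = φ x := by
  obtain ⟨R, hR, e, h1, h2, h3⟩ := F.factor h
  have he (x : P) : φ x = e x := congrArg Subtype.val (DFunLike.congr_fun h3 x)
  have hr : φ.range = R := by
    ext y
    constructor
    · rintro ⟨x, rfl⟩
      rw [he]
      exact (e x).2
    · intro hy
      exact ⟨e.symm ⟨y, hy⟩, by rw [he]; simp⟩
  subst hr
  exact ⟨e, ⟨h1, h2⟩, fun x => (he x).symm⟩

theorem codRestrict_mem_Hom {P Q : Subgroup S} {φ : P →* S} (h : φ ∈ F.HomS P)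
    (hQ : ∀ x, φ x ∈ Q) : φ.codRestrict Q hQ ∈ F.Hom P Q := by
  obtain ⟨e, he, he'⟩ := F.exists_iso_of_mem_HomS h
  have hle : ∀ x ∈ φ.range, 1 * x * 1⁻¹ ∈ Q := by
    rintro _ ⟨x, rfl⟩
    simpa using hQ x
  convert! F.comp_mem (F.conj_mem φ.range Q 1 hle) he.1
  ext x
  simp [conjHom, he']

theorem comp_mem_HomS {P Q : Subgroup S} {φ : P →* S} {ψ : Q →* S} (h : φ ∈ F.HomS P)
    (h' : ψ ∈ F.HomS Q) (hQ : ∀ x, φ x ∈ Q) : ψ.comp (φ.codRestrict Q hQ) ∈ F.HomS P :=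
  F.comp_mem h' (F.codRestrict_mem_Hom h hQ)

theorem conj_mem_HomS (g : S) (P : Subgroup S) :
    (MulAut.conj g).toMonoidHom.comp P.subtype ∈ F.HomS P :=
  F.conj_mem P ⊤ g (by simp)

theorem subtype_mem_HomS (P : Subgroup S) : P.subtype ∈ F.HomS P := by
  convert! F.conj_mem_HomS 1 P
  ext x
  simp

theorem inclusion_mem_HomS {P Q : Subgroup S} {φ : P →* S} (h : φ ∈ F.HomS P) (hQ : Q ≤ P) :
    φ.comp (Subgroup.inclusion hQ) ∈ F.HomS Q :=
  F.comp_mem_HomS (F.subtype_mem_HomS Q) h fun x => hQ x.2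

theorem Conjugate.refl (P : Subgroup S) : F.Conjugate P P :=
  ⟨MulEquiv.refl _, F.id_mem P, F.id_mem P⟩

variable {F} in
theorem Conjugate.symm {P Q : Subgroup S} (h : F.Conjugate P Q) : F.Conjugate Q P := by
  obtain ⟨e, h1, h2⟩ := h
  exact ⟨e.symm, h2, h1⟩

variable {F} in
theorem Conjugate.trans {P Q R : Subgroup S} (h : F.Conjugate P Q) (k : F.Conjugate Q R) :
    F.Conjugate P R := by
  obtain ⟨e, h1, h2⟩ := h
  obtain ⟨f, k1, k2⟩ := k
  exact ⟨e.trans f, F.comp_mem k1 h1, F.comp_mem h2 k2⟩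

variable {F} in
theorem Conjugate.card_eq {P Q : Subgroup S} (h : F.Conjugate P Q) : Nat.card P = Nat.card Q :=
  Nat.card_congr h.choose.toEquiv

/-- The graphs `{(φ x, x) | x ∈ P}` of the morphisms `φ ∈ Hom_F(P, S)`. -/
def graphs : Set (Subgroup (S × S)) := {D | ∃ (P : Subgroup S) (φ : F.HomS P), D = homGraph P φ.1}

variable {F}

theorem homGraph_mem {P : Subgroup S} {φ : P →* S} (h : φ ∈ F.HomS P) :
    homGraph P φ ∈ F.graphs := ⟨P, ⟨φ, h⟩, rfl⟩

theorem mem_HomS_of_homGraph_mem {P : Subgroup S} {φ : P →* S} (h : homGraph P φ ∈ F.graphs) :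
    φ ∈ F.HomS P := by
  obtain ⟨Q, ψ, hQ⟩ := h
  have h1 := congrArg (Subgroup.map (MonoidHom.snd S S)) hQ
  rw [map_snd_homGraph, map_snd_homGraph] at h1
  subst h1
  have h2 : φ = ψ.1 := by
    ext x
    have : (φ x, (x : S)) ∈ homGraph P ψ.1 := hQ ▸ mem_homGraph.2 ⟨x.2, rfl⟩
    exact (mem_homGraph.1 this).2.symm
  rw [h2]
  exact ψ.2

theorem mem_graphs_of_le {D E : Subgroup (S × S)} (hD : D ∈ F.graphs) (h : E ≤ D) :
    E ∈ F.graphs := by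
  obtain ⟨P, φ, rfl⟩ := hD
  have hle : E.map (MonoidHom.snd S S) ≤ P := by
    rintro _ ⟨x, hx, rfl⟩
    exact (mem_homGraph.1 (h hx)).1
  refine ⟨_, ⟨_, F.inclusion_mem_HomS φ.2 hle⟩, ?_⟩
  ext x
  rw [mem_homGraph]
  constructor
  · intro hx
    exact ⟨⟨x, hx, rfl⟩, (mem_homGraph.1 (h hx)).2⟩
  · rintro ⟨⟨y, hy, hyx⟩, h2⟩
    obtain ⟨h3, h4⟩ := mem_homGraph.1 (h hy)
    have : y = x := by
      refine Prod.ext ?_ hyx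
      rw [← h4, ← h2]
      exact congrArg φ.1 (Subtype.ext hyx)
    rwa [← this]

/-- The relation is the graph of `φ ∘ ψ` on the elements that `ψ` sends into `P`. With closure under
subgroups and converses, this lets the category axioms be used as a calculus of relations. -/
theorem relComp_mem {D E : Subgroup (S × S)} (hD : D ∈ F.graphs) (hE : E ∈ F.graphs) :
    relComp D E ∈ F.graphs := by
  obtain ⟨P, φ, rfl⟩ := hD
  obtain ⟨Q, ψ, rfl⟩ := hE
  let Q' := (relComp (homGraph P φ.1) (homGraph Q ψ.1)).map (MonoidHom.snd S S)
  have hle : Q' ≤ Q := by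
    rintro _ ⟨x, ⟨b, h1, h2⟩, rfl⟩
    exact (mem_homGraph.1 h2).1
  have hP : ∀ x : Q', (ψ.1.comp (Subgroup.inclusion hle)) x ∈ P := by
    rintro ⟨_, ⟨x, ⟨b, h1, h2⟩, rfl⟩⟩
    obtain ⟨h3, h4⟩ := mem_homGraph.1 h2
    obtain ⟨h5, h6⟩ := mem_homGraph.1 h1
    change ψ.1 ⟨x.2, h3⟩ ∈ P
    rw [h4]
    exact h5
  refine ⟨Q', ⟨_, F.comp_mem_HomS (F.inclusion_mem_HomS ψ.2 hle) φ.2 hP⟩, ?_⟩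
  ext x
  rw [mem_homGraph]
  constructor
  · intro hx
    refine ⟨⟨x, hx, rfl⟩, ?_⟩
    obtain ⟨b, h1, h2⟩ := hx
    obtain ⟨h3, h4⟩ := mem_homGraph.1 h2
    obtain ⟨h5, h6⟩ := mem_homGraph.1 h1
    refine Eq.trans ?_ h6
    exact congrArg φ.1 (Subtype.ext h4)
  · rintro ⟨h1, h2⟩
    exact ⟨ψ.1 ⟨x.2, hle h1⟩, mem_homGraph.2 ⟨hP ⟨x.2, h1⟩, h2⟩, mem_homGraph.2 ⟨hle h1, rfl⟩⟩

theorem relInv_homGraph {P : Subgroup S} {φ : P →* S} (e : P ≃* φ.range)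
    (he : ∀ x, (e x : S) = φ x) :
    relInv (homGraph P φ) = homGraph φ.range (P.subtype.comp e.symm.toMonoidHom) := by
  ext x
  rw [mem_relInv, mem_homGraph, mem_homGraph]
  constructor
  · rintro ⟨h1, h2⟩
    refine ⟨⟨_, h2⟩, ?_⟩
    have : e.symm ⟨x.2, ⟨_, h2⟩⟩ = ⟨x.1, h1⟩ := by
      rw [MulEquiv.symm_apply_eq]
      exact Subtype.ext ((he _).trans h2).symm
    exact congrArg Subtype.val this
  · rintro ⟨h1, h2⟩
    have h3 : (e.symm ⟨x.2, h1⟩ : S) = x.1 := h2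
    refine ⟨h3 ▸ (e.symm ⟨x.2, h1⟩).2, ?_⟩
    have h4 : (⟨x.1, h3 ▸ (e.symm ⟨x.2, h1⟩).2⟩ : P) = e.symm ⟨x.2, h1⟩ := Subtype.ext h3.symm
    exact (congrArg φ h4).trans ((he _).symm.trans (by simp))

theorem relInv_mem {D : Subgroup (S × S)} (hD : D ∈ F.graphs) : relInv D ∈ F.graphs := by
  obtain ⟨P, φ, rfl⟩ := hD
  obtain ⟨e, he, he'⟩ := F.exists_iso_of_mem_HomS φ.2
  rw [relInv_homGraph e he']
  exact homGraph_mem (F.subtype_comp_mem_HomS he.2)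

theorem map_fst_homGraph {P : Subgroup S} {φ : P →* S} :
    (homGraph P φ).map (MonoidHom.fst S S) = φ.range := by
  rw [homGraph, MonoidHom.map_range]
  rfl

theorem conjugate_of_mem_graphs {D : Subgroup (S × S)} (hD : D ∈ F.graphs) :
    F.Conjugate (D.map (MonoidHom.snd S S)) (D.map (MonoidHom.fst S S)) := by
  obtain ⟨P, φ, rfl⟩ := hD
  rw [map_snd_homGraph, map_fst_homGraph]
  obtain ⟨e, he, -⟩ := F.exists_iso_of_mem_HomS φ.2
  exact ⟨e, he⟩

theorem card_of_mem_graphs {D : Subgroup (S × S)} (hD : D ∈ F.graphs) :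
    Nat.card D = Nat.card (D.map (MonoidHom.snd S S)) := by
  obtain ⟨P, φ, rfl⟩ := hD
  rw [map_snd_homGraph, card_homGraph]

/-! ### Fully normalised representatives and extension to normalisers -/

variable (F)

theorem exists_fullyNormalized [Finite S] (P : Subgroup S) :
    ∃ Q, F.Conjugate P Q ∧ F.FullyNormalized Q := by
  have : Nonempty {Q // F.Conjugate P Q} := ⟨⟨P, Conjugate.refl F P⟩⟩
  obtain ⟨Q, hQ⟩ := Finite.exists_max fun Q : {Q // F.Conjugate P Q} =>
    Nat.card (Subgroup.normalizer (Q.1 : Set S))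
  exact ⟨Q.1, Q.2, fun R hR => hQ ⟨R, Q.2.trans hR.symm⟩⟩

/-- Conjugacy in `F`, as an equivalence relation. -/
def conjSetoid : Setoid (Subgroup S) := ⟨F.Conjugate, Conjugate.refl F, Conjugate.symm,
  Conjugate.trans⟩

/-- A fully normalised representative of the `F`-conjugacy class of a subgroup. -/
noncomputable def classRep [Finite S] (P : Subgroup S) : Subgroup S :=
  (F.exists_fullyNormalized (Quotient.mk F.conjSetoid P).out).choose

theorem conjugate_classRep [Finite S] (P : Subgroup S) : F.Conjugate P (F.classRep P) :=
  (Conjugate.symm (Quotient.mk_out (s := F.conjSetoid) P)).trans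
    (F.exists_fullyNormalized _).choose_spec.1

theorem fullyNormalized_classRep [Finite S] (P : Subgroup S) : F.FullyNormalized (F.classRep P) :=
  (F.exists_fullyNormalized _).choose_spec.2

theorem classRep_eq [Finite S] {P Q : Subgroup S} (h : F.Conjugate P Q) :
    F.classRep P = F.classRep Q := by
  have : Quotient.mk F.conjSetoid P = Quotient.mk F.conjSetoid Q := Quotient.sound h
  exact congrArg (fun q : Quotient F.conjSetoid => (F.exists_fullyNormalized q.out).choose) this

/-- The representative of the class of the graph of a morphism: the graph of the inclusion of a
fully normalised subgroup. -/
noncomputable def graphRep [Finite S] (D : Subgroup (S × S)) : Subgroup (S × S) :=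
  homGraph (F.classRep (D.map (MonoidHom.snd S S)))
    (F.classRep (D.map (MonoidHom.snd S S))).subtype

variable {F}

/-- Two homomorphisms to `S × S` that differ by morphisms of `F` in both coordinates. -/
theorem map_mem_graphs {N : Type*} [Group N] {θ₁ θ₂ : N →* S × S} {A B : Subgroup (S × S)}
    (hA : A ∈ F.graphs) (hB : B ∈ F.graphs) (h₁ : ∀ n, ((θ₂ n).1, (θ₁ n).1) ∈ A)
    (h₂ : ∀ n, ((θ₂ n).2, (θ₁ n).2) ∈ B) {R : Subgroup N} (hR : R.map θ₁ ∈ F.graphs) :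
    R.map θ₂ ∈ F.graphs := by
  refine mem_graphs_of_le (relComp_mem (relComp_mem hA hR) (relInv_mem hB)) ?_
  rintro _ ⟨n, hn, rfl⟩
  exact ⟨(θ₁ n).2, ⟨(θ₁ n).1, h₁ n, n, hn, rfl⟩, h₂ n⟩

theorem map_mem_graphs_iff {N : Type*} [Group N] {θ₁ θ₂ : N →* S × S} {A B : Subgroup (S × S)}
    (hA : A ∈ F.graphs) (hB : B ∈ F.graphs) (h₁ : ∀ n, ((θ₂ n).1, (θ₁ n).1) ∈ A)
    (h₂ : ∀ n, ((θ₂ n).2, (θ₁ n).2) ∈ B) (R : Subgroup N) :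
    R.map θ₂ ∈ F.graphs ↔ R.map θ₁ ∈ F.graphs :=
  ⟨map_mem_graphs (relInv_mem hA) (relInv_mem hB) h₁ h₂, map_mem_graphs hA hB h₁ h₂⟩

/-- The representative sees only the `F`-class of the second projection, so no condition on the
first coordinates is needed. -/
theorem graphRep_map_eq [Finite S] {N : Type*} [Group N] {θ₁ θ₂ : N →* S × S}
    {B : Subgroup (S × S)} (hB : B ∈ F.graphs) (h₂ : ∀ n, ((θ₂ n).2, (θ₁ n).2) ∈ B)
    (R : Subgroup N) : F.graphRep (R.map θ₂) = F.graphRep (R.map θ₁) := by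
  let E : Subgroup (S × S) :=
    R.map (((MonoidHom.snd S S).comp θ₂).prod ((MonoidHom.snd S S).comp θ₁))
  have hE : E ∈ F.graphs := by
    refine mem_graphs_of_le hB ?_
    rintro _ ⟨n, hn, rfl⟩
    exact h₂ n
  have h := F.classRep_eq (conjugate_of_mem_graphs hE)
  simp only [E, Subgroup.map_map, MonoidHom.snd_comp_prod, MonoidHom.fst_comp_prod] at h
  rw [graphRep, graphRep, Subgroup.map_map, Subgroup.map_map, h]

variable (F) in
theorem autS_le_autF (P : Subgroup S) : autS P ≤ F.autF P := by
  have key (n : Subgroup.normalizer (P : Set S)) :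
      (P.normalizerMonoidHom n).toMonoidHom ∈ F.Hom P P := by
    convert! F.conj_mem P P n fun x hx => (Subgroup.mem_normalizer_iff.1 n.2 x).1 hx
  rintro _ ⟨n, rfl⟩
  refine ⟨key n, ?_⟩
  have h1 : (P.normalizerMonoidHom n).symm = P.normalizerMonoidHom n⁻¹ := by
    rw [map_inv]; rfl
  rw [h1]
  exact key n⁻¹

/-- A morphism of `F` to a fully normalised subgroup can be chosen to extend to normalisers. -/
theorem IsSaturated.exists_normalizer_hom [Finite S] {p : ℕ} [Fact p.Prime] (hS : IsPGroup p S)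
    (hF : F.IsSaturated p) {P Q : Subgroup S} (hQ : F.FullyNormalized Q) (h : F.Conjugate P Q) :
    ∃ α : Subgroup.normalizer (P : Set S) →* S, α ∈ F.HomS (Subgroup.normalizer (P : Set S)) ∧
      (P.subgroupOf (Subgroup.normalizer (P : Set S))).map α = Q := by
  obtain ⟨χ, hχ⟩ := h
  obtain ⟨hcent, hsyl⟩ := hF.sylow Q hQ
  have hnorm (n : Subgroup.normalizer (P : Set S)) : F.IsIso (P.normalizerMonoidHom n) :=
    F.autS_le_autF P ⟨n, rfl⟩
  let ρ : Subgroup.normalizer (P : Set S) →* F.autF Q :=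
    ((MulAut.congr χ).toMonoidHom.comp P.normalizerMonoidHom).codRestrict (F.autF Q) fun n =>
      ⟨F.comp_mem hχ.1 (F.comp_mem (hnorm n).1 hχ.2), F.comp_mem hχ.1 (F.comp_mem (hnorm n).2 hχ.2)⟩
  let _ : MulAction (Subgroup.normalizer (P : Set S))
    (F.autF Q ⧸ (autS Q).subgroupOf (F.autF Q)) := MulAction.compHom _ ρ
  have : Finite (MulAut Q) := Finite.of_injective (fun e : MulAut Q => (e : Q → Q))
    DFunLike.coe_injective
  -- The `p`-group `N_S(P)`, transported by `χ`, acts on `Aut_F(Q)/Aut_S(Q)`, whose order is prime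
  -- to `p`, and so fixes a coset `γ Aut_S(Q)`. Replacing `χ` by `γ⁻¹ χ` carries `Aut_S(P)` into
  -- `Aut_S(Q)`.
  obtain ⟨q, hq⟩ := (hS.to_subgroup (Subgroup.normalizer (P : Set S))
    ).nonempty_fixed_point_of_prime_not_dvd_card (F.autF Q ⧸ (autS Q).subgroupOf (F.autF Q)) hsyl
  obtain ⟨γ, rfl⟩ := QuotientGroup.mk_surjective q
  have hγ (n : Subgroup.normalizer (P : Set S)) : (γ⁻¹ * ρ n * γ : F.autF Q).1 ∈ autS Q := by
    have h1 : ((ρ n * γ : F.autF Q) : F.autF Q ⧸ (autS Q).subgroupOf (F.autF Q)) = γ := hq n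
    have h2 := QuotientGroup.eq.1 h1.symm
    rw [← mul_assoc] at h2
    exact h2
  let e : P ≃* Q := χ.trans (γ⁻¹ : F.autF Q).1
  have he : F.IsIso e := ⟨F.comp_mem (γ⁻¹ : F.autF Q).2.1 hχ.1,
    F.comp_mem hχ.2 (γ⁻¹ : F.autF Q).2.2⟩
  have hφ := F.subtype_comp_mem_HomS he.1
  have hr : (Q.subtype.comp e.toMonoidHom).range = Q := by
    ext y
    constructor
    · rintro ⟨x, rfl⟩
      exact (e x).2
    · intro hy
      exact ⟨e.symm ⟨y, hy⟩, by simp⟩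
  obtain ⟨ψ, hψ, hψ'⟩ := hF.extension P _ hφ (by rwa [hr])
  -- By the choice of `γ`, the extender of the corrected isomorphism contains the whole normaliser.
  have hle : Subgroup.normalizer (P : Set S) ≤ extender (Q.subtype.comp e.toMonoidHom) := by
    intro n hn
    refine ⟨hn, ?_⟩
    obtain ⟨m, hm⟩ := hγ ⟨n, hn⟩
    refine ⟨m, by rw [hr]; exact m.2, fun x y hxy => ?_⟩
    have h1 := DFunLike.congr_fun hm (e x)
    have h2 : ((γ⁻¹ * ρ ⟨n, hn⟩ * γ : F.autF Q).1) (e x) = e y := by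
      change (γ⁻¹ : F.autF Q).1 (χ (P.normalizerMonoidHom ⟨n, hn⟩
        (χ.symm (γ.1 ((γ⁻¹ : F.autF Q).1 (χ x)))))) = (γ⁻¹ : F.autF Q).1 (χ y)
      have h3 : γ.1 ((γ⁻¹ : F.autF Q).1 (χ x)) = χ x := γ.1.apply_symm_apply (χ x)
      rw [h3, MulEquiv.symm_apply_apply]
      congr 2
      exact Subtype.ext hxy.symm
    rw [h2] at h1
    exact congrArg Subtype.val h1.symm
  refine ⟨ψ.comp (Subgroup.inclusion hle), F.inclusion_mem_HomS hψ hle, ?_⟩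
  refine Eq.trans ?_ hr
  ext y
  constructor
  · rintro ⟨n, hn, rfl⟩
    exact ⟨⟨n, hn⟩, (DFunLike.congr_fun hψ' ⟨n, hn⟩).symm⟩
  · rintro ⟨x, rfl⟩
    exact ⟨⟨x, Subgroup.le_normalizer x.2⟩, x.2, DFunLike.congr_fun hψ' x⟩

/-- The normaliser of the graph of `φ` consists of pairs `(s, t)` in `N(φ(P)) × N(P)` for which `φ`
intertwines conjugation by `t` with conjugation by `s`. The map `θ` is `α × β`, where `α` is defined
on `N(φ(P))` and `β` extends `α ∘ φ` as far as saturation permits. -/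
theorem IsSaturated.isFusionFamily [Finite S] {p : ℕ} [Fact p.Prime] (hS : IsPGroup p S)
    (hF : F.IsSaturated p) : IsFusionFamily F.graphs F.graphRep := by
  have hconj (t : S × S) (D : Subgroup (S × S)) :=
    map_mem_graphs_iff (θ₁ := MonoidHom.id (S × S)) (θ₂ := (MulAut.conj t).toMonoidHom)
      (homGraph_mem (F.conj_mem_HomS t.1 ⊤)) (homGraph_mem (F.conj_mem_HomS t.2 ⊤))
      (fun n => mem_homGraph.2 ⟨trivial, rfl⟩) (fun n => mem_homGraph.2 ⟨trivial, rfl⟩) D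
  have hrep (t : S × S) (D : Subgroup (S × S)) :=
    graphRep_map_eq (θ₁ := MonoidHom.id (S × S)) (θ₂ := (MulAut.conj t).toMonoidHom)
      (homGraph_mem (F.conj_mem_HomS t.2 ⊤)) (fun n => mem_homGraph.2 ⟨trivial, rfl⟩) D
  simp only [Subgroup.map_id] at hconj hrep
  refine ⟨mem_graphs_of_le, fun t hD => (hconj t _).2 hD, fun t _ => hrep t _, ?_⟩
  rintro _ ⟨P, φ, rfl⟩
  have hPR : F.Conjugate φ.1.range P := by
    have := (conjugate_of_mem_graphs (homGraph_mem φ.2)).symm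
    rwa [map_fst_homGraph, map_snd_homGraph] at this
  obtain ⟨α, hα, hα'⟩ := hF.exists_normalizer_hom hS (F.fullyNormalized_classRep P)
    (hPR.trans (F.conjugate_classRep P))
  have hN (x : P) : φ.1 x ∈ Subgroup.normalizer (φ.1.range : Set S) :=
    Subgroup.le_normalizer ⟨x, rfl⟩
  let φ' : P →* S := α.comp (φ.1.codRestrict _ hN)
  have hφ' : φ' ∈ F.HomS P := F.comp_mem_HomS φ.2 hα hN
  have hr : φ'.range = F.classRep P := by
    rw [← hα']
    ext y
    constructor
    · rintro ⟨x, rfl⟩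
      exact ⟨⟨φ.1 x, hN x⟩, ⟨x, rfl⟩, rfl⟩
    · rintro ⟨⟨_, _⟩, ⟨x, rfl⟩, rfl⟩
      exact ⟨x, rfl⟩
  obtain ⟨β, hβ, hβ'⟩ := hF.extension P φ' hφ' (by
    rw [hr]; exact (hF.sylow _ (F.fullyNormalized_classRep P)).1)
  let N := Subgroup.normalizer (homGraph P φ.1 : Set (S × S))
  have h1 (t : N) : t.1.1 ∈ Subgroup.normalizer (φ.1.range : Set S) := by
    rw [← map_fst_homGraph]
    exact Subgroup.le_normalizer_map (MonoidHom.fst S S) ⟨t, t.2, rfl⟩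
  -- Applying `α` to the intertwining relation exhibits `α(t.1.1)` as the element that extends
  -- conjugation by `t.1.2` along `φ'`.
  have h2 (t : N) : t.1.2 ∈ extender φ' := by
    refine ⟨?_, α ⟨t.1.1, h1 t⟩, ?_, ?_⟩
    · rw [← map_snd_homGraph P φ.1]
      exact Subgroup.le_normalizer_map (MonoidHom.snd S S) ⟨t, t.2, rfl⟩
    · rw [hr]
      exact IsFusionFamily.map_mem_normalizer α hα' _
    · intro x y hxy
      have h3 : (φ.1 x, (x : S)) ∈ homGraph P φ.1 := mem_homGraph.2 ⟨x.2, rfl⟩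
      obtain ⟨h4, h5⟩ := mem_homGraph.1 ((Subgroup.mem_normalizer_iff.1 t.2 _).1 h3)
      have h6 : φ.1 y = t.1.1 * φ.1 x * t.1.1⁻¹ := by
        rw [show y = ⟨_, h4⟩ from Subtype.ext hxy]
        exact h5
      change α ⟨φ.1 y, hN y⟩ = α ⟨t.1.1, h1 t⟩ * α ⟨φ.1 x, hN x⟩ * (α ⟨t.1.1, h1 t⟩)⁻¹
      rw [← map_inv, ← map_mul, ← map_mul]
      exact congrArg α (Subtype.ext h6)
  let θ : N →* S × S :=
    (α.comp (((MonoidHom.fst S S).comp N.subtype).codRestrict _ h1)).prod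
      (β.comp (((MonoidHom.snd S S).comp N.subtype).codRestrict _ h2))
  have hA (t : N) : ((θ t).1, (N.subtype t).1) ∈ homGraph _ α := mem_homGraph.2 ⟨h1 t, rfl⟩
  have hB (t : N) : ((θ t).2, (N.subtype t).2) ∈ homGraph _ β := mem_homGraph.2 ⟨h2 t, rfl⟩
  have hinj {P : Subgroup S} {φ : P →* S} (h : φ ∈ F.HomS P) : Function.Injective φ := by
    intro x y hxy
    exact F.injective h (Subtype.ext hxy)
  refine ⟨θ, ?_, ?_, fun R => ⟨map_mem_graphs_iff (homGraph_mem hα) (homGraph_mem hβ) hA hB R,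
    fun _ => graphRep_map_eq (homGraph_mem hβ) hB R⟩⟩
  · intro s t hst
    have e1 := hinj hα (congrArg Prod.fst hst)
    have e2 := hinj hβ (congrArg Prod.snd hst)
    exact Subtype.ext (Prod.ext (congrArg Subtype.val e1) (congrArg Subtype.val e2))
  · rw [graphRep, map_snd_homGraph]
    -- Since `β` extends `α ∘ φ`, both coordinates agree on the graph; its image is thus the
    -- diagonal of the representative.
    have hθ (x : P) (h : (φ.1 x, (x : S)) ∈ N) : θ ⟨_, h⟩ = (φ' x, φ' x) :=
      Prod.ext rfl (DFunLike.congr_fun hβ' x)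
    have hg (x : P) : (φ.1 x, (x : S)) ∈ homGraph P φ.1 := mem_homGraph.2 ⟨x.2, rfl⟩
    ext y
    constructor
    · rintro ⟨⟨_, h⟩, ⟨x, rfl⟩, rfl⟩
      change θ ⟨(φ.1 x, (x : S)), h⟩ ∈ _
      rw [hθ x h]
      exact mem_homGraph.2 ⟨hr ▸ ⟨x, rfl⟩, rfl⟩
    · intro hy
      obtain ⟨h3, h4⟩ := mem_homGraph.1 hy
      have h5 := h3
      rw [← hr] at h5
      obtain ⟨x, hx⟩ := h5
      refine ⟨⟨_, Subgroup.le_normalizer (hg x)⟩, hg x, (hθ x _).trans ?_⟩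
      rw [hx]
      exact Prod.ext h4 rfl

end FusionSystem

/-! ### Characteristic bisets -/

namespace Burnside

variable {G : Type u} [Group G] [Finite G]

theorem augmentation_mul (x y : Burnside G G) :
    augmentation (x * y) = augmentation x * augmentation y :=
  augmentation_comp x y

theorem augmentation_one : augmentation (1 : Burnside G G) = 1 := by
  refine (augmentation_ofBiset (Biset.one G)).trans ?_
  have h := Biset.numOrbits_mul_card (Biset.one G)
  have h' : (Biset.one G).numOrbits * Nat.card G = 1 * Nat.card G := h.trans (one_mul _).symm
  exact_mod_cast Nat.eq_of_mul_eq_mul_right Nat.card_pos h'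

theorem augmentation_pow (x : Burnside G G) (n : ℕ) :
    augmentation (x ^ n) = augmentation x ^ n := by
  induction n with
  | zero => rw [pow_zero, pow_zero, augmentation_one]
  | succ n ih => rw [pow_succ, pow_succ, augmentation_mul, ih]

theorem exists_ofBiset_eq_pow (X : Biset G G) (n : ℕ) :
    ∃ Y : Biset G G, ofBiset X ^ n = ofBiset Y := by
  induction n with
  | zero => exact ⟨Biset.one G, pow_zero _⟩
  | succ n ih =>
    obtain ⟨Y, hY⟩ := ih
    exact ⟨Y.comp X, by rw [pow_succ, hY, mul_def, comp_ofBiset]⟩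

end Burnside

/-! ### Isotropy, stability and marks -/

namespace FusionSystem

variable {S : Type u} [Group S] {F : FusionSystem S}

theorem conjSubgroup_mem_graphs (t : S × S) {D : Subgroup (S × S)} (hD : D ∈ F.graphs) :
    conjSubgroup t D ∈ F.graphs :=
  map_mem_graphs (θ₁ := MonoidHom.id (S × S))
    (homGraph_mem (F.conj_mem_HomS t.1 ⊤)) (homGraph_mem (F.conj_mem_HomS t.2 ⊤))
    (fun n => mem_homGraph.2 ⟨trivial, rfl⟩) (fun n => mem_homGraph.2 ⟨trivial, rfl⟩)
    (by rwa [Subgroup.map_id])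

theorem isotropyIn_comp {X Y : Biset S S} (hX : IsotropyIn F.graphs X.carrier)
    (hY : IsotropyIn F.graphs Y.carrier) : IsotropyIn F.graphs (X.comp Y).carrier := by
  rintro ⟨⟨x, y⟩⟩
  exact mem_graphs_of_le (relComp_mem (hX x) (hY y)) (Biset.stabilizer_compMk_le X Y x y)

section Mul

variable [Finite S]

theorem ofBiset_mem_burnside {X : Biset S S} (hX : IsotropyIn F.graphs X.carrier) :
    Burnside.ofBiset X ∈ F.burnside :=
  Burnside.ofBiset_mem _ X fun x P ψ h => AddSubgroup.subset_closure
    ⟨P, ⟨ψ, mem_HomS_of_homGraph_mem (h ▸ hX x)⟩, rfl⟩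

theorem isotropyIn_basis {P : Subgroup S} {φ : P →* S} (h : φ ∈ F.HomS P) :
    IsotropyIn F.graphs (Biset.basis P φ).carrier := by
  intro x
  obtain ⟨t, ht⟩ := Biset.exists_stabilizer_basis P φ x
  rw [ht]
  exact conjSubgroup_mem_graphs t (homGraph_mem h)

/-- By bilinearity it suffices to multiply two basis elements, where isotropy groups lie in
composites of graphs of morphisms. -/
theorem mul_mem_burnside {x y : Burnside S S} (hx : x ∈ F.burnside) (hy : y ∈ F.burnside) :
    x * y ∈ F.burnside := by
  refine AddSubgroup.closure_induction (p := fun x _ => x * y ∈ F.burnside) ?_ ?_ ?_ ?_ hx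
  · rintro _ ⟨P, φ, rfl⟩
    refine AddSubgroup.closure_induction (p := fun y _ => Burnside.basis P φ.1 * y ∈ F.burnside)
      ?_ ?_ ?_ ?_ hy
    · rintro _ ⟨Q, ψ, rfl⟩
      rw [Burnside.mul_def, Burnside.basis, Burnside.basis, Burnside.comp_ofBiset]
      exact ofBiset_mem_burnside (isotropyIn_comp (isotropyIn_basis φ.2) (isotropyIn_basis ψ.2))
    · rw [mul_zero]
      exact zero_mem _
    · intro a b _ _ ha hb
      rw [mul_add]
      exact add_mem ha hb
    · intro a _ ha
      rw [mul_neg]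
      exact neg_mem ha
  · rw [zero_mul]
    exact zero_mem _
  · intro a b _ _ ha hb
    rw [add_mul]
    exact add_mem ha hb
  · intro a _ ha
    rw [neg_mul]
    exact neg_mem ha

theorem pow_mem_burnside {x : Burnside S S} (hx : x ∈ F.burnside) {n : ℕ} (hn : 0 < n) :
    x ^ n ∈ F.burnside := by
  induction n, hn using Nat.le_induction with
  | base => rwa [pow_one]
  | succ n _ ih =>
    rw [pow_succ]
    exact mul_mem_burnside ih hx

theorem RightStable.mul_left {Ω : Burnside S S} (h : F.RightStable Ω) (Λ : Burnside S S) :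
    F.RightStable (Λ * Ω) := fun P φ => by
  rw [Burnside.mul_def, Burnside.comp_assoc, Burnside.comp_assoc, h P φ]

theorem LeftStable.mul_right {Ω : Burnside S S} (h : F.LeftStable Ω) (Λ : Burnside S S) :
    F.LeftStable (Ω * Λ) := fun P φ => by
  rw [Burnside.mul_def, ← Burnside.comp_assoc, ← Burnside.comp_assoc, h P φ]

theorem RightStable.pow {Ω : Burnside S S} (h : F.RightStable Ω) {n : ℕ} (hn : 0 < n) :
    F.RightStable (Ω ^ n) := by
  obtain ⟨n, rfl⟩ := Nat.exists_eq_succ_of_ne_zero hn.ne'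
  rw [pow_succ]
  exact h.mul_left _

theorem LeftStable.pow {Ω : Burnside S S} (h : F.LeftStable Ω) {n : ℕ} (hn : 0 < n) :
    F.LeftStable (Ω ^ n) := by
  obtain ⟨n, rfl⟩ := Nat.exists_eq_succ_of_ne_zero hn.ne'
  rw [pow_succ']
  exact h.mul_right _

/-- The marks of `X` are constant on the `F`-classes of graphs of morphisms. -/
def MarkStable (F : FusionSystem S) (X : Type*) [MulAction (S × S) X] : Prop :=
  ∀ D ∈ F.graphs, mark X D = mark X (F.graphRep D)

/-- Subgroups that differ by morphisms of `F` in both coordinates are both graphs of morphisms, with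
one representative, or both not, and then both marks vanish. -/
theorem MarkStable.mark_map_eq {X : Type*} [Finite X] [MulAction (S × S) X]
    (h : F.MarkStable X) (hX : IsotropyIn F.graphs X) {N : Type*} [Group N]
    {θ₁ θ₂ : N →* S × S} {A B : Subgroup (S × S)}
    (hA : A ∈ F.graphs) (hB : B ∈ F.graphs) (h₁ : ∀ n, ((θ₂ n).1, (θ₁ n).1) ∈ A)
    (h₂ : ∀ n, ((θ₂ n).2, (θ₁ n).2) ∈ B) (R : Subgroup N) :
    mark X (R.map θ₂) = mark X (R.map θ₁) := by
  have hiff := map_mem_graphs_iff hA hB h₁ h₂ R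
  by_cases hR : R.map θ₁ ∈ F.graphs
  · rw [h _ hR, h _ (hiff.2 hR), graphRep_map_eq hB h₂]
  · rw [mark_eq_zero_of_notMem mem_graphs_of_le hX hR,
      mark_eq_zero_of_notMem mem_graphs_of_le hX (mt hiff.1 hR)]

/-- Composition with `[P, φ]` is restriction along `φ`, so the marks to compare are those of `X` at
the images of `R` under `id × φ` and under `id × ι`. -/
theorem MarkStable.rightStable {X : Biset S S} (h : F.MarkStable X.carrier)
    (hX : IsotropyIn F.graphs X.carrier) : F.RightStable (Burnside.ofBiset X) := by
  intro P φ
  rw [restrictAlong, restrictAlong, Burnside.basis, Burnside.basis, Burnside.comp_ofBiset,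
    Burnside.comp_ofBiset, Burnside.ofBiset_congr (Biset.comp_basis_top X φ.1),
    Burnside.ofBiset_congr (Biset.comp_basis_top X P.subtype)]
  refine Burnside.ofBiset_congr (Biset.equiv_of_mark_eq fun R => ?_)
  rw [Biset.mark_restrictRight, Biset.mark_restrictRight]
  exact h.mark_map_eq hX (θ₁ := (MonoidHom.id S).prodMap P.subtype)
    (θ₂ := (MonoidHom.id S).prodMap φ.1) (homGraph_mem (F.subtype_mem_HomS ⊤)) (homGraph_mem φ.2)
    (fun n => mem_homGraph.2 ⟨trivial, rfl⟩) (fun n => mem_homGraph.2 ⟨n.2.2, rfl⟩) R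

theorem MarkStable.leftStable {X : Biset S S} (h : F.MarkStable X.carrier)
    (hX : IsotropyIn F.graphs X.carrier) : F.LeftStable (Burnside.ofBiset X) := by
  intro P φ
  have hφ : Function.Injective φ.1 := fun _ _ e => F.injective φ.2 (Subtype.ext e)
  rw [Burnside.basis, Burnside.basis, Burnside.comp_ofBiset, Burnside.comp_ofBiset,
    Burnside.ofBiset_congr (Biset.basis_comp φ.1.range (F.toImage φ).symm φ.1 hφ
      (fun _ => rfl) X),
    Burnside.ofBiset_congr (show (Biset.basis P (MonoidHom.id P)).comp X ≈ _ from
      Biset.basis_comp P (MulEquiv.refl P) P.subtype P.subtype_injective (fun _ => rfl) X)]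
  refine Burnside.ofBiset_congr (Biset.equiv_of_mark_eq fun R => ?_)
  rw [Biset.mark_restrictLeft, Biset.mark_restrictLeft]
  exact h.mark_map_eq hX (θ₁ := P.subtype.prodMap (MonoidHom.id S))
    (θ₂ := φ.1.prodMap (MonoidHom.id S)) (homGraph_mem φ.2) (homGraph_mem (F.subtype_mem_HomS ⊤))
    (fun n => mem_homGraph.2 ⟨n.1.2, rfl⟩) (fun n => mem_homGraph.2 ⟨trivial, rfl⟩) R

end Mul

/-! #### Construction of a stable biset -/

variable (S) in
/-- The diagonal subgroup of `S × S`. -/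
abbrev diagonalGraph : Subgroup (S × S) := homGraph ⊤ (⊤ : Subgroup S).subtype

theorem mem_diagonalGraph {x : S × S} : x ∈ diagonalGraph S ↔ x.2 = x.1 := by
  rw [mem_homGraph]
  exact ⟨fun h => h.2, fun h => ⟨trivial, h⟩⟩

section Existence

variable [Finite S]

variable (F) in
theorem classRep_top : F.classRep ⊤ = ⊤ :=
  Subgroup.eq_top_of_card_eq _ ((F.conjugate_classRep ⊤).card_eq.symm.trans Subgroup.card_top)

theorem map_snd_eq_top {D : Subgroup (S × S)} (hD : D ∈ F.graphs) (h : Nat.card D = Nat.card S) :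
    D.map (MonoidHom.snd S S) = ⊤ :=
  Subgroup.eq_top_of_card_eq _ ((card_of_mem_graphs hD).symm.trans h)

theorem card_le_of_mem_graphs {D : Subgroup (S × S)} (hD : D ∈ F.graphs) :
    Nat.card D ≤ Nat.card S := by
  rw [card_of_mem_graphs hD]
  exact Subgroup.card_le_card_group _

theorem graphRep_eq_diagonalGraph {D : Subgroup (S × S)} (h : D.map (MonoidHom.snd S S) = ⊤) :
    F.graphRep D = diagonalGraph S := by
  rw [graphRep, h, classRep_top]

/-- If `D` fixes some `x₀`, then `D` is the graph of conjugation by `x₀`, and left translation by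
`x₀⁻¹` maps its fixed points to those of the diagonal. So the diagonal has the maximal mark in its
class. -/
theorem mark_one_le {D : Subgroup (S × S)} (hD : D.map (MonoidHom.snd S S) = ⊤) :
    mark (Biset.one S).carrier D ≤ mark (Biset.one S).carrier (diagonalGraph S) := by
  rcases Nat.eq_zero_or_pos (mark (Biset.one S).carrier D) with h0 | hpos
  · omega
  · obtain ⟨⟨(x₀ : S), h₀⟩⟩ := (Finite.card_pos_iff.1 hpos)
    refine Nat.card_le_card_of_injective (fun x => ⟨(x₀⁻¹ * (show S from x.1) : S), ?_⟩) ?_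
    · rintro ⟨a, b⟩ hab
      obtain rfl : b = a := mem_diagonalGraph.1 hab
      obtain ⟨⟨c, d⟩, hcd, hd⟩ : b ∈ D.map (MonoidHom.snd S S) := hD ▸ trivial
      obtain rfl : d = b := hd
      have e1 : c * (x₀ * d⁻¹) = x₀ := h₀ _ hcd
      obtain ⟨(x : S), hx⟩ := x
      have e2 : c * (x * d⁻¹) = x := hx _ hcd
      change d * (x₀⁻¹ * x * d⁻¹) = x₀⁻¹ * x
      have e3 : c = x₀ * d * x₀⁻¹ := by
        rw [← mul_assoc, mul_inv_eq_iff_eq_mul] at e1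
        rw [eq_mul_inv_iff_mul_eq, e1]
      rw [e3] at e2
      nth_rewrite 2 [← e2]
      simp [mul_assoc]
    · rintro ⟨(x : S), hx⟩ ⟨(y : S), hy⟩ h
      exact Subtype.ext (mul_left_cancel (G := S) (congrArg Subtype.val h : x₀⁻¹ * x = x₀⁻¹ * y))

theorem isotropyIn_one : IsotropyIn F.graphs (Biset.one S).carrier := by
  intro (x : S)
  refine mem_graphs_of_le (homGraph_mem (F.conj_mem_HomS x ⊤)) ?_
  rintro ⟨a, b⟩ h
  have h' : a * x = x * b :=
    (Biset.mem_stabilizer_iff (X := Biset.one S) (x := x)).1 h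
  refine mem_homGraph.2 ⟨trivial, ?_⟩
  change x * b * x⁻¹ = a
  rw [← h', mul_inv_cancel_right]

/-- The points of `S` fixed by the diagonal are the centre, the kernel of `S → Aut_S(S)`. -/
theorem mark_one_mul_card_autS :
    mark (Biset.one S).carrier (diagonalGraph S) * Nat.card (autS (⊤ : Subgroup S)) =
      Nat.card S := by
  have h1 := Subgroup.card_eq_card_quotient_mul_card_subgroup
    (Subgroup.normalizerMonoidHom (⊤ : Subgroup S)).ker
  have h0 : Nat.card (Subgroup.normalizer ((⊤ : Subgroup S) : Set S)) = Nat.card S := by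
    rw [Subgroup.normalizer_eq_top, Subgroup.card_top]
  rw [Nat.card_congr (QuotientGroup.quotientKerEquivRange _).toEquiv, h0] at h1
  rw [h1, autS, mul_comm]
  congr 1
  refine Nat.card_congr (Equiv.ofBijective (fun x => ⟨⟨(show S from x.1),
    (Subgroup.normalizer_eq_top (H := (⊤ : Subgroup S))).ge trivial⟩, ?_⟩) ⟨?_, ?_⟩)
  · obtain ⟨(x : S), hx⟩ := x
    rw [MonoidHom.mem_ker]
    ext y
    have h2 : (y : S) * (x * (y : S)⁻¹) = x := hx (y, y) (mem_diagonalGraph.2 rfl)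
    change x * y * x⁻¹ = y
    rw [← mul_assoc, mul_inv_eq_iff_eq_mul] at h2
    rw [← h2, mul_inv_cancel_right]
  · intro x y h
    exact Subtype.ext (congrArg (fun z => (z.1.1 : S)) h)
  · rintro ⟨⟨n, hn⟩, hn'⟩
    refine ⟨⟨n, ?_⟩, rfl⟩
    rintro ⟨a, b⟩ hab
    obtain rfl : b = a := mem_diagonalGraph.1 hab
    have h3 : n * b * n⁻¹ = b := congrArg Subtype.val
      (DFunLike.congr_fun (MonoidHom.mem_ker.1 hn') (⟨b, trivial⟩ : (⊤ : Subgroup S)))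
    change b * (n * b⁻¹) = n
    rw [mul_inv_eq_iff_eq_mul] at h3
    rw [← mul_assoc, ← h3, mul_inv_cancel_right]

/-- There is a mark-stable finite `S × S`-set with isotropy in `F` whose mark at the diagonal is
that of `S`. -/
theorem IsSaturated.exists_markStable {p : ℕ} [Fact p.Prime] (hS : IsPGroup p S)
    (hF : F.IsSaturated p) :
    ∃ (Y : Type u) (_ : Finite Y) (_ : MulAction (S × S) Y), IsotropyIn F.graphs Y ∧
      F.MarkStable Y ∧
      mark Y (diagonalGraph S) = mark (Biset.one S).carrier (diagonalGraph S) := by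
  have hfam := hF.isFusionFamily hS
  have hdiag : diagonalGraph S ∈ F.graphs := homGraph_mem (F.subtype_mem_HomS ⊤)
  have hcard : Nat.card (diagonalGraph S) = Nat.card S := by
    rw [card_homGraph, Subgroup.card_top]
  -- Graphs have order at most `|S|`, so nothing lies above this first step.
  obtain ⟨Y, _, _, hY1, hY2, -, hY3⟩ := hfam.exists_extension_step (Nat.card S)
    (Biset.one S).carrier isotropyIn_one
    (fun E hE h => absurd (card_le_of_mem_graphs hE) (not_le.2 h))
  have hY4 := hY3 (diagonalGraph S) (graphRep_eq_diagonalGraph (map_snd_eq_top hdiag hcard))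
    hdiag hcard fun D hD h => mark_one_le <| map_snd_eq_top hD <| by
      rw [← hcard, ← h, hfam.card_rep hD]
  have hpos : 0 < Nat.card S := Nat.card_pos
  -- Resuming strictly below `|S|` leaves the mark at the diagonal untouched.
  obtain ⟨Z, hZ, hZ', hZ1, hZ2, hZ3⟩ := hfam.exists_stable_extension (Nat.card S - 1) Y hY1
    fun E hE h => hY2 E hE (by omega)
  exact ⟨Z, hZ, hZ', hZ1, hZ2, by rw [hZ3 _ (by rw [hcard]; omega), hY4]⟩

end Existence

end FusionSystem

/-! ### Counting left orbits modulo `p` -/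

theorem dvd_card_of_forall_dvd_index {T : Type*} [Group T] [Finite T] {X : Type*} [Finite X] [MulAction T X]
    {m : ℕ} (h : ∀ x : X, m ∣ (MulAction.stabilizer T x).index) : m ∣ Nat.card X := by
  have := Fintype.ofFinite (Quotient (MulAction.orbitRel T X))
  rw [Nat.card_congr (MulAction.selfEquivSigmaOrbitsQuotientStabilizer T X), Nat.card_sigma]
  exact Finset.dvd_sum fun q _ => h q.out

namespace FusionSystem

variable {S : Type u} [Group S] [Finite S] {F : FusionSystem S}

/-- An injective endomorphism of the finite group `S` is an automorphism, so graphs over all of `S`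
correspond to elements of `Aut_F(S)`. -/
theorem card_graphs_top :
    Nat.card {D : Subgroup (S × S) // D ∈ F.graphs ∧ D.map (MonoidHom.snd S S) = ⊤} =
      Nat.card (F.autF ⊤) := by
  refine (Nat.card_congr (Equiv.ofBijective (fun a : F.autF ⊤ =>
    ⟨homGraph ⊤ ((⊤ : Subgroup S).subtype.comp a.1.toMonoidHom),
      homGraph_mem (F.subtype_comp_mem_HomS a.2.1), map_snd_homGraph _ _⟩) ⟨?_, ?_⟩)).symm
  · intro a b h
    refine Subtype.ext (MulEquiv.ext fun x => ?_)
    have h1 : ((a.1 x : S), (x : S)) ∈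
        homGraph ⊤ ((⊤ : Subgroup S).subtype.comp a.1.toMonoidHom) := mem_homGraph.2 ⟨x.2, rfl⟩
    have h2 : homGraph ⊤ ((⊤ : Subgroup S).subtype.comp a.1.toMonoidHom) =
        homGraph ⊤ ((⊤ : Subgroup S).subtype.comp b.1.toMonoidHom) := congrArg Subtype.val h
    rw [h2] at h1
    exact Subtype.ext (mem_homGraph.1 h1).2.symm
  · rintro ⟨_, ⟨P, φ, rfl⟩, hD⟩
    rw [map_snd_homGraph] at hD
    subst hD
    have hr : φ.1.range = ⊤ := by
      obtain ⟨e, -, -⟩ := F.exists_iso_of_mem_HomS φ.2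
      exact Subgroup.eq_top_of_card_eq _ ((Nat.card_congr e.toEquiv).symm.trans Subgroup.card_top)
    obtain ⟨e, he, he'⟩ : ∃ e : (⊤ : Subgroup S) ≃* (⊤ : Subgroup S), F.IsIso e ∧
        ∀ x, (e x : S) = φ.1 x := by
      have := F.exists_iso_of_mem_HomS φ.2
      rwa [hr] at this
    refine ⟨⟨e, he⟩, Subtype.ext (congrArg (homGraph ⊤) (MonoidHom.ext he'))⟩

/-- Points are sorted by whether the isotropy group projects onto `S`. This gives `|X| ≡ j |S|`
modulo `p |S|` with `j = |Aut_F(S) : Aut_S(S)|`, which is prime to `p` by the Sylow axiom for `S`.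
-/
theorem not_dvd_numOrbits {p : ℕ} [hp : Fact p.Prime] (hS : IsPGroup p S) (hF : F.IsSaturated p)
    {X : Biset S S} (hX : IsotropyIn F.graphs X.carrier) (hst : F.MarkStable X.carrier)
    (hm : mark X.carrier (diagonalGraph S) = mark (Biset.one S).carrier (diagonalGraph S)) :
    ¬ p ∣ X.numOrbits := by
  let j := (autS (⊤ : Subgroup S)).relIndex (F.autF ⊤)
  have hj : ¬ p ∣ j := by
    have := F.fullyNormalized_classRep ⊤
    rw [classRep_top] at this
    exact (hF.sylow ⊤ this).2
  have hcard (x : X.carrier) : Nat.card (MulAction.stabilizer (S × S) x) = Nat.card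
      ((MulAction.stabilizer (S × S) x).map (MonoidHom.snd S S)) := card_of_mem_graphs (hX x)
  let 𝒯 := {D : Subgroup (S × S) // D ∈ F.graphs ∧ D.map (MonoidHom.snd S S) = ⊤}
  -- Each of the `|Aut_F(S)|` graphs over `S` is a full isotropy group wherever it fixes a point,
  -- and by stability fixes `|Z(S)|` points; finally `|Aut_S(S)| · |Z(S)| = |S|`.
  have htop : Nat.card {x : X.carrier //
      (MulAction.stabilizer (S × S) x).map (MonoidHom.snd S S) = ⊤} = j * Nat.card S := by
    have := Fintype.ofFinite 𝒯
    let f (x : {x : X.carrier // (MulAction.stabilizer (S × S) x).map (MonoidHom.snd S S) = ⊤}) :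
      𝒯 := ⟨MulAction.stabilizer (S × S) x.1, hX x.1, x.2⟩
    have hfib (D : 𝒯) : Nat.card {x // f x = D} = mark X.carrier (diagonalGraph S) := by
      rw [← graphRep_eq_diagonalGraph (F := F) D.2.2, ← hst _ D.2.1]
      refine Nat.card_congr (Equiv.ofBijective (fun x => ⟨x.1.1, fun d hd => ?_⟩) ⟨?_, ?_⟩)
      · rw [← congrArg Subtype.val x.2] at hd
        exact hd
      · intro x y h
        exact Subtype.ext (Subtype.ext (congrArg (fun z => z.1) h))
      · rintro ⟨x, hx⟩
        have hle : D.1 ≤ MulAction.stabilizer (S × S) x := hx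
        have h1 : (MulAction.stabilizer (S × S) x).map (MonoidHom.snd S S) = ⊤ :=
          top_le_iff.1 (D.2.2 ▸ Subgroup.map_mono hle)
        refine ⟨⟨⟨x, h1⟩, Subtype.ext (Subgroup.eq_of_le_of_card_ge hle ?_).symm⟩, rfl⟩
        rw [hcard, h1, card_of_mem_graphs D.2.1, D.2.2]
    rw [← Nat.card_congr (Equiv.sigmaFiberEquiv f), Nat.card_sigma]
    simp only [hfib, Finset.sum_const, Finset.card_univ, smul_eq_mul]
    rw [← Nat.card_eq_fintype_card, card_graphs_top, hm,
      ← mark_one_mul_card_autS (S := S), ← Subgroup.index_mul_card ((autS ⊤).subgroupOf (F.autF ⊤)),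
      Nat.card_congr (Subgroup.subgroupOfEquivOfLe (F.autS_le_autF ⊤)).toEquiv]
    change j * _ * _ = _
    ring
  let L : SubMulAction (S × S) X.carrier :=
    ⟨{x | (MulAction.stabilizer (S × S) x).map (MonoidHom.snd S S) ≠ ⊤}, by
      intro t x hx h
      refine hx (Subgroup.eq_top_of_card_eq _ ?_)
      have e : conjSubgroup t (MulAction.stabilizer (S × S) x) =
        MulAction.stabilizer (S × S) (t • x) :=
          (MulAction.stabilizer_smul_eq_stabilizer_map_conj t x).symm
      rw [← hcard, ← card_conjSubgroup t, e, hcard, h, Subgroup.card_top]⟩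
  -- A graph over a proper subgroup `P` has index `|S : P| · |S|` in `S × S`.
  have hlow : p * Nat.card S ∣ Nat.card L := by
    refine dvd_card_of_forall_dvd_index (T := S × S) fun x => ?_
    rw [SubMulAction.stabilizer_of_subMul]
    have hx : (MulAction.stabilizer (S × S) x.1).map (MonoidHom.snd S S) ≠ ⊤ := x.2
    have h1 := Subgroup.card_mul_index (MulAction.stabilizer (S × S) x.1)
    rw [hcard, Nat.card_prod] at h1
    have h2 := Subgroup.index_mul_card ((MulAction.stabilizer (S × S) x.1).map (MonoidHom.snd S S))
    have h3 : p ∣ ((MulAction.stabilizer (S × S) x.1).map (MonoidHom.snd S S)).index := by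
      obtain ⟨n, hn⟩ := hS.index ((MulAction.stabilizer (S × S) x.1).map (MonoidHom.snd S S))
      rw [hn]
      refine dvd_pow_self p fun h0 => hx ?_
      rw [h0, pow_zero] at hn
      exact Subgroup.index_eq_one.1 hn
    have h4 : (MulAction.stabilizer (S × S) x.1).index =
        ((MulAction.stabilizer (S × S) x.1).map (MonoidHom.snd S S)).index * Nat.card S := by
      refine Nat.eq_of_mul_eq_mul_left (Nat.card_pos (α :=
        (MulAction.stabilizer (S × S) x.1).map (MonoidHom.snd S S))) ?_
      rw [h1]
      nth_rewrite 1 [← h2]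
      ring
    rw [h4]
    exact mul_dvd_mul_right h3 _
  have htotal : X.numOrbits * Nat.card S = j * Nat.card S + Nat.card L := by
    rw [Biset.numOrbits_mul_card, ← htop]
    classical
    rw [← Nat.card_sum]
    exact (Nat.card_congr (Equiv.sumCompl _)).symm
  intro hdvd
  have h5 : p * Nat.card S ∣ j * Nat.card S :=
    (Nat.dvd_add_left hlow).1 (htotal ▸ mul_dvd_mul_right hdvd _)
  exact hj (Nat.dvd_of_mul_dvd_mul_right Nat.card_pos h5)

theorem IsSaturated.exists_characteristicBiset {p : ℕ} [hp : Fact p.Prime] (hS : IsPGroup p S)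
    (hF : F.IsSaturated p) :
    ∃ Ω : Burnside S S, F.IsCharacteristicBiset p Ω ∧ IsIdempotentMod p Ω := by
  obtain ⟨Y, _, _, hY, hst, hm⟩ := hF.exists_markStable hS
  let X : Biset S S := Biset.ofProd Y fun h y hy => by
    have h1 : (h, (1 : S)) ∈ MulAction.stabilizer (S × S) y := hy
    obtain ⟨P, φ, hP⟩ := hY y
    rw [hP] at h1
    obtain ⟨h2, h3⟩ := mem_homGraph.1 h1
    exact h3.symm.trans (map_one φ.1)
  have hX : IsotropyIn F.graphs X.carrier := fun y => by
    have := Biset.stabilizer_ofProd Y (fun h y => X.free h y) y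
    exact this ▸ hY y
  have hXm (D) : mark X.carrier D = mark Y D := Biset.mark_ofProd Y _ D
  have hXst : F.MarkStable X.carrier := fun D hD => by rw [hXm, hXm, hst D hD]
  have hunit := not_dvd_numOrbits hS hF hX hXst ((hXm _).trans hm)
  obtain ⟨n, hn, hid⟩ := Burnside.exists_pow_isIdempotentMod hp.1.ne_zero (Burnside.ofBiset X)
  refine ⟨_, ⟨?_, pow_mem_burnside (ofBiset_mem_burnside hX) hn,
    (hXst.rightStable hX).pow hn, (hXst.leftStable hX).pow hn, ?_⟩, hid⟩
  · obtain ⟨Z, hZ⟩ := Burnside.exists_ofBiset_eq_pow X n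
    exact ⟨Z, hZ⟩
  · obtain ⟨Λ, hΛ⟩ := hid
    have h1 := congrArg Burnside.augmentation hΛ
    rw [map_sub, Burnside.augmentation_mul, map_nsmul] at h1
    -- Modulo `p` the augmentation of the power is an idempotent of a field; being nonzero, it is
    -- `1`.
    have h2 : ¬ (p : ℤ) ∣ Burnside.augmentation (Burnside.ofBiset X ^ n) := by
      rw [Burnside.augmentation_pow, Burnside.augmentation_ofBiset]
      intro h
      exact hunit (Int.natCast_dvd_natCast.1 ((Nat.prime_iff_prime_int.1 hp.1).dvd_of_dvd_pow h))
    have h3 : (p : ℤ) ∣ Burnside.augmentation (Burnside.ofBiset X ^ n) *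
        (Burnside.augmentation (Burnside.ofBiset X ^ n) - 1) :=
      ⟨Burnside.augmentation Λ, by rw [mul_sub, mul_one, h1, nsmul_eq_mul]⟩
    have h4 := ((Nat.prime_iff_prime_int.1 hp.1).dvd_or_dvd h3).resolve_left h2
    exact (Int.modEq_iff_dvd.2 h4).symm

end FusionSystem

/-! ### `p`-adic limits -/

section PAdic

variable {p : ℕ} [hp : Fact p.Prime]

/-- `t k` is the sum of `p ^ (j + 1) * c (j + k)` over `j ≥ 0`. The recursion expresses the
correction terms without a topology on the module. -/
theorem exists_padic_tails (c : ℕ → ℤ_[p]) :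
    ∃ t : ℕ → ℤ_[p], ∀ k, t k = p * (c k + t (k + 1)) := by
  have hs (k : ℕ) : Summable fun j : ℕ => (p : ℤ_[p]) ^ (j + 1) * c (j + k) := by
    refine Summable.of_norm_bounded (g := fun j : ℕ => ((p : ℝ)⁻¹) ^ j)
      (summable_geometric_of_lt_one (by positivity)
        (inv_lt_one_of_one_lt₀ (by exact_mod_cast hp.1.one_lt))) fun j => ?_
    rw [norm_mul, norm_pow, PadicInt.norm_p]
    have h1 : ‖c (j + k)‖ ≤ 1 := PadicInt.norm_le_one _
    have h2 : (p : ℝ)⁻¹ ≤ 1 := inv_le_one_of_one_le₀ (by exact_mod_cast hp.1.one_lt.le)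
    have h3 : (0 : ℝ) ≤ (p : ℝ)⁻¹ := by positivity
    calc ((p : ℝ)⁻¹) ^ (j + 1) * ‖c (j + k)‖ ≤ ((p : ℝ)⁻¹) ^ (j + 1) * 1 := by gcongr
      _ = ((p : ℝ)⁻¹) ^ j * (p : ℝ)⁻¹ := by rw [mul_one, pow_succ]
      _ ≤ ((p : ℝ)⁻¹) ^ j * 1 := by gcongr
      _ = _ := mul_one _
  refine ⟨fun k => ∑' j : ℕ, (p : ℤ_[p]) ^ (j + 1) * c (j + k), fun k => ?_⟩
  dsimp only
  rw [(hs k).tsum_eq_zero_add, mul_add, ← (hs (k + 1)).tsum_mul_left]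
  congr 1
  · simp
  · refine tsum_congr fun j => ?_
    rw [pow_succ' _ (j + 1), mul_assoc, show j + 1 + k = j + (k + 1) by ring]

variable {M : Type*} [AddCommGroup M] [Module ℤ_[p] M] [Module.Finite ℤ_[p] M]

/-- The increments are lifted along a surjection from a free module of finite rank and summed
coordinatewise. The quantity `x k + p ^ k f(t k)` does not depend on `k`, and its value is the
limit. -/
theorem exists_padic_limit (x : ℕ → M) (hx : ∀ k, ∃ y, x (k + 1) - x k = p ^ (k + 1) • y) :
    ∃ a, ∀ k, ∃ y, x k - a = p ^ k • y := by
  choose y hy using hx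
  obtain ⟨n, f, hf⟩ := Module.Finite.exists_fin' ℤ_[p] M
  choose c hc using fun k => hf (y k)
  choose t ht using fun i => exists_padic_tails fun k => c k i
  have hT (k : ℕ) : f (fun i => t i k) = p • (y k + f (fun i => t i (k + 1))) := by
    rw [← hc, ← map_add, ← map_nsmul]
    congr 1
    ext i
    rw [ht]
    simp [mul_add]
  have hinv (k : ℕ) : x k + p ^ k • f (fun i => t i k) = x 0 + f (fun i => t i 0) := by
    induction k with
    | zero => simp
    | succ k ih =>
      rw [← ih, hT k, eq_add_of_sub_eq (hy k), pow_succ, mul_smul, mul_smul, smul_add, smul_add]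
      abel
  refine ⟨x 0 + f (fun i => t i 0), fun k => ⟨-f (fun i => t i k), ?_⟩⟩
  rw [← hinv k, smul_neg]
  abel

/-- Krull's intersection theorem: a finite module over the Noetherian local ring `ℤ_p` is separated.
-/
theorem eq_zero_of_forall_pow_smul (a : M) (h : ∀ k, ∃ y, a = p ^ k • y) : a = 0 := by
  refine IsHausdorff.haus (I := IsLocalRing.maximalIdeal ℤ_[p]) inferInstance a fun k => ?_
  obtain ⟨y, rfl⟩ := h k
  rw [SModEq.zero]
  have : p ^ k • y = (p : ℤ_[p]) ^ k • y := by
    rw [← Nat.cast_pow, Nat.cast_smul_eq_nsmul]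
  rw [this]
  refine Submodule.smul_mem_smul (Ideal.pow_mem_pow ?_ k) trivial
  rw [PadicInt.maximalIdeal_eq_span_p]
  exact Ideal.mem_span_singleton_self _

/-- Additive maps preserve divisibility by `p ^ k`, so linear conditions pass to limits; membership
in a submodule is the case of its quotient map. -/
theorem map_eq_zero_of_padic_limit {N : Type*} [AddCommGroup N] {x : ℕ → N} {a : N}
    (hx : ∀ k, ∃ y, x k - a = p ^ k • y) (f : N →+ M) (hf : ∀ k, f (x k) = 0) : f a = 0 := by
  refine eq_zero_of_forall_pow_smul (p := p) _ fun k => ?_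
  obtain ⟨y, hy⟩ := hx k
  refine ⟨-f y, ?_⟩
  have := congrArg f hy
  rw [map_sub, hf, map_nsmul] at this
  rw [smul_neg, ← this, zero_sub, neg_neg]

end PAdic

/-! ### Multiplicativity in the completed Burnside ring -/

namespace BurnsideHat

variable {p : ℕ} [hp : Fact p.Prime] {G H K : Type u} [Group G] [Group H] [Group K]

theorem comp_of (x : Burnside H K) (y : Burnside G H) :
    comp (of p x) (of p y) = of p (Burnside.comp x y) := by
  change comp ((1 : ℤ_[p]) ⊗ₜ[ℤ] x) ((1 : ℤ_[p]) ⊗ₜ[ℤ] y) = (1 : ℤ_[p]) ⊗ₜ[ℤ] Burnside.comp x y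
  rw [comp_tmul, one_mul]

theorem of_mul [Finite G] (x y : Burnside G G) : of p (x * y) = of p x * of p y := by
  rw [← comp_eq_mul, comp_of, Burnside.mul_def]

theorem augmentation_tmul (a : ℤ_[p]) (x : Burnside G H) :
    augmentation (a ⊗ₜ[ℤ] x) = a * (Burnside.augmentation x : ℤ_[p]) := rfl

theorem augmentation_of (x : Burnside G H) :
    augmentation (of p x) = (Burnside.augmentation x : ℤ_[p]) :=
  one_mul _

theorem augmentation_mul [Finite G] (x y : BurnsideHat p G G) :
    augmentation (x * y) = augmentation x * augmentation y := by
  induction x using TensorProduct.induction_on with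
  | zero => simp
  | add x x' hx hx' => rw [add_mul, map_add, map_add, add_mul, hx, hx']
  | tmul a x =>
    induction y using TensorProduct.induction_on with
    | zero => simp
    | add y y' hy hy' => rw [mul_add, map_add, map_add, mul_add, hy, hy']
    | tmul b y =>
      rw [Algebra.TensorProduct.tmul_mul_tmul, augmentation_tmul, augmentation_tmul,
        augmentation_tmul, Burnside.augmentation_mul]
      push_cast
      ring

end BurnsideHat

/-! ### The characteristic idempotent as a limit -/

namespace FusionSystem

variable {S : Type u} [Group S] [Finite S] {F : FusionSystem S} {p : ℕ} [hp : Fact p.Prime]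

theorem of_mem_burnsideHat {x : Burnside S S} (hx : x ∈ F.burnside) :
    BurnsideHat.of p x ∈ F.burnsideHat p := by
  have : F.burnside ≤ (F.burnsideHat p).toAddSubgroup.comap (BurnsideHat.of p) := by
    refine (AddSubgroup.closure_le _).2 ?_
    rintro _ ⟨P, φ, rfl⟩
    exact Submodule.subset_span ⟨P, φ, rfl⟩
  exact this hx

theorem IsCharacteristicBiset.exists_limit {Ω : Burnside S S} (hΩ : F.IsCharacteristicBiset p Ω)
    (hid : IsIdempotentMod p Ω) :
    ∃ ω : BurnsideHat p S S, F.IsCharacteristicIdempotent p ω ∧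
      PAdicTendsto p (fun k => BurnsideHat.of p (Ω ^ p ^ k)) ω := by
  have hpos (k : ℕ) : 0 < p ^ k := pow_pos hp.1.pos k
  obtain ⟨ω, hω⟩ := exists_padic_limit (p := p) (fun k => BurnsideHat.of p (Ω ^ p ^ k)) fun k => by
    obtain ⟨y, hy⟩ := (Burnside.exists_pow_sub_pow hp.1.ne_zero hid k).1
    exact ⟨BurnsideHat.of p y, by rw [← map_sub, hy, map_nsmul]⟩
  refine ⟨ω, ?_, fun n => ⟨n, fun k hk => ?_⟩⟩
  swap
  · obtain ⟨y, hy⟩ := hω k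
    refine ⟨p ^ (k - n) • y, ?_⟩
    rw [hy, smul_smul, ← pow_add, Nat.add_sub_cancel' hk]
  have hidem : ω * ω = ω := by
    rw [← sub_eq_zero]
    refine eq_zero_of_forall_pow_smul (p := p) _ fun k => ?_
    obtain ⟨y, hy⟩ := hω k
    obtain ⟨z, hz⟩ := (Burnside.exists_pow_sub_pow hp.1.ne_zero hid k).2
    have hz' := congrArg (BurnsideHat.of p) hz
    rw [map_sub, BurnsideHat.of_mul, map_nsmul] at hz'
    set x := BurnsideHat.of p (Ω ^ p ^ k)
    have hx : x = ω + p ^ k • y := eq_add_of_sub_eq' hy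
    -- Substituting `x = ω + p ^ k y` into `x² - x = p ^ (k + 1) z` and solving for `ω² - ω` gives
    -- this quotient.
    refine ⟨p • BurnsideHat.of p z - x * y - y * ω + y, ?_⟩
    have h1 : x * x = ω * ω + p ^ k • (y * ω) + p ^ k • (x * y) := by
      nth_rewrite 2 [hx]
      rw [mul_add, mul_smul_comm]
      nth_rewrite 1 [hx]
      rw [add_mul, smul_mul_assoc]
    rw [h1, pow_succ, mul_smul] at hz'
    rw [smul_add, smul_sub, smul_sub, ← hz']
    rw [sub_eq_iff_eq_add] at hy
    rw [hy]
    abel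
  have haug : BurnsideHat.augmentation ω = 1 := by
    have h1 := congrArg BurnsideHat.augmentation hidem
    rw [BurnsideHat.augmentation_mul] at h1
    have h2 : BurnsideHat.augmentation ω * (BurnsideHat.augmentation ω - 1) = 0 := by
      rw [mul_sub, mul_one, h1, sub_self]
    -- An idempotent of the domain `ℤ_p` is `0` or `1`. The value `0` would make `ε(Ω) ^ p`, the
    -- augmentation of the term with index `1`, divisible by `p`, against `ε(Ω) ≡ 1`.
    refine sub_eq_zero.1 ((mul_eq_zero.1 h2).resolve_left fun h0 => ?_)
    obtain ⟨y, hy⟩ := hω 1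
    have h3 := congrArg BurnsideHat.augmentation hy
    rw [map_sub, h0, sub_zero, BurnsideHat.augmentation_of, Burnside.augmentation_pow, map_nsmul,
      pow_one, nsmul_eq_mul] at h3
    have h4 : ((Burnside.augmentation Ω ^ p : ℤ) : ZMod p) = 0 := by
      have := congrArg (PadicInt.toZMod (p := p)) h3
      rw [map_intCast, map_mul, map_natCast, ZMod.natCast_self, zero_mul] at this
      exact this
    have h5 : (Burnside.augmentation Ω : ZMod p) = ((1 : ℤ) : ZMod p) :=
      (ZMod.intCast_eq_intCast_iff _ _ _).2 hΩ.augmentation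
    rw [Int.cast_pow, h5, Int.cast_one, one_pow] at h4
    exact one_ne_zero h4
  refine ⟨hidem, ?_, fun P φ => ?_, fun P φ => ?_, haug⟩
  · have := map_eq_zero_of_padic_limit hω (F.burnsideHat p).mkQ.toAddMonoidHom fun k =>
      (Submodule.Quotient.mk_eq_zero _).2 (of_mem_burnsideHat (pow_mem_burnside hΩ.mem (hpos k)))
    exact (Submodule.Quotient.mk_eq_zero _).1 this
  · rw [← sub_eq_zero]
    exact map_eq_zero_of_padic_limit hω
      (BurnsideHat.comp.flip (BurnsideHat.of p (restrictAlong φ.1)) -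
        BurnsideHat.comp.flip (BurnsideHat.of p (restrictAlong P.subtype))).toAddMonoidHom
      fun k => sub_eq_zero.2 ((BurnsideHat.comp_of _ _).trans
        ((congrArg (BurnsideHat.of p) (hΩ.rightStable.pow (hpos k) P φ)).trans
          (BurnsideHat.comp_of _ _).symm))
  · rw [← sub_eq_zero]
    exact map_eq_zero_of_padic_limit hω
      (BurnsideHat.comp (BurnsideHat.basis p φ.1.range (F.toImage φ).symm.toMonoidHom) -
        BurnsideHat.comp (BurnsideHat.basis p P (MonoidHom.id P))).toAddMonoidHom
      fun k => sub_eq_zero.2 ((BurnsideHat.comp_of _ _).trans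
        ((congrArg (BurnsideHat.of p) (hΩ.leftStable.pow (hpos k) P φ)).trans
          (BurnsideHat.comp_of _ _).symm))

end FusionSystem

theorem mainTheorem7 {p : ℕ} [Fact p.Prime] {S : Type u} [Group S] [Finite S]
    (hS : IsPGroup p S) (F : FusionSystem S) (hF : F.IsSaturated p) :
    (∃ Ω : Burnside S S, F.IsCharacteristicBiset p Ω ∧ IsIdempotentMod p Ω) ∧
      ∀ Ω : Burnside S S, F.IsCharacteristicBiset p Ω → IsIdempotentMod p Ω →
        ∃ ω : BurnsideHat p S S, F.IsCharacteristicIdempotent p ω ∧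
          PAdicTendsto p (fun k => BurnsideHat.of p (Ω ^ p ^ k)) ω :=
  ⟨hF.exists_characteristicBiset hS, fun _ hΩ hid => hΩ.exists_limit hid⟩
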